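/- Let $J,K$ be natural numbers and consider $2\times J\times K$ tables $X=(X_{ijk})$ of nonnegative integers, $i\in\{1,2\}$, $1\le j\le J$, $1\le k\le K$, where $X_{1jk}$ and $X_{2jk}$ are the numbers of successes and failures at level $(j,k)$; a subscript $+$ denotes summation over that index. The bivariate logistic regression model with equally spaced levels is the set of all $(p_{jk})$ with $0<p_{jk}<1$ and $\log\frac{p_{jk}}{1-p_{jk}}=\mu+\alpha j+\beta k$ for some $\mu,\alpha,\beta\in\mathbb R$; its likelihood is $L_p(X)=\prod_{j,k}\binom{X_{+jk}}{X_{1jk}}p_{jk}^{X_{1jk}}(1-p_{jk})^{X_{2jk}}$. Let $$A=\begin{pmatrix}1&1&\cdots&1\\1&2&\cdots&J\end{pmatrix},\qquad B=\begin{pmatrix}1&1&\cdots&1\\1&2&\cdots&K\end{pmatrix}.$$ Let $A\otimes B$ be their Segre product, the $4\times JK$ matrix whose column at $(j,k)$ is the $j$-th column of $A$ stacked on the $k$-th column of $B$, and let $$\Lambda(A\otimes B)=\begin{pmatrix}A\otimes B&0\\E_{JK}&E_{JK}\end{pmatrix}$$ be its Lawrence lifting, where $E_{JK}$ is the identity matrix,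 the first $JK$ columns correspond to the cells $(1,j,k)$ and the last $JK$ columns to the cells $(2,j,k)$. The fiber of an integer vector $b$ is the set of all tables $X$ with $\Lambda(A\otimes B)X=b$. (i) $\Lambda(A\otimes B)$ is the configuration of the model: for every table $X$, the vector $\Lambda(A\otimes B)X$ consists of $X_{1++}$ (twice), $\sum_j jX_{1j+}$, $\sum_k kX_{1+k}$ and all $X_{+jk}$; and for tables $X,Y$ with $X_{+jk}=Y_{+jk}$ for all $j,k$, one has $\Lambda(A\otimes B)X=\Lambda(A\otimes B)Y$ if and only if there is a constant $r$ with $L_p(X)=r\,L_p(Y)$ for all $p$ in the model. (ii) Let $\boldsymbol e_{jk}$ be the $2\times J\times K$ integer array with $1$ at $(1,j,k)$, $-1$ at $(2,j,k)$ and $0$ elsewhere, and let $\mathcal B_{\Lambda(A\otimes B)}$ be the set of all $z$ with $\Lambda(A\otimes B)z=0$ of the form $z=\boldsymbol e_{j_1k_1}-\boldsymbol e_{j_2k_2}-\boldsymbol e_{j_3k_3}+\boldsymbol e_{j_4k_4}$ with $(j_1,k_1)-(j_2,k_2)=(j_3,k_3)-(j_4,k_4)$ in $\mathbb Z^2$.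 Then $\mathcal B_{\Lambda(A\otimes B)}$ connects every fiber whose tables satisfy $X_{+jk}>0$ for all $j,k$: for any two tables $X,Y$ in such a fiber there are $z_1,\dots,z_n\in\mathcal B_{\Lambda(A\otimes B)}$ (with $n\ge 0$) such that $Y=X+z_1+\dots+z_n$ and every partial sum $X+z_1+\dots+z_s$, $0\le s\le n$, lies in the fiber (in particular, is nonnegative). -/

import Mathlib

namespace BivariateLogistic

/-- The configuration of univariate Poisson regression with levels `1, …, J`: the first row is
`1, …, 1` and the second row is `1, 2, …, J` (the index `j : Fin J` stands for the level `j + 1`). -/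
def poissonConfig (J : ℕ) : Matrix (Fin 2) (Fin J) ℤ :=
  Matrix.of ![fun _ => 1, fun j => ((j : ℕ) : ℤ) + 1]

/-- The Segre product `A ⊗ B`: the column at `(j, k)` is the `j`-th column of `A` stacked on the
`k`-th column of `B`. -/
def segreProduct {m n ι κ : Type*} (A : Matrix m ι ℤ) (B : Matrix n κ ℤ) :
    Matrix (m ⊕ n) (ι × κ) ℤ :=
  Matrix.of fun r c => Sum.elim (fun a => A a c.1) (fun b => B b c.2) r

/-- The Lawrence lifting `Λ(A)`, the block matrix with rows `(A, 0)` and `(E, E)`. The first block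
of columns is indexed by the cells `(0, c)`, the second one by the cells `(1, c)`. -/
def lawrenceLifting {m ι : Type*} [DecidableEq ι] (A : Matrix m ι ℤ) :
    Matrix (m ⊕ ι) (Fin 2 × ι) ℤ :=
  (Matrix.fromBlocks A 0 1 1).submatrix id
    (fun c => if c.1 = 0 then Sum.inl c.2 else Sum.inr c.2)

/-- The cells of a `2 × J × K` table. The first coordinate is the response:
`0` for successes (`i = 1`), `1` for failures (`i = 2`). -/
abbrev Cell (J K : ℕ) : Type := Fin 2 × (Fin J × Fin K)

/-- The rows of the matrix `Λ(A ⊗ B)`. -/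
abbrev StatIndex (J K : ℕ) : Type := (Fin 2 ⊕ Fin 2) ⊕ (Fin J × Fin K)

/-- The matrix `Λ(A ⊗ B)`, where `A` and `B` are the univariate configurations with levels
`1, …, J` and `1, …, K`. -/
def config (J K : ℕ) : Matrix (StatIndex J K) (Cell J K) ℤ :=
  lawrenceLifting (segreProduct (poissonConfig J) (poissonConfig K))

/-- `Λ(A ⊗ B) x` for a table `x` of frequencies. -/
def statistic {J K : ℕ} (x : Cell J K → ℕ) : StatIndex J K → ℤ :=
  (config J K).mulVec (fun c => (x c : ℤ))

/-- The response marginal `X_{+jk}`. -/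
def responseMarginal {J K : ℕ} (x : Cell J K → ℕ) (j : Fin J) (k : Fin K) : ℕ :=
  ∑ i : Fin 2, x (i, (j, k))

/-- The sufficient statistic of bivariate logistic regression, that is `X_{1++}`, `∑ j X_{1j+}`,
`X_{1++}` again, `∑ k X_{1+k}`, and all the `X_{+jk}`. -/
def sufficientStatistic {J K : ℕ} (x : Cell J K → ℕ) : StatIndex J K → ℤ :=
  Sum.elim
    (Sum.elim
      ![∑ j : Fin J, ∑ k : Fin K, (x (0, (j, k)) : ℤ),
        ∑ j : Fin J, (((j : ℕ) : ℤ) + 1) * ∑ k : Fin K, (x (0, (j, k)) : ℤ)]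
      ![∑ j : Fin J, ∑ k : Fin K, (x (0, (j, k)) : ℤ),
        ∑ k : Fin K, (((k : ℕ) : ℤ) + 1) * ∑ j : Fin J, (x (0, (j, k)) : ℤ)])
    (fun c => (responseMarginal x c.1 c.2 : ℤ))

/-- The bivariate logistic regression model: the families of success probabilities
`p_{jk} ∈ (0, 1)` with `logit p_{jk} = μ + α j + β k` for some real `μ`, `α`, `β`. -/
def model (J K : ℕ) : Set (Fin J → Fin K → ℝ) :=
  {p | (∀ j k, 0 < p j k ∧ p j k < 1) ∧ ∃ μ α β : ℝ, ∀ j k,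
    Real.log (p j k / (1 - p j k)) = μ + α * ((j : ℕ) + 1 : ℝ) + β * ((k : ℕ) + 1 : ℝ)}

/-- The probability of the table `x` when the numbers of successes at the levels `(j, k)` are
independent binomial variables with `X_{+jk}` trials and success probability `p_{jk}`. -/
noncomputable def likelihood {J K : ℕ} (p : Fin J → Fin K → ℝ) (x : Cell J K → ℕ) : ℝ :=
  ∏ j : Fin J, ∏ k : Fin K,
    ((responseMarginal x j k).choose (x (0, (j, k))) : ℝ) *
      p j k ^ x (0, (j, k)) * (1 - p j k) ^ x (1, (j, k))

/-- The fiber of the tables of frequencies with `Λ(A ⊗ B) x = b`. -/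
def fiber {J K : ℕ} (b : StatIndex J K → ℤ) : Set (Cell J K → ℕ) :=
  {x | statistic x = b}

/-- The integer array `e_{jk}`, with `1` at `(1, j, k)`, `-1` at `(2, j, k)` and `0` elsewhere. -/
def arrayE {J K : ℕ} (j : Fin J) (k : Fin K) : Cell J K → ℤ :=
  Pi.single (0, (j, k)) 1 - Pi.single (1, (j, k)) 1

/-- The set of moves `e_{j₁k₁} - e_{j₂k₂} - e_{j₃k₃} + e_{j₄k₄}` with
`(j₁, k₁) - (j₂, k₂) = (j₃, k₃) - (j₄, k₄)` as integer vectors. -/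
def moves (J K : ℕ) : Set (Cell J K → ℤ) :=
  {z | (config J K).mulVec z = 0 ∧
    ∃ (j₁ j₂ j₃ j₄ : Fin J) (k₁ k₂ k₃ k₄ : Fin K),
      z = arrayE j₁ k₁ - arrayE j₂ k₂ - arrayE j₃ k₃ + arrayE j₄ k₄ ∧
      ((j₁ : ℕ) : ℤ) - ((j₂ : ℕ) : ℤ) = ((j₃ : ℕ) : ℤ) - ((j₄ : ℕ) : ℤ) ∧
      ((k₁ : ℕ) : ℤ) - ((k₂ : ℕ) : ℤ) = ((k₃ : ℕ) : ℤ) - ((k₄ : ℕ) : ℤ)}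

/-- The set of moves `M` connects the set of tables `F`: any two tables of `F` are joined by
finitely many steps, each of which adds an element of `M` and stays in `F`. -/
def Connects {J K : ℕ} (M : Set (Cell J K → ℤ)) (F : Set (Cell J K → ℕ)) : Prop :=
  ∀ x ∈ F, ∀ y ∈ F,
    Relation.ReflTransGen
      (fun u v : Cell J K → ℕ =>
        u ∈ F ∧ v ∈ F ∧ ∃ z ∈ M, ∀ c, (v c : ℤ) = (u c : ℤ) + z c) x y

end BivariateLogistic

namespace BivariateLogistic

/-! ### Runs of integer flows on a line -/

/-- Between a nonempty site and a site that is not full there is a pair of neighbours with the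
same property, as all the capacities are positive. -/
theorem exists_hop {x n : ℤ → ℤ} {a b : ℤ} (hab : a < b)
    (hn : ∀ k, a ≤ k → k ≤ b → 1 ≤ n k) (ha : 0 < x a) (hb : x b < n b) :
    ∃ k, a ≤ k ∧ k < b ∧ 0 < x k ∧ x (k + 1) < n (k + 1) := by
  obtain ⟨m, rfl⟩ : ∃ m : ℕ, b = a + 1 + m := ⟨(b - a - 1).toNat, by omega⟩
  induction m with
  | zero => exact ⟨a, le_rfl, by omega, ha, by simpa using hb⟩
  | succ m ih =>
    by_cases h : x (a + 1 + m) < n (a + 1 + m)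
    · obtain ⟨k, h1, h2, h3⟩ := ih (by omega) (fun k h1 h2 => hn k h1 (by omega)) h
      exact ⟨k, h1, by omega, h3⟩
    · have := hn (a + 1 + m) (by omega) (by omega)
      refine ⟨a + 1 + m, by omega, by omega, by omega, ?_⟩
      have e : a + 1 + (m : ℤ) + 1 = a + 1 + ((m + 1 : ℕ) : ℤ) := by push_cast; ring
      rwa [e]

/-- The left end of the maximal interval of positivity around `k`. -/
theorem exists_left_end {F : ℤ → ℤ} {lo k : ℤ} (hlo : ∀ i, i ≤ lo → F i ≤ 0) (hk : 0 < F k) :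
    ∃ l ≤ k, F (l - 1) < F l ∧ ∀ i, l ≤ i → i ≤ k → 0 < F i := by
  have hlk : lo < k := by
    by_contra h
    exact absurd (hlo k (by omega)) (by omega)
  obtain ⟨l, hl, hmin⟩ := Int.exists_least_of_bdd
    (P := fun l => l ≤ k ∧ ∀ i, l ≤ i → i ≤ k → 0 < F i)
    ⟨lo, fun z hz => by
      by_contra h
      exact absurd (hz.2 lo (by omega) (by omega)) (by have := hlo lo le_rfl; omega)⟩
    ⟨k, le_rfl, fun i h1 h2 => by rwa [le_antisymm h2 h1]⟩
  refine ⟨l, hl.1, ?_, hl.2⟩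
  by_contra h
  have hp : 0 < F (l - 1) := by have := hl.2 l le_rfl hl.1; omega
  have := hmin (l - 1) ⟨by have := hl.1; omega, fun i h1 h2 => by
    rcases eq_or_lt_of_le h1 with h3 | h3
    · rwa [← h3]
    · exact hl.2 i (by omega) h2⟩
  omega

/-- The right end of the maximal interval of positivity around `k`. -/
theorem exists_right_end {F : ℤ → ℤ} {hi k : ℤ} (hhi : ∀ i, hi ≤ i → F i ≤ 0) (hk : 0 < F k) :
    ∃ r, k < r ∧ F r < F (r - 1) ∧ ∀ i, k ≤ i → i < r → 0 < F i := by
  obtain ⟨l, h1, h2, h3⟩ := exists_left_end (F := fun i => F (-i)) (lo := -hi) (k := -k)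
    (fun i h => hhi _ (by omega)) (by simpa using hk)
  refine ⟨-l + 1, by omega, ?_, fun i h4 h5 => ?_⟩
  · have e1 : -(l - 1) = -l + 1 := by ring
    have e2 : -l + 1 - 1 = -l := by ring
    rw [e2, ← e1]
    exact h2
  · simpa using h3 (-i) (by omega) (by omega)

/-- A run of a flow: a source `a` and a sink `b` without a source between them. -/
theorem exists_run {F : ℤ → ℤ} {lo hi k : ℤ} (hlo : ∀ i, i ≤ lo → F i ≤ 0)
    (hhi : ∀ i, hi ≤ i → F i ≤ 0) (hk : 0 < F k) :
    ∃ a b, a < b ∧ F (a - 1) < F a ∧ F b < F (b - 1) ∧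
      (∀ i, a < i → i < b → F i ≤ F (i - 1)) ∧ ∀ i, a ≤ i → i < b → 0 < F i := by
  obtain ⟨l, hl1, hl2, -⟩ := exists_left_end hlo hk
  obtain ⟨r, hr1, hr2, hr3⟩ := exists_right_end hhi hk
  -- The last source before `r`. After it `F` does not increase, so positivity at `r - 1` propagates
  -- back to `a`.
  obtain ⟨a, ha, hmax⟩ := Int.exists_greatest_of_bdd
    (P := fun a => a < r ∧ F (a - 1) < F a) ⟨r, fun z hz => hz.1.le⟩ ⟨l, by omega, hl2⟩
  have hmid : ∀ i, a < i → i < r → F i ≤ F (i - 1) := fun i h1 h2 => by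
    by_contra h
    exact absurd (hmax i ⟨h2, by omega⟩) (by omega)
  refine ⟨a, r, ha.1, ha.2, hr2, hmid, ?_⟩
  have key : ∀ m : ℕ, a ≤ r - 1 - m → 0 < F (r - 1 - m) := by
    intro m
    induction m with
    | zero => intro _; exact hr3 _ (by omega) (by omega)
    | succ m ih =>
      intro h
      have h1 := ih (by push_cast at h; omega)
      have h2 := hmid (r - 1 - m) (by push_cast at h; omega) (by omega)
      have e : r - 1 - (m : ℤ) - 1 = r - 1 - ((m + 1 : ℕ) : ℤ) := by push_cast; ring
      rw [e] at h2
      omega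
  intro i h1 h2
  have := key (r - 1 - i).toNat (by omega)
  rwa [show r - 1 - ((r - 1 - i).toNat : ℤ) = i by omega] at this

/-- A run of a flow in the opposite direction. -/
theorem exists_neg_run {F : ℤ → ℤ} {lo hi k : ℤ} (hlo : ∀ i, i ≤ lo → 0 ≤ F i)
    (hhi : ∀ i, hi ≤ i → 0 ≤ F i) (hk : F k < 0) :
    ∃ q p, q < p ∧ F (p - 1) < F p ∧ F q < F (q - 1) ∧
      (∀ i, q < i → i < p → F i ≤ F (i - 1)) ∧ ∀ i, q ≤ i → i < p → F i < 0 := by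
  -- The reflection `j ↦ -j` of the sites sends the edge `i`, from `i` to `i + 1`, to the edge `-i -
  -- 1` and reverses its direction.
  obtain ⟨a, b, h1, h2, h3, h4, h5⟩ := exists_run (F := fun i => -F (-i - 1))
    (lo := -hi - 1) (hi := -lo - 1) (k := -k - 1)
    (fun i h => by have := hhi (-i - 1) (by omega); omega)
    (fun i h => by have := hlo (-i - 1) (by omega); omega)
    (by rw [show -(-k - 1) - 1 = k by ring]; omega)
  refine ⟨-b, -a, by omega, ?_, ?_, fun i h6 h7 => ?_, fun i h6 h7 => ?_⟩
  · rw [show -(a - 1) - 1 = -a by ring] at h2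
    omega
  · rw [show -(b - 1) - 1 = -b by ring] at h3
    omega
  · have := h4 (-i) (by omega) (by omega)
    rw [show -(-i) - 1 = i - 1 by ring, show -(-i - 1) - 1 = i by ring] at this
    omega
  · have := h5 (-i - 1) (by omega) (by omega)
    rw [show -(-i - 1) - 1 = i by ring] at this
    omega

/-! ### Separable convex functions along a flow -/

/-- The differences of `φ` increase, by at most one at a time. -/
structure SlowConvex (φ : ℤ → ℤ) : Prop where
  mono : ∀ x, φ (x + 1) - φ x ≤ φ (x + 1 + 1) - φ (x + 1)
  step : ∀ x, φ (x + 1 + 1) - φ (x + 1) ≤ φ (x + 1) - φ x + 1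

theorem SlowConvex.diff_mono {φ : ℤ → ℤ} (h : SlowConvex φ) {x y : ℤ} (hxy : x ≤ y) :
    φ (x + 1) - φ x ≤ φ (y + 1) - φ y := by
  obtain ⟨m, rfl⟩ : ∃ m : ℕ, y = x + m := ⟨(y - x).toNat, by omega⟩
  induction m with
  | zero => simp
  | succ m ih =>
    have h1 := ih (by omega)
    have h2 := h.mono (x + m)
    have e : x + ((m + 1 : ℕ) : ℤ) = x + m + 1 := by push_cast; ring
    rw [e]
    omega

theorem SlowConvex.add_le {φ : ℤ → ℤ} (h : SlowConvex φ) {p r d : ℤ} (hpr : p ≤ r) (hd : 0 ≤ d) :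
    φ r + φ (p + d) ≤ φ p + φ (r + d) := by
  obtain ⟨m, rfl⟩ : ∃ m : ℕ, d = m := ⟨d.toNat, by omega⟩
  clear hd
  induction m with
  | zero => simp [add_comm]
  | succ m ih =>
    have h2 := h.diff_mono (x := p + m) (y := r + m) (by omega)
    have e : ∀ z : ℤ, z + ((m + 1 : ℕ) : ℤ) = z + m + 1 := fun z => by push_cast; ring
    rw [e, e]
    omega

/-- The indicator function of the edges `a, …, a + t - 1`. -/
def edgeFlow (a t : ℤ) (e : ℤ) : ℤ := if a ≤ e ∧ e < a + t then 1 else 0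

/-- The state reached from `c` by a flow, `F e` being the net number of units that pass from the
site `e` to the site `e + 1`. -/
def flowState (c F : ℤ → ℤ) (j : ℤ) : ℤ := c j - F j + F (j - 1)

theorem sum_edgeFlow {I : Finset ℤ} {x t : ℤ} (ht : 0 ≤ t) (hx : ∀ e, x ≤ e → e < x + t → e ∈ I) :
    ∑ e ∈ I, edgeFlow x t e = t := by
  simp only [edgeFlow]
  rw [← Finset.sum_filter]
  have : I.filter (fun e => x ≤ e ∧ e < x + t) = Finset.Ico x (x + t) := by
    ext e
    simp only [Finset.mem_filter, Finset.mem_Ico]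
    exact ⟨fun h => h.2, fun h => ⟨hx e h.1 h.2, h⟩⟩
  rw [this]
  simp
  omega

/-- Both runs have `t` edges, so removing an exchange keeps the flow balanced. -/
theorem sum_sub_exchange {I : Finset ℤ} {F : ℤ → ℤ} {a k t : ℤ} (ht : 0 ≤ t)
    (hA : ∀ e, a ≤ e → e < a + t → 0 < F e) (hB : ∀ e, k ≤ e → e < k + t → F e < 0)
    (hF : ∀ i, F i ≠ 0 → i ∈ I) :
    ∑ e ∈ I, (F e - (edgeFlow a t e - edgeFlow k t e)) = ∑ e ∈ I, F e := by
  simp only [Finset.sum_sub_distrib]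
  rw [sum_edgeFlow ht (fun e h1 h2 => hF e (hA e h1 h2).ne'),
    sum_edgeFlow ht (fun e h1 h2 => hF e (hB e h1 h2).ne)]
  ring

theorem sub_exchange_eq_zero {F : ℤ → ℤ} {a k t : ℤ}
    (hA : ∀ e, a ≤ e → e < a + t → 0 < F e) (hB : ∀ e, k ≤ e → e < k + t → F e < 0) {e : ℤ}
    (he : F e = 0) : F e - (edgeFlow a t e - edgeFlow k t e) = 0 := by
  have h1 := hA e
  have h2 := hB e
  simp only [edgeFlow]
  split_ifs <;> omega

/-- The exchange takes one unit off edges where `F` has the same sign, so no `|F e|` grows and the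
one at `a` drops. This is the measure for the inductions along a flow. -/
theorem sum_abs_sub_exchange_lt {I : Finset ℤ} {F : ℤ → ℤ} {a k t : ℤ} (ht : 1 ≤ t)
    (hA : ∀ e, a ≤ e → e < a + t → 0 < F e) (hB : ∀ e, k ≤ e → e < k + t → F e < 0)
    (hF : ∀ i, F i ≠ 0 → i ∈ I) :
    (∑ e ∈ I, |F e - (edgeFlow a t e - edgeFlow k t e)|).toNat < (∑ e ∈ I, |F e|).toNat := by
  have h1 : ∑ e ∈ I, |F e - (edgeFlow a t e - edgeFlow k t e)| < ∑ e ∈ I, |F e| := by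
    have h2 := hA a le_rfl (by omega)
    refine Finset.sum_lt_sum (fun e _ => ?_) ⟨a, hF a h2.ne', ?_⟩
    · have h3 := hA e
      have h4 := hB e
      simp only [edgeFlow]
      rcases abs_cases (F e) with h' | h' <;> rw [h'.1, abs_le] <;> split_ifs <;> omega
    · have h4 := hB a
      simp only [edgeFlow]
      rw [abs_of_pos h2, abs_lt]
      split_ifs <;> omega
  have h2 : 0 ≤ ∑ e ∈ I, |F e - (edgeFlow a t e - edgeFlow k t e)| :=
    Finset.sum_nonneg fun i _ => abs_nonneg _
  omega

/-- If every elementary exchange of units along the edges in `A` and `B` raises a separable convex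
function by at least `s`, then so does every nonzero balanced flow. -/
theorem le_of_flow {I : Finset ℤ} {lo hi : ℤ} {c : ℤ → ℤ} {φ : ℤ → ℤ → ℤ} {A B : ℤ → Prop}
    {s : ℤ} (hI : ∀ i ∈ I, lo < i ∧ i < hi)
    (hφ : ∀ j, SlowConvex (φ j)) (hs : 1 ≤ s)
    (H : ∀ i k t, 1 ≤ t → (∀ e, i ≤ e → e < i + t → A e) → (∀ e, k ≤ e → e < k + t → B e) →
      ∑ j ∈ I, φ j (c j) + s ≤
        ∑ j ∈ I, φ j (flowState c (fun e => edgeFlow i t e - edgeFlow k t e) j))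
    (F : ℤ → ℤ) (hF : ∀ i, F i ≠ 0 → i ∈ I) (hsum : ∑ i ∈ I, F i = 0) (hne : ∃ i, F i ≠ 0)
    (hA : ∀ i, 0 < F i → A i) (hB : ∀ i, F i < 0 → B i) :
    ∑ j ∈ I, φ j (c j) + s ≤ ∑ j ∈ I, φ j (flowState c F j) := by
  induction hN : (∑ i ∈ I, |F i|).toNat using Nat.strong_induction_on generalizing F with
  | _ N ih =>
  subst hN
  have hlo : ∀ i, i ≤ lo → F i = 0 := fun i h => by
    by_contra h1
    have := (hI i (hF i h1)).1
    omega
  have hhi : ∀ i, hi ≤ i → F i = 0 := fun i h => by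
    by_contra h1
    have := (hI i (hF i h1)).2
    omega
  obtain ⟨kp, hkp⟩ : ∃ i, 0 < F i := by
    by_contra! h
    obtain ⟨i, hi0⟩ := hne
    have := Finset.sum_lt_sum (s := I) (f := F) (g := fun _ => 0) (fun i _ => h i)
      ⟨i, hF i hi0, lt_of_le_of_ne (h i) hi0⟩
    simp [hsum] at this
  obtain ⟨kn, hkn⟩ : ∃ i, F i < 0 := by
    by_contra! h
    have := Finset.sum_lt_sum (s := I) (f := fun _ => 0) (g := F) (fun i _ => h i)
      ⟨kp, hF kp (by omega), hkp⟩
    simp [hsum] at this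
  obtain ⟨a, b, hab, ha, hb, hmid, hpos⟩ :=
    exists_run (fun i h => (hlo i h).le) (fun i h => (hhi i h).le) hkp
  obtain ⟨q, p, hqp, hp, hq, hmid', hneg⟩ :=
    exists_neg_run (fun i h => (hlo i h).ge) (fun i h => (hhi i h).ge) hkn
  -- Both units start at the sources `a` and `p` of their runs and travel the length of the shorter
  -- run. Hence at least one of them ends in a sink; the other may stop midway.
  obtain ⟨t, ht1, htb, htq, ht⟩ : ∃ t, 1 ≤ t ∧ a + t ≤ b ∧ q ≤ p - t ∧ (a + t = b ∨ p - t = q) :=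
    ⟨min (b - a) (p - q), by omega, by omega, by omega, by omega⟩
  set k := p - t with hk
  have hpk : p = k + t := by omega
  set G : ℤ → ℤ := fun e => edgeFlow a t e - edgeFlow k t e with hG
  have hposA : ∀ e, a ≤ e → e < a + t → 0 < F e := fun e h1 h2 => hpos e h1 (by omega)
  have hnegB : ∀ e, k ≤ e → e < k + t → F e < 0 := fun e h1 h2 => hneg e (by omega) (by omega)
  have hbase : ∑ j ∈ I, φ j (c j) + s ≤ ∑ j ∈ I, φ j (flowState c G j) :=
    H a k t ht1 (fun e h1 h2 => hA e (hposA e h1 h2))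
    (fun e h1 h2 => hB e (hnegB e h1 h2))
  have hGF : ∀ e, (G e = 1 ∧ 0 < F e ∧ a ≤ e ∧ e < a + t ∧ ¬ (k ≤ e ∧ e < k + t)) ∨
      (G e = -1 ∧ F e < 0 ∧ k ≤ e ∧ e < k + t ∧ ¬ (a ≤ e ∧ e < a + t)) ∨
      (G e = 0 ∧ ¬ (a ≤ e ∧ e < a + t) ∧ ¬ (k ≤ e ∧ e < k + t)) := by
    intro e
    simp only [hG, edgeFlow]
    by_cases h1 : a ≤ e ∧ e < a + t
    · have h3 := hposA e h1.1 h1.2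
      by_cases h2 : k ≤ e ∧ e < k + t
      · have := hnegB e h2.1 h2.2
        omega
      · simp [h1, h2, h3]
    · by_cases h2 : k ≤ e ∧ e < k + t
      · have := hnegB e h2.1 h2.2
        simp [h1, h2, this]
      · simp [h1, h2]
  set F' : ℤ → ℤ := fun e => F e - G e with hF'
  -- the sites that are neither sources nor sinks of the two runs
  set m : ℤ := if a + t = b then k else a + t with hm
  set ε : ℤ := if a + t = b ∧ k = q then 0 else 1 with hε
  -- Here `G - 0` is compared with `F - F'` site by site. If the net change by `G` at `j` lies
  -- between `0` and the net change by `F`, convexity suffices. The only other possibility is the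
  -- site `m` where a unit stops midway and `F` has no net change; there the loss is at most `ε`.
  have hcol : ∀ j ∈ I, φ j (flowState c G j) - φ j (c j) - (if j = m then ε else 0) ≤
      φ j (flowState c F j) - φ j (flowState c F' j) := by
    intro j _
    have conv : ∀ D δ : ℤ, (0 ≤ δ ∧ δ ≤ D) ∨ (D ≤ δ ∧ δ ≤ 0) →
        φ j (c j - δ) + φ j (c j - D + δ) ≤ φ j (c j - D) + φ j (c j) := by
      intro D δ h
      rcases h with h | h
      · have := (hφ j).add_le (p := c j - D) (r := c j - δ) (d := δ) (by omega) (by omega)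
        rwa [sub_add_cancel] at this
      · have := (hφ j).add_le (p := c j) (r := c j - D + δ) (d := -δ) (by omega) (by omega)
        rw [show c j - D + δ + -δ = c j - D by ring, ← sub_eq_add_neg] at this
        omega
    have e1 : flowState c G j = c j - (G j - G (j - 1)) := by simp only [flowState]; ring
    have e2 : flowState c F j = c j - (F j - F (j - 1)) := by simp only [flowState]; ring
    have e3 : flowState c F' j = c j - (F j - F (j - 1)) + (G j - G (j - 1)) := by
      simp only [flowState, hF']; ring
    rw [e1, e2, e3]
    have hε0 : 0 ≤ ε := by rw [hε]; split_ifs <;> omega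
    have hcase : ((0 ≤ G j - G (j - 1) ∧ G j - G (j - 1) ≤ F j - F (j - 1)) ∨
        (F j - F (j - 1) ≤ G j - G (j - 1) ∧ G j - G (j - 1) ≤ 0)) ∨
        (G j - G (j - 1) = -1 ∧ F j - F (j - 1) = 0 ∧ j = m ∧ ε = 1) := by
      rcases hGF j with ⟨h1, h1', h1''⟩ | ⟨h1, h1', h1''⟩ | ⟨h1, h1'⟩ <;>
        rcases hGF (j - 1) with ⟨h2, h2', h2''⟩ | ⟨h2, h2', h2''⟩ | ⟨h2, h2'⟩ <;>
        rw [h1, h2]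
      · omega
      · omega
      · obtain rfl : j = a := by omega
        omega
      · omega
      · omega
      · obtain rfl : j = k := by omega
        rcases eq_or_lt_of_le htq with h | h
        · rw [h] at hq; omega
        · have h3 := hmid' _ h (by omega)
          rcases eq_or_lt_of_le h3 with h4 | h4
          · have h5 : a + t = b := by omega
            have h6 : m = k := if_pos h5
            have h7 : ε = 1 := if_neg (by omega)
            omega
          · omega
      · obtain rfl : j = a + t := by omega
        rcases eq_or_lt_of_le htb with h | h
        · rw [← h] at hb; omega
        · have h3 := hmid _ (by omega) h
          rcases eq_or_lt_of_le h3 with h4 | h4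
          · have h6 : m = a + t := if_neg (by omega)
            have h7 : ε = 1 := if_neg (by omega)
            omega
          · omega
      · obtain rfl : j = k + t := by omega
        rw [hpk] at hp
        omega
      · omega
    rcases hcase with h | ⟨h1, h2, h3, h4⟩
    · have h0 : 0 ≤ (if j = m then ε else 0) := by split_ifs <;> omega
      have := conv _ _ h
      omega
    · rw [if_pos h3, h4, h1, h2]
      -- At the exceptional site `F` changes nothing and `G` adds a unit: the two neighbouring
      -- slopes differ by at most one.
      have h5 := (hφ j).step (c j - 1)
      rw [sub_add_cancel] at h5
      have e4 : c j - 0 + -1 = c j - 1 := by ring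
      have e5 : c j - -1 = c j + 1 := by ring
      rw [e4, e5, sub_zero]
      omega
  have hεI : ∑ j ∈ I, (if j = m then ε else 0) ≤ ε := by
    rw [Finset.sum_ite_eq']
    have hε0 : 0 ≤ ε := by rw [hε]; split_ifs <;> omega
    split_ifs <;> omega
  have htot := Finset.sum_le_sum hcol
  simp only [Finset.sum_sub_distrib] at htot
  -- If `F'` is nonzero, the induction gives a raise of at least `s + s - ε ≥ s`, because `ε ≤ 1 ≤
  -- s`. If it vanishes, `G` exhausts both runs, so `ε = 0`.
  by_cases hz : ∃ i, F' i ≠ 0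
  · have hlt := sum_abs_sub_exchange_lt ht1 hposA hnegB hF
    have := ih _ hlt F' (fun i h => hF i fun h0 => h (sub_exchange_eq_zero hposA hnegB h0)) (by
        exact (sum_sub_exchange (by omega) hposA hnegB hF).trans hsum) hz (fun i h => hA i (by
          simp only [hF'] at h
          rcases hGF i with h1 | h1 | h1 <;> omega)) (fun i h => hB i (by
          simp only [hF'] at h
          rcases hGF i with h1 | h1 | h1 <;> omega)) rfl
    have hε1 : ε ≤ 1 := by rw [hε]; split_ifs <;> omega
    omega
  · push Not at hz
    have hε1 : ε = 0 := by
      rw [hε, if_pos]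
      by_contra hcon
      rw [not_and_or] at hcon
      rcases ht with h | h
      · have h1 : q < k := by omega
        have h2 := hneg (k - 1) (by omega) (by omega)
        have h3 := hz (k - 1)
        simp only [hF'] at h3
        rcases hGF (k - 1) with h4 | h4 | h4 <;> omega
      · have h1 : a + t < b := by omega
        have h2 := hpos (a + t) (by omega) (by omega)
        have h3 := hz (a + t)
        simp only [hF'] at h3
        rcases hGF (a + t) with h4 | h4 | h4 <;> omega
    have e : ∑ j ∈ I, φ j (flowState c F' j) = ∑ j ∈ I, φ j (c j) :=
      Finset.sum_congr rfl fun j _ => by simp [flowState, hz]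
    omega

/-! ### Elementary exchanges -/

/-- The change of `∑ φ_j (c_j)` when one unit passes from `i` to `i + t` and another one from
`k + t` to `k`. -/
def exchangeGain (φ : ℤ → ℤ → ℤ) (c : ℤ → ℤ) (i k t : ℤ) : ℤ :=
  (φ (i + t) (c (i + t) + 1) - φ (i + t) (c (i + t))) - (φ i (c i) - φ i (c i - 1)) +
  (φ k (c k + (if k = i + t then 1 else 0) + 1) - φ k (c k + if k = i + t then 1 else 0)) -
  (φ (k + t) (c (k + t) - if k + t = i then 1 else 0) -
    φ (k + t) (c (k + t) - (if k + t = i then 1 else 0) - 1))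

theorem sum_add_single {I : Finset ℤ} {p : ℤ} (hp : p ∈ I) (φ : ℤ → ℤ → ℤ) {f g : ℤ → ℤ}
    (hfp : f p = g p + 1) (hfg : ∀ j, j ≠ p → f j = g j) :
    ∑ j ∈ I, φ j (f j) = ∑ j ∈ I, φ j (g j) + (φ p (g p + 1) - φ p (g p)) := by
  rw [← Finset.add_sum_erase _ _ hp, ← Finset.add_sum_erase _ (fun j => φ j (g j)) hp, hfp]
  have : ∑ j ∈ I.erase p, φ j (f j) = ∑ j ∈ I.erase p, φ j (g j) :=
    Finset.sum_congr rfl fun j hj => by rw [hfg j (Finset.ne_of_mem_erase hj)]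
  rw [this]
  ring

theorem flowState_exchange (c : ℤ → ℤ) {i k t : ℤ} (ht : 1 ≤ t) (j : ℤ) :
    flowState c (fun e => edgeFlow i t e - edgeFlow k t e) j =
      c j + (if j = i + t then 1 else 0) + (if j = k then 1 else 0) - (if j = i then 1 else 0) -
        (if j = k + t then 1 else 0) := by
  have h : ∀ a : ℤ, edgeFlow a t (j - 1) - edgeFlow a t j =
      (if j = a + t then 1 else 0) - (if j = a then 1 else 0) := by
    intro a
    simp only [edgeFlow]
    split_ifs <;> omega
  have h1 := h i
  have h2 := h k
  simp only [flowState]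
  have h3 : (if j = k + t then (1 : ℤ) else 0) - (if j = k then 1 else 0) =
      edgeFlow k t (j - 1) - edgeFlow k t j := (h k).symm
  linarith

/-- The four changes are made one after another: into `i + t`, into `k`, out of `i`, out of `k + t`.
The only sites that can coincide are `k = i + t` or `k + t = i`, which the indicators in
`exchangeGain` take into account. -/
theorem sum_exchange {I : Finset ℤ} (φ : ℤ → ℤ → ℤ) (c : ℤ → ℤ) {i k t : ℤ} (ht : 1 ≤ t)
    (hik : i ≠ k) (h1 : i ∈ I) (h2 : i + t ∈ I) (h3 : k ∈ I) (h4 : k + t ∈ I) :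
    ∑ j ∈ I, φ j (flowState c (fun e => edgeFlow i t e - edgeFlow k t e) j) =
      ∑ j ∈ I, φ j (c j) + exchangeGain φ c i k t := by
  have e1 := sum_add_single h2 φ (f := fun j => c j + if j = i + t then 1 else 0) (g := c)
    (by simp) (fun j hj => by simp [hj])
  have e2 := sum_add_single h3 φ
    (f := fun j => c j + (if j = i + t then 1 else 0) + if j = k then 1 else 0)
    (g := fun j => c j + if j = i + t then 1 else 0) (by simp) (fun j hj => by simp [hj])
  have e3 := sum_add_single h1 φ
    (f := fun j => c j + (if j = i + t then 1 else 0) + if j = k then 1 else 0)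
    (g := fun j => c j + (if j = i + t then 1 else 0) + (if j = k then 1 else 0) -
      if j = i then 1 else 0) (by simp) (fun j hj => by simp [hj])
  have e4 := sum_add_single h4 φ
    (f := fun j => c j + (if j = i + t then 1 else 0) + (if j = k then 1 else 0) -
      if j = i then 1 else 0)
    (g := fun j => c j + (if j = i + t then 1 else 0) + (if j = k then 1 else 0) -
      (if j = i then 1 else 0) - (if j = k + t then 1 else 0))
    (by simp) (fun j hj => by simp [hj])
  have n1 : i ≠ i + t := by omega
  have n2 : k + t ≠ i + t := by omega
  have n3 : k + t ≠ k := by omega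
  simp only [flowState_exchange c ht]
  simp only [n2, n3, if_true, if_false, add_zero, hik, n1] at e1 e2 e3 e4
  simp only [exchangeGain]
  rw [show c i - 1 + 1 = c i by ring] at e3
  rw [show c (k + t) - (if k + t = i then 1 else 0) - 1 + 1 =
    c (k + t) - (if k + t = i then 1 else 0) by ring] at e4
  linarith

/-! ### Exchanges blocked by empty or full sites -/

/-- Convex functions `φ_j` whose differences go from `0` at `-1` and `1` at `0` to `K` and `K + 1`
at the two sides of the capacity. -/
structure LevelData (K : ℤ) (cap : ℤ → ℤ) (φ : ℤ → ℤ → ℤ) : Prop where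
  slow : ∀ j, SlowConvex (φ j)
  low : ∀ j, φ j 0 = φ j (-1)
  first : ∀ j, φ j 1 = φ j 0 + 1
  last : ∀ j, φ j (cap j) = φ j (cap j - 1) + K
  past : ∀ j, φ j (cap j + 1) = φ j (cap j) + K + 1

theorem LevelData.one_le {K : ℤ} {cap : ℤ → ℤ} {φ : ℤ → ℤ → ℤ} (h : LevelData K cap φ) (j : ℤ)
    {x : ℤ} (hx : 0 ≤ x) : 1 ≤ φ j (x + 1) - φ j x := by
  have := (h.slow j).diff_mono hx
  have h1 := h.first j
  rw [zero_add] at this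
  omega

theorem LevelData.le {K : ℤ} {cap : ℤ → ℤ} {φ : ℤ → ℤ → ℤ} (h : LevelData K cap φ) (j : ℤ)
    {x : ℤ} (hx : x < cap j) : φ j (x + 1) - φ j x ≤ K := by
  have := (h.slow j).diff_mono (show x ≤ cap j - 1 by omega)
  have h1 := h.last j
  rw [sub_add_cancel] at this
  omega

/-- `A` and `B` are sets of edges such that units may pass to the right through each interval of
edges in `A`, and to the left through each interval of edges in `B`. -/
structure FlowRegion (c cap : ℤ → ℤ) (A B : ℤ → Prop) : Prop where
  disj : ∀ e, A e → ¬ B e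
  A_left : ∀ e, A e → ∃ l ≤ e, 1 ≤ c l ∧ ∀ i, l ≤ i → i ≤ e → A i
  A_right : ∀ e, A e → ∃ r, e < r ∧ c r < cap r ∧ ∀ i, e ≤ i → i < r → A i
  B_left : ∀ e, B e → ∃ l ≤ e, c l < cap l ∧ ∀ i, l ≤ i → i ≤ e → B i
  B_right : ∀ e, B e → ∃ r, e < r ∧ 1 ≤ c r ∧ ∀ i, e ≤ i → i < r → B i
  two_out : ∀ i, A i → B (i - 1) → 2 ≤ c i
  two_in : ∀ i, A (i - 1) → B i → c i + 2 ≤ cap i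
  nonneg : ∀ j, 0 ≤ c j
  le_cap : ∀ j, c j ≤ cap j
  cap_pos : ∀ j, 1 ≤ cap j

/-- The mirror image interchanges `A` and `B`, so that only a blocked unit moving to the right has
to be studied. -/
theorem FlowRegion.reflect {c cap : ℤ → ℤ} {A B : ℤ → Prop} (h : FlowRegion c cap A B) :
    FlowRegion (fun j => c (-j)) (fun j => cap (-j)) (fun e => B (-e - 1))
      (fun e => A (-e - 1)) where
  disj e h1 h2 := h.disj _ h2 h1
  A_left e he := by
    obtain ⟨r, h1, h2, h3⟩ := h.B_right _ he
    exact ⟨-r, by omega, by simpa using h2, fun i h4 h5 => h3 _ (by omega) (by omega)⟩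
  A_right e he := by
    obtain ⟨r, h1, h2, h3⟩ := h.B_left _ he
    exact ⟨-r, by omega, by simpa using h2, fun i h4 h5 => h3 _ (by omega) (by omega)⟩
  B_left e he := by
    obtain ⟨r, h1, h2, h3⟩ := h.A_right _ he
    exact ⟨-r, by omega, by simpa using h2, fun i h4 h5 => h3 _ (by omega) (by omega)⟩
  B_right e he := by
    obtain ⟨r, h1, h2, h3⟩ := h.A_left _ he
    exact ⟨-r, by omega, by simpa using h2, fun i h4 h5 => h3 _ (by omega) (by omega)⟩
  two_out i h1 h2 := h.two_out _ (by rwa [show -(i - 1) - 1 = -i by ring] at h2) h1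
  two_in i h1 h2 := h.two_in _ h2 (by rwa [show -(i - 1) - 1 = -i by ring] at h1)
  nonneg _ := h.nonneg _
  le_cap _ := h.le_cap _
  cap_pos _ := h.cap_pos _

theorem LevelData.reflect {K : ℤ} {cap : ℤ → ℤ} {φ : ℤ → ℤ → ℤ} (h : LevelData K cap φ) :
    LevelData K (fun j => cap (-j)) (fun j => φ (-j)) where
  slow _ := h.slow _
  low _ := h.low _
  first _ := h.first _
  last _ := h.last _
  past _ := h.past _

theorem exchangeGain_reflect (φ : ℤ → ℤ → ℤ) (c : ℤ → ℤ) {i k t : ℤ} (ht : 1 ≤ t) :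
    exchangeGain (fun j => φ (-j)) (fun j => c (-j)) (-(k + t)) (-(i + t)) t =
      exchangeGain φ c i k t := by
  simp only [exchangeGain]
  have e1 : -(-(k + t) + t) = k := by ring
  have e2 : -(-(i + t) + t) = i := by ring
  have c1 : (-(i + t) = -(k + t) + t) ↔ k = i + t := by omega
  have c2 : (-(i + t) + t = -(k + t)) ↔ k + t = i := by omega
  simp only [e1, e2, neg_neg, c1, c2]
  by_cases h1 : k = i + t
  · subst h1
    have h2 : ¬ (i + t + t = i) := by omega
    simp only [h2, if_true, if_false, sub_zero]
    ring
  · by_cases h2 : k + t = i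
    · subst h2
      simp only [h1, if_true, if_false, add_zero]
      ring
    · simp only [h1, h2, if_false, add_zero, sub_zero]
      ring

/-- If units cannot pass freely to the right, some unit can pass to an empty neighbour or from a
full one. -/
theorem FlowRegion.exists_free_hop {c cap : ℤ → ℤ} {A B : ℤ → Prop} (h : FlowRegion c cap A B)
    {i t : ℤ} (ht : 1 ≤ t) (hA : ∀ e, i ≤ e → e < i + t → A e)
    (hblock : c i < 1 ∨ cap (i + t) ≤ c (i + t)) :
    ∃ e, A e ∧ ((1 ≤ c e ∧ c (e + 1) = 0 ∧ A (e + 1)) ∨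
      (c e = cap e ∧ c (e + 1) < cap (e + 1) ∧ A (e - 1))) := by
  rcases hblock with h1 | h1
  · obtain ⟨l, h2, h3, h4⟩ := h.A_left i (hA i le_rfl (by omega))
    have hli : l < i := by
      rcases eq_or_lt_of_le h2 with rfl | h5
      · omega
      · exact h5
    -- With capacity `1` in place of `cap`, "not full" means "empty".
    obtain ⟨e, h5, h6, h7, h8⟩ := exists_hop (n := fun _ => 1) hli (fun _ _ _ => le_rfl)
      (by omega : 0 < c l) h1
    exact ⟨e, h4 e h5 (by omega), Or.inl ⟨by omega, by have := h.nonneg (e + 1); omega,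
      h4 _ (by omega) (by omega)⟩⟩
  · obtain ⟨r, h2, h3, h4⟩ := h.A_right (i + t - 1) (hA _ (by omega) (by omega))
    have hli : i + t < r := by
      rcases eq_or_lt_of_le (show i + t ≤ r by omega) with rfl | h5
      · omega
      · exact h5
    obtain ⟨e, h5, h6, h7, h8⟩ := exists_hop (n := fun _ => 1)
      (x := fun j => if c j < cap j then 0 else 1) hli (fun _ _ _ => le_rfl)
      (by rw [if_neg (by omega)]; exact one_pos) (by rw [if_pos h3]; exact one_pos)
    have h9 : ¬ (c e < cap e) := fun hc => by simp [hc] at h7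
    have h10 : c (e + 1) < cap (e + 1) := by
      by_contra hc
      simp [hc] at h8
    exact ⟨e, h4 e (by omega) (by omega), Or.inr ⟨by have := h.le_cap e; omega, h10,
      h4 _ (by omega) (by omega)⟩⟩

/-- A blocked site forces a hop in `A` that enters an empty site or leaves a full one, and such a
hop does not raise the cost. Pairing it with one-edge hops in `B` shows that each possible hop in
`B` alone raises the cost by at least `s`; so does then every run in `B`. The blocked unit itself
contributes nothing negative, by the slopes prescribed outside the capacity. -/
theorem exchangeGain_of_blocked {K s : ℤ} {c cap : ℤ → ℤ} {φ : ℤ → ℤ → ℤ} {A B : ℤ → Prop}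
    (h : FlowRegion c cap A B) (hφ : LevelData K cap φ) (hs : 1 ≤ s)
    (hbad : ∀ i k t, 1 ≤ t → (∀ e, i ≤ e → e < i + t → A e) → (∀ e, k ≤ e → e < k + t → B e) →
      1 ≤ c i → c (i + t) < cap (i + t) → 1 ≤ c (k + t) → c k < cap k →
      s ≤ exchangeGain φ c i k t)
    {i k t : ℤ} (ht : 1 ≤ t) (hA : ∀ e, i ≤ e → e < i + t → A e)
    (hB : ∀ e, k ≤ e → e < k + t → B e) (hblock : c i < 1 ∨ cap (i + t) ≤ c (i + t)) :
    s ≤ exchangeGain φ c i k t := by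
  obtain ⟨e, he, hfree⟩ := h.exists_free_hop ht hA hblock
  have hone : ∀ q, B q → 1 ≤ c (q + 1) → c q < cap q →
      s ≤ (φ q (c q + 1) - φ q (c q)) - (φ (q + 1) (c (q + 1)) - φ (q + 1) (c (q + 1) - 1)) := by
    intro q hq h1 h2
    have hbd := hbad e q 1 le_rfl (fun x h3 h4 => by rwa [show x = e by omega])
      (fun x h3 h4 => by rwa [show x = q by omega])
    rcases hfree with ⟨h3, h4, h5⟩ | ⟨h3, h4, h5⟩
    · have hbd := hbd h3 (by have := h.cap_pos (e + 1); omega) h1 h2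
      have hne : q ≠ e + 1 := fun h0 => h.disj _ h5 (h0 ▸ hq)
      simp only [exchangeGain, hne, if_false, h4, add_zero] at hbd
      have h6 := hφ.first (e + 1)
      rw [zero_add] at hbd
      by_cases h7 : q + 1 = e
      · have h8 := h.two_out e he (by rwa [show e - 1 = q by omega])
        have h9 := hφ.one_le e (x := c e - 1 - 1) (by omega)
        rw [sub_add_cancel] at h9
        rw [if_pos h7, h7] at hbd
        rw [h7]
        omega
      · have h9 := hφ.one_le e (x := c e - 1) (by omega)
        rw [sub_add_cancel] at h9
        rw [if_neg h7] at hbd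
        simp only [sub_zero] at hbd
        omega
    · have hbd := hbd (by have := h.cap_pos e; omega) h4 h1 h2
      have hne : ¬ (q + 1 = e) := fun h0 => h.disj _ h5 (by rwa [show e - 1 = q by omega])
      simp only [exchangeGain, hne, if_false, sub_zero] at hbd
      have h6 := hφ.last e
      rw [h3] at hbd
      by_cases h7 : q = e + 1
      · have h8 := h.two_in q (by rwa [show q - 1 = e by omega]) hq
        have h9 := hφ.le q (x := c q + 1) (by omega)
        rw [if_pos h7, ← h7] at hbd
        omega
      · have h9 := hφ.le (e + 1) (x := c (e + 1)) h4
        rw [if_neg h7] at hbd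
        simp only [add_zero] at hbd
        omega
  -- A blocked edge of `B` would yield, by reflection, a hop in `B` that does not raise the cost,
  -- against `hone` and `s ≥ 1`.
  have hall : ∀ q, B q → 1 ≤ c (q + 1) ∧ c q < cap q := by
    intro q hq
    by_contra hcon
    obtain ⟨e', he', hfree'⟩ := h.reflect.exists_free_hop (i := -q - 1) (t := 1) le_rfl
      (fun x h1 h2 => by rwa [show -x - 1 = q by omega])
      (by
        rw [show -(-q - 1) = q + 1 by ring, show -(-q - 1 + 1) = q by ring]
        omega)
    rw [show -(e' + 1) = -e' - 1 by ring, show -e' = (-e' - 1) + 1 by ring] at hfree'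
    rw [show -e' - 1 + 1 - 1 = -e' - 1 by ring] at hfree'
    generalize -e' - 1 = q' at he' hfree'
    rcases hfree' with ⟨h1, h2, -⟩ | ⟨h1, h2, -⟩
    · have := hone q' he' h1 (by have := h.cap_pos q'; omega)
      have h3 := hφ.first q'
      have h4 := hφ.one_le (q' + 1) (x := c (q' + 1) - 1) (by omega)
      rw [sub_add_cancel] at h4
      rw [h2, zero_add] at this
      omega
    · have := hone q' he' (by have := h.cap_pos (q' + 1); omega) h2
      have h3 := hφ.last (q' + 1)
      have h4 := hφ.le q' h2
      rw [h1] at this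
      omega
  -- The run is composed of single hops. At each intermediate site the slopes of entering and
  -- leaving differ by at most one, so a further hop adds at least `s - 1 ≥ 0`.
  have hrun : ∀ m : ℕ, (∀ e, k ≤ e → e < k + (m + 1 : ℕ) → B e) →
      s ≤ (φ k (c k + 1) - φ k (c k)) -
        (φ (k + (m + 1 : ℕ)) (c (k + (m + 1 : ℕ))) -
          φ (k + (m + 1 : ℕ)) (c (k + (m + 1 : ℕ)) - 1)) := by
    intro m
    induction m with
    | zero =>
      intro hb
      have hk := hb k le_rfl (by simp)
      simpa using hone k hk (hall k hk).1 (hall k hk).2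
    | succ m ih =>
      intro hb
      have h1 := ih (fun e h2 h3 => hb e h2 (by push_cast at h3 ⊢; omega))
      have hq := hb (k + (m + 1 : ℕ)) (by omega) (by push_cast; omega)
      have h2 := hone _ hq (hall _ hq).1 (hall _ hq).2
      have h3 := (hφ.slow (k + (m + 1 : ℕ))).step (c (k + (m + 1 : ℕ)) - 1)
      rw [sub_add_cancel] at h3
      rw [show k + ((m + 1 + 1 : ℕ) : ℤ) = k + ((m + 1 : ℕ) : ℤ) + 1 by push_cast; ring]
      omega
  have hW := hrun (t - 1).toNat
  have et : (((t - 1).toNat + 1 : ℕ) : ℤ) = t := by omega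
  rw [et] at hW
  have hW := hW hB
  have hE : 0 ≤ (φ (i + t) (c (i + t) + 1) - φ (i + t) (c (i + t))) -
      (φ i (c i) - φ i (c i - 1)) := by
    rcases hblock with h1 | h1
    · have h2 : c i = 0 := by have := h.nonneg i; omega
      have h3 := hφ.one_le (i + t) (h.nonneg (i + t))
      have h4 := hφ.low i
      rw [h2, zero_sub]
      omega
    · have h2 : c (i + t) = cap (i + t) := by have := h.le_cap (i + t); omega
      have h3 := hφ.past (i + t)
      have h4 := hφ.le i (x := c i - 1) (by have := h.le_cap i; omega)
      rw [sub_add_cancel] at h4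
      rw [h2]
      omega
  have h1 := (hφ.slow k).mono (c k)
  have h2 := (hφ.slow (k + t)).mono (c (k + t) - 1 - 1)
  simp only [sub_add_cancel] at h2
  simp only [exchangeGain]
  split_ifs <;> (try simp only [add_zero, sub_zero]) <;> omega

/-- It suffices to check the exchanges that are possible in the given state. -/
theorem le_exchangeGain {K s : ℤ} {c cap : ℤ → ℤ} {φ : ℤ → ℤ → ℤ} {A B : ℤ → Prop}
    (h : FlowRegion c cap A B) (hφ : LevelData K cap φ) (hs : 1 ≤ s)
    (hbad : ∀ i k t, 1 ≤ t → (∀ e, i ≤ e → e < i + t → A e) → (∀ e, k ≤ e → e < k + t → B e) →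
      1 ≤ c i → c (i + t) < cap (i + t) → 1 ≤ c (k + t) → c k < cap k →
      s ≤ exchangeGain φ c i k t)
    {i k t : ℤ} (ht : 1 ≤ t) (hA : ∀ e, i ≤ e → e < i + t → A e)
    (hB : ∀ e, k ≤ e → e < k + t → B e) :
    s ≤ exchangeGain φ c i k t := by
  by_cases hE : c i < 1 ∨ cap (i + t) ≤ c (i + t)
  · exact exchangeGain_of_blocked h hφ hs hbad ht hA hB hE
  by_cases hW : c (k + t) < 1 ∨ cap k ≤ c k
  · rw [← exchangeGain_reflect φ c ht]
    refine exchangeGain_of_blocked h.reflect hφ.reflect hs ?_ ht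
      (fun e h1 h2 => hB _ (by omega) (by omega)) (fun e h1 h2 => hA _ (by omega) (by omega)) ?_
    · intro i' k' t' ht' hA' hB' h1 h2 h3 h4
      have := hbad (-(k' + t')) (-(i' + t')) t' ht'
        (fun e h5 h6 => by simpa using hB' (-e - 1) (by omega) (by omega))
        (fun e h5 h6 => by simpa using hA' (-e - 1) (by omega) (by omega))
        (by simpa using h3) (by rw [show -(k' + t') + t' = -k' by ring]; exact h4)
        (by rw [show -(i' + t') + t' = -i' by ring]; exact h1) h2
      rw [← exchangeGain_reflect φ c ht'] at this
      rw [show -(-(i' + t') + t') = i' by ring, show -(-(k' + t') + t') = k' by ring] at this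
      exact this
    · rw [neg_neg, show -(-(k + t) + t) = k by ring]
      exact hW
  · exact hbad i k t ht hA hB (by omega) (by omega) (by omega) (by omega)

/-! ### Columns of units at the levels `1, …, K` -/

/-- The sum of `y` over the levels `1, …, k`. -/
def cum (y : ℤ → ℤ) (k : ℕ) : ℤ := ∑ i ∈ Finset.range k, y (i + 1)

/-- The sum of the levels of the units of `y`. -/
def levelSum (K : ℕ) (y : ℤ → ℤ) : ℤ := ∑ i ∈ Finset.range K, ((i : ℤ) + 1) * y (i + 1)

theorem cum_succ (y : ℤ → ℤ) (k : ℕ) : cum y (k + 1) = cum y k + y (k + 1) :=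
  Finset.sum_range_succ _ _

theorem cum_zero (y : ℤ → ℤ) : cum y 0 = 0 := Finset.sum_range_zero _

theorem cum_mono_of_nonneg {y : ℤ → ℤ} (hy : ∀ k, 0 ≤ y k) : Monotone (cum y) :=
  monotone_nat_of_le_succ fun k => by rw [cum_succ]; linarith [hy (k + 1)]

theorem cum_strictMono {n : ℤ → ℤ} (hn : ∀ k, 1 ≤ n k) : StrictMono (cum n) :=
  strictMono_nat_of_lt_succ fun k => by rw [cum_succ]; linarith [hn (k + 1)]

theorem cum_le_cum {y n : ℤ → ℤ} (h : ∀ k, y k ≤ n k) (k : ℕ) : cum y k ≤ cum n k :=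
  Finset.sum_le_sum fun _ _ => h _

theorem cum_add (y z : ℤ → ℤ) (k : ℕ) : cum (y + z) k = cum y k + cum z k :=
  Finset.sum_add_distrib

theorem cum_sub (y z : ℤ → ℤ) (k : ℕ) : cum (y - z) k = cum y k - cum z k :=
  Finset.sum_sub_distrib _ _

theorem levelSum_add (y z : ℤ → ℤ) (K : ℕ) :
    levelSum K (y + z) = levelSum K y + levelSum K z := by
  simp [levelSum, mul_add, Finset.sum_add_distrib]

theorem levelSum_sub (y z : ℤ → ℤ) (K : ℕ) :
    levelSum K (y - z) = levelSum K y - levelSum K z := by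
  simp [levelSum, mul_sub, Finset.sum_sub_distrib]

/-- Abel summation: a unit at level `l` lies above exactly the `l` thresholds `0, …, l - 1`. -/
theorem levelSum_eq_sum_cum (K : ℕ) (y : ℤ → ℤ) :
    levelSum K y = ∑ k ∈ Finset.range (K + 1), (cum y K - cum y k) := by
  induction K with
  | zero => simp [levelSum]
  | succ K ih =>
    have h1 : levelSum (K + 1) y = levelSum K y + ((K : ℤ) + 1) * y (K + 1) :=
      Finset.sum_range_succ _ _
    rw [h1, ih, Finset.sum_range_succ _ (K + 1), sub_self, add_zero, cum_succ]
    simp only [Finset.sum_sub_distrib, Finset.sum_const, Finset.card_range, nsmul_eq_mul]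
    push_cast
    ring

/-! ### Least sums of levels in one column -/

/-- The least possible sum of the levels of `x` units, if `N k` is the total capacity of the
levels `1, …, k`. -/
def levelCost (N : ℕ → ℤ) (K : ℕ) (x : ℤ) : ℤ := ∑ k ∈ Finset.range (K + 1), max (x - N k) 0

/-- The slope counts the thresholds already filled by `x` units: within the capacity it is the level
at which greedy filling puts the next unit. -/
theorem levelCost_succ_sub (N : ℕ → ℤ) (K : ℕ) (x : ℤ) :
    levelCost N K (x + 1) - levelCost N K x =
      ∑ k ∈ Finset.range (K + 1), if N k ≤ x then 1 else 0 := by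
  rw [levelCost, levelCost, ← Finset.sum_sub_distrib]
  exact Finset.sum_congr rfl fun k _ => by split_ifs <;> omega

/-- A strictly increasing `N` takes the value `x + 1` at most once, so the slope jumps by at most
one. Positivity of all capacities is essential here: a level of capacity zero would make it jump by
two. -/
theorem slowConvex_levelCost {N : ℕ → ℤ} (hN : StrictMono N) (K : ℕ) :
    SlowConvex (levelCost N K) where
  mono x := by
    rw [levelCost_succ_sub, levelCost_succ_sub]
    exact Finset.sum_le_sum fun k _ => by split_ifs <;> omega
  step x := by
    rw [levelCost_succ_sub, levelCost_succ_sub, ← sub_le_iff_le_add', ← Finset.sum_sub_distrib]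
    have h1 : ∀ k ∈ Finset.range (K + 1),
        (if N k ≤ x + 1 then (1 : ℤ) else 0) - (if N k ≤ x then 1 else 0) =
          if N k = x + 1 then 1 else 0 := fun k _ => by split_ifs <;> omega
    rw [Finset.sum_congr rfl h1, Finset.sum_boole]
    have : ((Finset.range (K + 1)).filter fun k => N k = x + 1).card ≤ 1 :=
      Finset.card_le_one.2 fun a ha b hb => hN.injective
        ((Finset.mem_filter.1 ha).2.trans (Finset.mem_filter.1 hb).2.symm)
    exact_mod_cast this

theorem levelData_levelCost {N : ℤ → ℕ → ℤ} (hN : ∀ j, StrictMono (N j)) (h0 : ∀ j, N j 0 = 0)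
    (K : ℕ) : LevelData K (fun j => N j K) (fun j => levelCost (N j) K) where
  slow j := slowConvex_levelCost (hN j) K
  low j := by
    have := levelCost_succ_sub (N j) K (-1)
    rw [Finset.sum_eq_zero] at this
    · simpa [sub_eq_zero] using this
    · intro k _
      have h1 := (hN j).monotone (Nat.zero_le k)
      rw [h0] at h1
      exact if_neg (by omega)
  first j := by
    have := levelCost_succ_sub (N j) K 0
    rw [Finset.sum_eq_single 0] at this
    · rw [h0, if_pos le_rfl, zero_add] at this
      linarith
    · intro k _ hk
      have h1 := hN j (Nat.pos_of_ne_zero hk)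
      rw [h0] at h1
      exact if_neg (by omega)
    · simp
  last j := by
    have := levelCost_succ_sub (N j) K (N j K - 1)
    rw [Finset.sum_range_succ, if_neg (by omega), Finset.sum_congr rfl (g := fun _ => 1)] at this
    · simp only [sub_add_cancel, Finset.sum_const, Finset.card_range] at this
      simp at this
      linarith
    · intro k hk
      have h1 := hN j (Finset.mem_range.1 hk)
      exact if_pos (by omega)
  past j := by
    have := levelCost_succ_sub (N j) K (N j K)
    rw [Finset.sum_congr rfl (g := fun _ => 1)] at this
    · simp at this
      linarith
    · intro k hk
      have h1 := (hN j).monotone (Nat.lt_succ_iff.1 (Finset.mem_range.1 hk))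
      exact if_pos h1

/-- At most `cum n k` units fit into the levels up to `k`; the others lie above, and
`levelSum_eq_sum_cum` adds up these counts. -/
theorem levelCost_le_levelSum {y n : ℤ → ℤ} (hy : ∀ k, 0 ≤ y k) (hyn : ∀ k, y k ≤ n k) (K : ℕ) :
    levelCost (cum n) K (cum y K) ≤ levelSum K y := by
  rw [levelSum_eq_sum_cum]
  refine Finset.sum_le_sum fun k hk => ?_
  have h1 := cum_le_cum hyn k
  have h2 := cum_mono_of_nonneg hy (Nat.lt_succ_iff.1 (Finset.mem_range.1 hk))
  omega

/-- If the sum of the levels is not the least possible one, then a unit can go down by one. -/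
theorem exists_down_hop {y n : ℤ → ℤ} (hy : ∀ k, 0 ≤ y k) (hyn : ∀ k, y k ≤ n k)
    (hn : ∀ k, 1 ≤ n k) {K : ℕ} (h : levelCost (cum n) K (cum y K) < levelSum K y) :
    ∃ k : ℤ, 1 ≤ k ∧ k < K ∧ 0 < y (k + 1) ∧ y k < n k := by
  by_contra! hcon
  refine absurd h (not_lt.2 ?_)
  rw [levelSum_eq_sum_cum]
  refine Finset.sum_le_sum fun k hk => ?_
  have hkK : k ≤ K := Nat.lt_succ_iff.1 (Finset.mem_range.1 hk)
  -- Without a hop down, either the levels up to `k` are full or there is a hole among them and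
  -- everything above `k` is empty. In both cases the term at `k` is the least possible one.
  by_cases hfull : ∀ i ∈ Finset.range k, y (i + 1) = n (i + 1)
  · have : cum y k = cum n k := Finset.sum_congr rfl hfull
    omega
  · push Not at hfull
    obtain ⟨i, hi, hi2⟩ := hfull
    have hik := Finset.mem_range.1 hi
    have hzero : ∀ u : ℤ, k < u → u ≤ K → y u = 0 := by
      intro u hu1 hu2
      by_contra hu
      have hu3 := hy u
      have hi3 := hyn (i + 1)
      -- A hole hopping up is a unit hopping down.
      obtain ⟨a, h1, h2, h3, h4⟩ := exists_hop (x := fun k => n k - y k) (n := n)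
        (a := (i : ℤ) + 1) (b := u) (by omega) (fun k _ _ => hn k) (by omega) (by omega)
      have := hcon a (by omega) (by omega) (by omega)
      omega
    have : ∀ m, k ≤ m → m ≤ K → cum y m = cum y k := by
      intro m hm
      induction m, hm using Nat.le_induction with
      | base => intro _; rfl
      | succ m hm ih =>
        intro h1
        rw [cum_succ, ih (by omega), hzero _ (by omega) (by omega), add_zero]
    have := this K hkK le_rfl
    omega

/-! ### Largest sums of levels, compared with least ones -/

/-- The total capacities of the topmost `k` of the levels `1, …, K`, for `k ≤ K`; it is continued
in a strictly increasing way. -/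
def flipCum (N : ℕ → ℤ) (K : ℕ) (k : ℕ) : ℤ := N K - N (K - k) + ((k - K : ℕ) : ℤ)

theorem flipCum_of_le (N : ℕ → ℤ) {K k : ℕ} (h : k ≤ K) : flipCum N K k = N K - N (K - k) := by
  rw [flipCum, Nat.sub_eq_zero_of_le h]
  simp

theorem flipCum_zero (N : ℕ → ℤ) (K : ℕ) : flipCum N K 0 = 0 := by simp [flipCum]

theorem strictMono_flipCum {N : ℕ → ℤ} (hN : StrictMono N) (K : ℕ) : StrictMono (flipCum N K) :=
  strictMono_nat_of_lt_succ fun k => by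
    rcases Nat.lt_or_ge k K with h | h
    · rw [flipCum_of_le N h.le, flipCum_of_le N h]
      have := hN (show K - (k + 1) < K - k by omega)
      simp only [Nat.succ_eq_add_one]
      omega
    · simp only [flipCum]
      rw [show K - k = 0 by omega, show K - k.succ = 0 by omega]
      omega

/-- For `K ≤ d` the left side exceeds `(K + 1) * d` by `(K - 1) * (d - K)`. The bound `d ≤ 4` is
sharp: for `d = 5`, `K = 3` this excess is `4 > d - 2`. -/
theorem sum_max_sub_le (K : ℕ) {d : ℤ} (h0 : 0 ≤ d) (h4 : d ≤ 4) :
    2 * ∑ k ∈ Finset.range K, max (d - k) 0 ≤ (K + 1) * d + max 0 (d - 2) := by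
  by_cases hK : K < 4
  · interval_cases K <;> simp [Finset.sum_range_succ] <;> omega
  · push Not at hK
    induction K, hK using Nat.le_induction with
    | base => simp [Finset.sum_range_succ]; omega
    | succ K hK ih =>
      rw [Finset.sum_range_succ, max_eq_right (by omega)]
      push_cast
      nlinarith

theorem le_strictMono {N : ℕ → ℤ} (hN : StrictMono N) (a d : ℕ) : N a + d ≤ N (a + d) := by
  induction d with
  | zero => simp
  | succ d ih =>
    have := hN (Nat.lt_succ_self (a + d))
    push_cast
    rw [← add_assoc a d 1]
    simp only [Nat.succ_eq_add_one] at this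
    omega

/-- The least sum of levels of `a` units and the largest one of `b` units are in the expected
order, up to a small error. -/
theorem levelCost_add_levelCost_flip {N : ℕ → ℤ} (hN : StrictMono N) (h0 : N 0 = 0) (K : ℕ)
    {a b : ℤ} (ha0 : 0 ≤ a) (hb0 : 0 ≤ b) (ha : a ≤ N K) (hb : b ≤ N K) (hab : |a - b| ≤ 4) :
    2 * levelCost N K a + 2 * levelCost (flipCum N K) K b ≤
      (K + 1) * (a + b) + max 0 (|a - b| - 2) := by
  have hflip : levelCost (flipCum N K) K b =
      ∑ k ∈ Finset.range (K + 1), max (b - (N K - N k)) 0 := by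
    rw [levelCost, ← Finset.sum_range_reflect]
    refine Finset.sum_congr rfl fun k hk => ?_
    have := Finset.mem_range.1 hk
    rw [flipCum_of_le N (by omega), show K - (K + 1 - 1 - k) = k by omega]
  rw [hflip, levelCost, ← mul_add, ← Finset.sum_add_distrib]
  have hNk : ∀ k ∈ Finset.range (K + 1), 0 ≤ N k ∧ N k ≤ N K := fun k hk => by
    have h1 := hN.monotone (Nat.zero_le k)
    have h2 := hN.monotone (Nat.lt_succ_iff.1 (Finset.mem_range.1 hk))
    omega
  rcases le_total b a with h | h
  · have h1 : ∑ k ∈ Finset.range (K + 1), (max (a - N k) 0 + max (b - (N K - N k)) 0) ≤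
        ∑ k ∈ Finset.range (K + 1), (b + max (a - b - N k) 0) :=
      Finset.sum_le_sum fun k hk => by have := hNk k hk; omega
    have h2 : ∑ k ∈ Finset.range K, max (a - b - N k) 0 ≤
        ∑ k ∈ Finset.range K, max (a - b - k) 0 := Finset.sum_le_sum fun k hk => by
      have := le_strictMono hN 0 k
      rw [h0, zero_add, zero_add] at this
      omega
    rw [Finset.sum_add_distrib (f := fun _ => b), Finset.sum_range_succ (fun k => max (a - b - N k) 0),
      max_eq_right (show a - b - N K ≤ 0 by omega)] at h1
    have h3 := sum_max_sub_le K (d := a - b) (by omega) (by rw [abs_of_nonneg] at hab <;> omega)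
    rw [abs_of_nonneg (by omega)]
    simp only [Finset.sum_const, Finset.card_range, nsmul_eq_mul] at h1
    push_cast at h1
    linarith
  · have h1 : ∑ k ∈ Finset.range (K + 1), (max (a - N k) 0 + max (b - (N K - N k)) 0) ≤
        ∑ k ∈ Finset.range (K + 1), (a + max (b - a - (N K - N k)) 0) :=
      Finset.sum_le_sum fun k hk => by have := hNk k hk; omega
    have h2 : ∑ k ∈ Finset.range (K + 1), max (b - a - (N K - N k)) 0 ≤
        ∑ k ∈ Finset.range K, max (b - a - k) 0 := by
      rw [← Finset.sum_range_reflect, Finset.sum_range_succ]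
      have e : K + 1 - 1 - K = 0 := by omega
      rw [e, h0, max_eq_right (show b - a - (N K - 0) ≤ 0 by omega), add_zero]
      refine Finset.sum_le_sum fun k hk => ?_
      have h3 := le_strictMono hN (K - k) k
      have h4 := Finset.mem_range.1 hk
      rw [show K - k + k = K by omega] at h3
      rw [show K + 1 - 1 - k = K - k by omega]
      omega
    rw [Finset.sum_add_distrib (f := fun _ => a)] at h1
    have h3 := sum_max_sub_le K (d := b - a) (by omega) (by
      rw [abs_sub_comm, abs_of_nonneg] at hab <;> omega)
    rw [abs_sub_comm, abs_of_nonneg (by omega)]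
    simp only [Finset.sum_const, Finset.card_range, nsmul_eq_mul] at h1
    push_cast at h1
    linarith

/-! ### Exchanges along a flow between two states -/

/-- The ends of a maximal interval of constant sign of `F` are a source and a sink. As both end
states lie between `0` and `cap`, a source is nonempty and a sink is not full. Where `F` changes
sign, the net change is at least two units, whence `two_out` and `two_in`. -/
theorem flowRegion_of_flow {J : ℤ} {c cap F : ℤ → ℤ} (hF : ∀ i, F i ≠ 0 → 1 ≤ i ∧ i < J)
    (hcap : ∀ j, 1 ≤ cap j) (h0 : ∀ j, 0 ≤ c j) (h1 : ∀ j, c j ≤ cap j)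
    (h0' : ∀ j, 0 ≤ flowState c F j) (h1' : ∀ j, flowState c F j ≤ cap j) :
    FlowRegion c cap (fun e => 0 < F e) (fun e => F e < 0) := by
  have hlo : ∀ i, i ≤ 0 → F i = 0 := fun i h => by
    by_contra h2
    have := (hF i h2).1
    omega
  have hhi : ∀ i, J ≤ i → F i = 0 := fun i h => by
    by_contra h2
    have := (hF i h2).2
    omega
  simp only [flowState] at h0' h1'
  refine ⟨fun e h2 h3 => by omega, fun e he => ?_, fun e he => ?_, fun e he => ?_, fun e he => ?_,
    fun i h2 h3 => ?_, fun i h2 h3 => ?_, h0, h1, hcap⟩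
  · obtain ⟨l, h2, h3, h4⟩ := exists_left_end (fun i h => (hlo i h).le) he
    exact ⟨l, h2, by have := h0' l; omega, h4⟩
  · obtain ⟨l, h2, h3, h4⟩ := exists_right_end (fun i h => (hhi i h).le) he
    exact ⟨l, h2, by have := h1' l; omega, h4⟩
  · obtain ⟨l, h2, h3, h4⟩ := exists_left_end (F := fun i => - F i) (lo := 0) (k := e)
      (fun i h => by simp [hlo i h]) (by omega)
    exact ⟨l, h2, by have := h1' l; omega, fun i h5 h6 => by have := h4 i h5 h6; omega⟩
  · obtain ⟨l, h2, h3, h4⟩ := exists_right_end (F := fun i => - F i) (hi := J) (k := e)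
      (fun i h => by simp [hhi i h]) (by omega)
    exact ⟨l, h2, by have := h0' l; omega, fun i h5 h6 => by have := h4 i h5 h6; omega⟩
  · have := h0' i
    omega
  · have := h1' i
    omega

/-- One of the exchanges along a flow between two states in a sublevel set stays in this set. -/
theorem exists_cheap_exchange {J K T : ℤ} {c cap F : ℤ → ℤ} {φ : ℤ → ℤ → ℤ}
    (hφ : LevelData K cap φ) (hF : ∀ i, F i ≠ 0 → 1 ≤ i ∧ i < J)
    (hreg : FlowRegion c cap (fun e => 0 < F e) (fun e => F e < 0))
    (hsum : ∑ i ∈ Finset.Icc 1 J, F i = 0) (hne : ∃ i, F i ≠ 0)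
    (hT : ∑ j ∈ Finset.Icc 1 J, φ j (c j) ≤ T)
    (hT' : ∑ j ∈ Finset.Icc 1 J, φ j (flowState c F j) ≤ T) :
    ∃ i k t, 1 ≤ t ∧ (∀ e, i ≤ e → e < i + t → 0 < F e) ∧ (∀ e, k ≤ e → e < k + t → F e < 0) ∧
      1 ≤ c i ∧ c (i + t) < cap (i + t) ∧ 1 ≤ c (k + t) ∧ c k < cap k ∧
      ∑ j ∈ Finset.Icc 1 J,
        φ j (flowState c (fun e => edgeFlow i t e - edgeFlow k t e) j) ≤ T := by
  by_contra! hcon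
  have hex : ∀ i k t, 1 ≤ t → (∀ e, i ≤ e → e < i + t → 0 < F e) →
      (∀ e, k ≤ e → e < k + t → F e < 0) →
      ∑ j ∈ Finset.Icc 1 J, φ j (flowState c (fun e => edgeFlow i t e - edgeFlow k t e) j) =
        ∑ j ∈ Finset.Icc 1 J, φ j (c j) + exchangeGain φ c i k t := by
    intro i k t ht hA hB
    have h1 := hA i le_rfl (by omega)
    have h2 := hA (i + t - 1) (by omega) (by omega)
    have h3 := hB k le_rfl (by omega)
    have h4 := hB (k + t - 1) (by omega) (by omega)
    have h1' := hF i (by omega)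
    have h2' := hF (i + t - 1) (by omega)
    have h3' := hF k (by omega)
    have h4' := hF (k + t - 1) (by omega)
    refine sum_exchange φ c ht (fun h => by rw [h] at h1; omega) ?_ ?_ ?_ ?_ <;>
      rw [Finset.mem_Icc] <;> omega
  -- The least raise that leaves the sublevel set. If all possible exchanges raise the sum by `s`,
  -- then so do all exchanges and finally the flow itself, contradicting `hT'`.
  set s : ℤ := T + 1 - ∑ j ∈ Finset.Icc 1 J, φ j (c j) with hs
  have hfin := le_of_flow (I := Finset.Icc 1 J) (lo := 0) (hi := J + 1) (c := c) (φ := φ)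
    (A := fun e => 0 < F e) (B := fun e => F e < 0) (s := s)
    (fun i hi => by have := Finset.mem_Icc.1 hi; omega) hφ.slow (by omega)
    (fun i k t ht hA hB => by
      rw [hex i k t ht hA hB]
      have := le_exchangeGain (s := s) hreg hφ (by omega)
        (fun i k t ht hA hB h1 h2 h3 h4 => by
          have h5 := hcon i k t ht hA hB h1 h2 h3 h4
          rw [hex i k t ht hA hB] at h5
          omega) ht hA hB
      omega) F (fun i hi => by have := hF i hi; rw [Finset.mem_Icc]; omega) hsum hne
    (fun _ h => h) (fun _ h => h)
  omega

theorem exchange_mem_Icc {c cap F : ℤ → ℤ}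
    (hreg : FlowRegion c cap (fun e => 0 < F e) (fun e => F e < 0)) {i k t : ℤ} (ht : 1 ≤ t)
    (hA : ∀ e, i ≤ e → e < i + t → 0 < F e) (hB : ∀ e, k ≤ e → e < k + t → F e < 0)
    (h1 : 1 ≤ c i) (h2 : c (i + t) < cap (i + t)) (h3 : 1 ≤ c (k + t)) (h4 : c k < cap k) (j : ℤ) :
    0 ≤ flowState c (fun e => edgeFlow i t e - edgeFlow k t e) j ∧
      flowState c (fun e => edgeFlow i t e - edgeFlow k t e) j ≤ cap j := by
  rw [flowState_exchange c ht]
  have h5 := hreg.nonneg j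
  have h6 := hreg.le_cap j
  have hik : i ≠ k := fun h => by
    have h7 := hA i le_rfl (by omega)
    have h8 := hB k le_rfl (by omega)
    rw [h] at h7
    omega
  have h7 : i = k + t → 2 ≤ c i := fun h =>
    hreg.two_out i (hA i le_rfl (by omega)) (hB _ (by omega) (by omega))
  have h8 : k = i + t → c k + 2 ≤ cap k := fun h =>
    hreg.two_in k (hA _ (by omega) (by omega)) (hB k le_rfl (by omega))
  by_cases c1 : j = i + t
  · subst c1
    by_cases c2 : i + t = k
    · have h9 := h8 c2.symm
      subst c2
      split_ifs <;> omega
    · split_ifs <;> omega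
  · by_cases c2 : j = k
    · subst c2
      split_ifs <;> omega
    · by_cases c3 : j = i
      · subst c3
        by_cases c4 : j = k + t
        · have h9 := h7 c4
          split_ifs <;> omega
        · split_ifs <;> omega
      · by_cases c4 : j = k + t
        · subst c4
          split_ifs <;> omega
        · split_ifs
          omega

theorem sum_flowState_exchange {J : ℤ} {F : ℤ → ℤ} (c : ℤ → ℤ)
    (hF : ∀ i, F i ≠ 0 → 1 ≤ i ∧ i < J) {i k t : ℤ} (ht : 1 ≤ t)
    (hA : ∀ e, i ≤ e → e < i + t → 0 < F e) (hB : ∀ e, k ≤ e → e < k + t → F e < 0) :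
    ∑ j ∈ Finset.Icc 1 J, flowState c (fun e => edgeFlow i t e - edgeFlow k t e) j =
      ∑ j ∈ Finset.Icc 1 J, c j := by
  have h1' := hF i (by have := hA i le_rfl (by omega); omega)
  have h2' := hF (i + t - 1) (by have := hA (i + t - 1) (by omega) (by omega); omega)
  have h3' := hF k (by have := hB k le_rfl (by omega); omega)
  have h4' := hF (k + t - 1) (by have := hB (k + t - 1) (by omega) (by omega); omega)
  simp only [flowState_exchange c ht, Finset.sum_sub_distrib, Finset.sum_add_distrib,
    Finset.sum_ite_eq', Finset.mem_Icc]
  rw [if_pos (by omega), if_pos (by omega), if_pos (by omega), if_pos (by omega)]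
  ring

/-- An exchange changes at most one column by two units, and no column by more. -/
theorem exists_excess (c : ℤ → ℤ) (I : Finset ℤ) {i k t : ℤ} (ht : 1 ≤ t) :
    ∃ ε : ℤ → ℤ, ∑ j ∈ I, ε j ≤ 1 ∧ ∀ j, 0 ≤ ε j ∧ ε j ≤ 1 ∧
      |flowState c (fun e => edgeFlow i t e - edgeFlow k t e) j - c j| ≤ 1 + ε j := by
  by_cases h : i = k + t
  · refine ⟨fun j => if j = i then 1 else 0, ?_, fun j => ?_⟩
    · rw [Finset.sum_ite_eq']
      split_ifs <;> omega
    · rw [flowState_exchange c ht, abs_le]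
      beta_reduce
      split_ifs <;> omega
  · refine ⟨fun j => if j = k then 1 else 0, ?_, fun j => ?_⟩
    · rw [Finset.sum_ite_eq']
      split_ifs <;> omega
    · rw [flowState_exchange c ht, abs_le]
      beta_reduce
      split_ifs <;> omega

/-- Between two states of columns for which a sum of levels `T` is possible there is an exchange
along the flow such that `T` is possible in the new state, too. -/
theorem exists_exchange {J T : ℤ} {K : ℕ} {N : ℤ → ℕ → ℤ} {c F : ℤ → ℤ}
    (hN : ∀ j, StrictMono (N j)) (hN0 : ∀ j, N j 0 = 0) (hcap : ∀ j, 1 ≤ N j K)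
    (hF : ∀ i, F i ≠ 0 → 1 ≤ i ∧ i < J)
    (hsum : ∑ i ∈ Finset.Icc 1 J, F i = 0) (hne : ∃ i, F i ≠ 0)
    (h0 : ∀ j, 0 ≤ c j) (h1 : ∀ j, c j ≤ N j K)
    (h0' : ∀ j, 0 ≤ flowState c F j) (h1' : ∀ j, flowState c F j ≤ N j K)
    (hT : ∑ j ∈ Finset.Icc 1 J, levelCost (N j) K (c j) ≤ T)
    (hT' : ∑ j ∈ Finset.Icc 1 J, levelCost (N j) K (flowState c F j) ≤ T)
    (hG : ∑ j ∈ Finset.Icc 1 J, levelCost (flipCum (N j) K) K (c j) ≤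
      (K + 1) * ∑ j ∈ Finset.Icc 1 J, c j - T)
    (hG' : ∑ j ∈ Finset.Icc 1 J, levelCost (flipCum (N j) K) K (flowState c F j) ≤
      (K + 1) * ∑ j ∈ Finset.Icc 1 J, c j - T) :
    ∃ i k t, 1 ≤ t ∧ (∀ e, i ≤ e → e < i + t → 0 < F e) ∧ (∀ e, k ≤ e → e < k + t → F e < 0) ∧
      1 ≤ c i ∧ c (i + t) < N (i + t) K ∧ 1 ≤ c (k + t) ∧ c k < N k K ∧
      ∑ j ∈ Finset.Icc 1 J,
        levelCost (N j) K (flowState c (fun e => edgeFlow i t e - edgeFlow k t e) j) ≤ T ∧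
      ∑ j ∈ Finset.Icc 1 J, levelCost (flipCum (N j) K) K
          (flowState c (fun e => edgeFlow i t e - edgeFlow k t e) j) ≤
        (K + 1) * ∑ j ∈ Finset.Icc 1 J, c j - T := by
  have hreg := flowRegion_of_flow (J := J) (cap := fun j => N j K) hF hcap h0 h1 h0' h1'
  obtain ⟨i, k, t, ht, hA, hB, a1, a2, a3, a4, ha⟩ :=
    exists_cheap_exchange (levelData_levelCost hN hN0 K) hF hreg hsum hne hT hT'
  have hflipK : (fun j => flipCum (N j) K K) = fun j => N j K := by
    funext j
    rw [flipCum_of_le _ le_rfl, Nat.sub_self, hN0, sub_zero]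
  obtain ⟨i', k', t', ht', hA', hB', b1, b2, b3, b4, hb⟩ :=
    exists_cheap_exchange (hflipK ▸ levelData_levelCost (fun j => strictMono_flipCum (hN j) K)
      (fun j => flipCum_zero (N j) K) K) hF hreg hsum hne hG hG'
  by_cases h2 : ∑ j ∈ Finset.Icc 1 J, levelCost (flipCum (N j) K) K
      (flowState c (fun e => edgeFlow i t e - edgeFlow k t e) j) ≤
      (K + 1) * ∑ j ∈ Finset.Icc 1 J, c j - T
  · exact ⟨i, k, t, ht, hA, hB, a1, a2, a3, a4, ha, h2⟩
  by_cases h3 : ∑ j ∈ Finset.Icc 1 J, levelCost (N j) K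
      (flowState c (fun e => edgeFlow i' t' e - edgeFlow k' t' e) j) ≤ T
  · exact ⟨i', k', t', ht', hA', hB', b1, b2, b3, b4, h3, hb⟩
  -- Now the least cost of `v` is at least `T + 1` and the flipped cost of `u` at least `(K + 1) * ∑
  -- c - T + 1`. Twice their sum thus exceeds `2 * (K + 1) * ∑ c` by at least `4`, while the
  -- columnwise estimate allows only `∑ (ε + η) ≤ 2`.
  exfalso
  push Not at h2 h3
  obtain ⟨ε, hε, hε'⟩ := exists_excess c (Finset.Icc 1 J) (i := i) (k := k) ht
  obtain ⟨η, hη, hη'⟩ := exists_excess c (Finset.Icc 1 J) (i := i') (k := k') ht'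
  have s1 := sum_flowState_exchange c hF ht hA hB
  have s2 := sum_flowState_exchange c hF ht' hA' hB'
  have r1 := exchange_mem_Icc hreg ht hA hB a1 a2 a3 a4
  have r2 := exchange_mem_Icc hreg ht' hA' hB' b1 b2 b3 b4
  set u := flowState c (fun e => edgeFlow i t e - edgeFlow k t e)
  set v := flowState c (fun e => edgeFlow i' t' e - edgeFlow k' t' e)
  have hcol : ∑ j ∈ Finset.Icc 1 J,
      (2 * levelCost (N j) K (v j) + 2 * levelCost (flipCum (N j) K) K (u j)) ≤
      ∑ j ∈ Finset.Icc 1 J, (((K : ℤ) + 1) * (v j + u j) + (ε j + η j)) := by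
    refine Finset.sum_le_sum fun j _ => ?_
    have h4 := abs_le.1 (hε' j).2.2
    have h5 := abs_le.1 (hη' j).2.2
    have h6 := hε' j
    have h7 := hη' j
    have h8 : |v j - u j| ≤ 2 + ε j + η j := by rw [abs_le]; omega
    have h9 := levelCost_add_levelCost_flip (hN j) (hN0 j) K (r2 j).1 (r1 j).1 (r2 j).2 (r1 j).2
      (by omega)
    have h10 : max 0 (|v j - u j| - 2) ≤ ε j + η j := by omega
    linarith
  simp only [Finset.sum_add_distrib, ← Finset.mul_sum] at hcol
  rw [s1, s2] at hcol
  linarith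

/-! ### Tables on the integer grid -/

/-- The cells of the grid with columns `1, …, J` and levels `1, …, K`. -/
def InBox (J K : ℕ) (p : ℤ × ℤ) : Prop := 1 ≤ p.1 ∧ p.1 ≤ J ∧ 1 ≤ p.2 ∧ p.2 ≤ K

/-- Tables with capacities `n`, supported in the box. -/
def IsTable (J K : ℕ) (n x : ℤ × ℤ → ℤ) : Prop :=
  ∀ p, 0 ≤ x p ∧ x p ≤ n p ∧ (x p ≠ 0 → InBox J K p)

/-- A unit in the cell `p`. -/
def unit (p q : ℤ × ℤ) : ℤ := if q = p then 1 else 0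

/-- The column `j` of a table. -/
def column (x : ℤ × ℤ → ℤ) (j k : ℤ) : ℤ := x (j, k)

/-- The number of units in the column `j`. -/
def colSum (K : ℕ) (x : ℤ × ℤ → ℤ) (j : ℤ) : ℤ := cum (column x j) K

/-- The sum of the levels of the units of a table. -/
noncomputable def levelTotal (J K : ℕ) (x : ℤ × ℤ → ℤ) : ℤ :=
  ∑ j ∈ Finset.Icc (1 : ℤ) J, levelSum K (column x j)

/-- Two units move in such a way that the sum of their positions does not change. -/
def Step (J K : ℕ) (n x y : ℤ × ℤ → ℤ) : Prop :=
  IsTable J K n x ∧ IsTable J K n y ∧ ∃ p₁ p₂ q₁ q₂, InBox J K p₁ ∧ InBox J K p₂ ∧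
    InBox J K q₁ ∧ InBox J K q₂ ∧ p₁ + p₂ = q₁ + q₂ ∧
    y = x - unit p₁ - unit p₂ + unit q₁ + unit q₂

theorem unit_self (p : ℤ × ℤ) : unit p p = 1 := if_pos rfl

theorem unit_of_ne {p q : ℤ × ℤ} (h : q ≠ p) : unit p q = 0 := if_neg h

theorem unit_nonneg (p q : ℤ × ℤ) : 0 ≤ unit p q := by
  rw [unit]
  split_ifs <;> omega

theorem IsTable.add_unit {J K : ℕ} {n x : ℤ × ℤ → ℤ} (h : IsTable J K n x) {p : ℤ × ℤ}
    (hp : InBox J K p) (hxp : x p < n p) : IsTable J K n (x + unit p) := by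
  intro q
  have hq := h q
  by_cases hqp : q = p
  · subst hqp
    rw [Pi.add_apply, unit_self]
    exact ⟨by omega, by omega, fun _ => hp⟩
  · rw [Pi.add_apply, unit_of_ne hqp, add_zero]
    exact hq

theorem IsTable.sub_unit {J K : ℕ} {n x : ℤ × ℤ → ℤ} (h : IsTable J K n x) {p : ℤ × ℤ}
    (hxp : 0 < x p) : IsTable J K n (x - unit p) := by
  intro q
  have hq := h q
  by_cases hqp : q = p
  · subst hqp
    rw [Pi.sub_apply, unit_self]
    exact ⟨by omega, by omega, fun _ => hq.2.2 (by omega)⟩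
  · rw [Pi.sub_apply, unit_of_ne hqp, sub_zero]
    exact hq

theorem cum_column_unit {p : ℤ × ℤ} (hp : 1 ≤ p.2) (j : ℤ) (k : ℕ) :
    cum (column (unit p) j) k = if j = p.1 ∧ p.2 ≤ k then 1 else 0 := by
  simp only [cum, column, unit]
  by_cases hj : j = p.1
  · subst hj
    have h1 : ∀ i ∈ Finset.range k, (if ((p.1, (i : ℤ) + 1) : ℤ × ℤ) = p then (1 : ℤ) else 0) =
        if i = (p.2 - 1).toNat then 1 else 0 := by
      intro i _
      have : ((p.1, (i : ℤ) + 1) : ℤ × ℤ) = p ↔ i = (p.2 - 1).toNat := by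
        rw [Prod.ext_iff]
        simp only [true_and]
        omega
      simp only [this]
    rw [Finset.sum_congr rfl h1, Finset.sum_ite_eq']
    simp only [Finset.mem_range, true_and]
    split_ifs <;> omega
  · rw [if_neg (fun h => hj h.1)]
    exact Finset.sum_eq_zero fun i _ => if_neg fun h => hj (by rw [← h])

theorem column_add (x y : ℤ × ℤ → ℤ) (j : ℤ) : column (x + y) j = column x j + column y j := rfl

theorem column_sub (x y : ℤ × ℤ → ℤ) (j : ℤ) : column (x - y) j = column x j - column y j := rfl

theorem colSum_add (K : ℕ) (x y : ℤ × ℤ → ℤ) (j : ℤ) :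
    colSum K (x + y) j = colSum K x j + colSum K y j := cum_add _ _ _

theorem colSum_sub (K : ℕ) (x y : ℤ × ℤ → ℤ) (j : ℤ) :
    colSum K (x - y) j = colSum K x j - colSum K y j := cum_sub _ _ _

theorem colSum_unit {J K : ℕ} {p : ℤ × ℤ} (hp : InBox J K p) (j : ℤ) :
    colSum K (unit p) j = if j = p.1 then 1 else 0 := by
  rw [colSum, cum_column_unit hp.2.2.1]
  simp only [hp.2.2.2, and_true]

theorem levelTotal_add (J K : ℕ) (x y : ℤ × ℤ → ℤ) :
    levelTotal J K (x + y) = levelTotal J K x + levelTotal J K y := by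
  simp only [levelTotal, column_add, levelSum_add, Finset.sum_add_distrib]

theorem levelTotal_sub (J K : ℕ) (x y : ℤ × ℤ → ℤ) :
    levelTotal J K (x - y) = levelTotal J K x - levelTotal J K y := by
  simp only [levelTotal, column_sub, levelSum_sub, Finset.sum_sub_distrib]

theorem levelSum_column_unit {K : ℕ} {p : ℤ × ℤ} (hp : 1 ≤ p.2) (hpK : p.2 ≤ K) (j : ℤ) :
    levelSum K (column (unit p) j) = if j = p.1 then p.2 else 0 := by
  rw [levelSum_eq_sum_cum]
  simp only [cum_column_unit hp, hpK, and_true]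
  by_cases hj : j = p.1
  · simp only [hj, if_true, true_and]
    have h1 : ∀ k ∈ Finset.range (K + 1), (1 - if p.2 ≤ (k : ℤ) then (1 : ℤ) else 0) =
        if k ∈ Finset.range p.2.toNat then 1 else 0 := by
      intro k _
      simp only [Finset.mem_range]
      split_ifs <;> omega
    rw [Finset.sum_congr rfl h1, Finset.sum_ite_mem, Finset.inter_eq_right.2]
    · simp
      omega
    · intro k hk
      rw [Finset.mem_range] at hk ⊢
      omega
  · simp [hj]

theorem levelTotal_unit {J K : ℕ} {p : ℤ × ℤ} (hp : InBox J K p) :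
    levelTotal J K (unit p) = p.2 := by
  simp only [levelTotal, levelSum_column_unit hp.2.2.1 hp.2.2.2, Finset.sum_ite_eq',
    Finset.mem_Icc]
  exact if_pos ⟨hp.1, hp.2.1⟩

/-! ### Flows inside the columns -/

theorem cum_toNat_sub_one {z : ℤ → ℤ} {k : ℤ} (hz : ∀ k, k < 1 → z k = 0) :
    cum z k.toNat - cum z (k - 1).toNat = z k := by
  by_cases hk : 1 ≤ k
  · obtain ⟨m, rfl⟩ : ∃ m : ℕ, k = m + 1 := ⟨(k - 1).toNat, by omega⟩
    rw [show ((m : ℤ) + 1).toNat = m + 1 by omega, show ((m : ℤ) + 1 - 1).toNat = m by omega,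
      cum_succ]
    ring
  · rw [hz k (by omega), show k.toNat = 0 by omega, show (k - 1).toNat = 0 by omega, sub_self]

theorem cum_eq_of_le {z : ℤ → ℤ} {K : ℕ} (hz : ∀ k : ℤ, K < k → z k = 0) {m : ℕ} (hm : K ≤ m) :
    cum z m = cum z K := by
  induction m, hm using Nat.le_induction with
  | base => rfl
  | succ m hm ih => rw [cum_succ, ih, hz _ (by omega), add_zero]

/-- Where more units of `y` than of `y'` are at the levels up to some `k`, a unit of `y` can go
up. -/
theorem exists_up_hop_of_cum {y y' n : ℤ → ℤ} {K : ℕ} (hy' : ∀ k, 0 ≤ y' k)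
    (hyn' : ∀ k, y' k ≤ n k) (hn : ∀ k, 1 ≤ n k) (hlo : ∀ k, k < 1 → y k = y' k)
    (hhi : ∀ k : ℤ, K < k → y k = y' k) (hK : cum y K = cum y' K) {m : ℕ}
    (hm : cum y' m < cum y m) :
    ∃ k : ℕ, 1 ≤ k ∧ k < K ∧ cum y' k < cum y k ∧ 0 < y k ∧ y (k + 1) < n (k + 1) := by
  set F : ℤ → ℤ := fun k => cum (y - y') k.toNat with hF
  have h0 : ∀ i, i ≤ 0 → F i ≤ 0 := fun i hi => by
    simp only [hF]
    rw [show i.toNat = 0 by omega, cum_zero]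
  have h1 : ∀ i, (K : ℤ) ≤ i → F i ≤ 0 := fun i hi => by
    simp only [hF]
    rw [cum_eq_of_le (K := K) (fun k hk => by rw [Pi.sub_apply, hhi k hk, sub_self])
      (by omega : K ≤ i.toNat), cum_sub, hK, sub_self]
  have h2 : 0 < F m := by simp only [hF, Int.toNat_natCast, cum_sub]; omega
  have h3 : ∀ k, F k - F (k - 1) = y k - y' k := fun k =>
    cum_toNat_sub_one (z := y - y') fun k hk => by rw [Pi.sub_apply, hlo k hk, sub_self]
  obtain ⟨l, hl1, hl2, hl3⟩ := exists_left_end h0 h2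
  obtain ⟨r, hr1, hr2, hr3⟩ := exists_right_end h1 h2
  -- At the left end `l` of the interval where the partial sums of `y` are ahead, `y l > y' l ≥ 0`;
  -- at the right end `y r < y' r ≤ n r`.
  obtain ⟨k, hk1, hk2, hk3, hk4⟩ := exists_hop (x := y) (n := n) (by omega : l < r)
    (fun k _ _ => hn k) (by have := h3 l; have := hy' l; omega)
    (by have := h3 r; have := hyn' r; omega)
  have hFk : 0 < F k := by
    rcases le_total k m with h | h
    · exact hl3 k hk1 h
    · exact hr3 k h hk2
  have hk5 : 1 ≤ k := by
    by_contra hc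
    have := h0 k (by omega)
    omega
  have hk6 : k < K := by
    by_contra hc
    have := h1 k (by omega)
    omega
  obtain ⟨q, rfl⟩ : ∃ q : ℕ, k = q := ⟨k.toNat, by omega⟩
  simp only [hF, Int.toNat_natCast, cum_sub] at hFk
  exact ⟨q, by omega, by omega, by omega, hk3, hk4⟩

/-- Passing to the holes `n - y` and `n - y'` turns hops up into hops down. -/
theorem exists_down_hop_of_cum {y y' n : ℤ → ℤ} {K : ℕ} (hy' : ∀ k, 0 ≤ y' k)
    (hyn' : ∀ k, y' k ≤ n k) (hn : ∀ k, 1 ≤ n k) (hlo : ∀ k, k < 1 → y k = y' k)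
    (hhi : ∀ k : ℤ, K < k → y k = y' k) (hK : cum y K = cum y' K) {m : ℕ}
    (hm : cum y m < cum y' m) :
    ∃ k : ℕ, 1 ≤ k ∧ k < K ∧ cum y k < cum y' k ∧ 0 < y (k + 1) ∧ y k < n k := by
  obtain ⟨k, h1, h2, h3, h4, h5⟩ := exists_up_hop_of_cum (y := n - y) (y' := n - y') (n := n)
    (K := K) (m := m) (fun k => sub_nonneg.2 (hyn' k)) (fun k => sub_le_self _ (hy' k)) hn
    (fun k hk => by rw [Pi.sub_apply, Pi.sub_apply, hlo k hk])
    (fun k hk => by rw [Pi.sub_apply, Pi.sub_apply, hhi k hk])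
    (by rw [cum_sub, cum_sub, hK]) (by rw [cum_sub, cum_sub]; omega)
  simp only [cum_sub, Pi.sub_apply] at h3 h4 h5
  exact ⟨k, h1, h2, by omega, by omega, by omega⟩

theorem IsTable.column_lo {J K : ℕ} {n x : ℤ × ℤ → ℤ} (h : IsTable J K n x) (j : ℤ) {k : ℤ}
    (hk : k < 1) : column x j k = 0 := by
  by_contra hc
  have := ((h (j, k)).2.2 hc).2.2.1
  simp at this
  omega

theorem IsTable.column_hi {J K : ℕ} {n x : ℤ × ℤ → ℤ} (h : IsTable J K n x) (j : ℤ) {k : ℤ}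
    (hk : K < k) : column x j k = 0 := by
  by_contra hc
  have := ((h (j, k)).2.2 hc).2.2.2
  simp at this
  omega

/-- Tables with the same column sums and the same sum of levels are connected. -/
theorem reach_of_colSum_eq {J K : ℕ} {n : ℤ × ℤ → ℤ} (hn : ∀ p, 1 ≤ n p) {x y : ℤ × ℤ → ℤ}
    (hx : IsTable J K n x) (hy : IsTable J K n y) (hc : ∀ j, colSum K x j = colSum K y j)
    (hT : levelTotal J K x = levelTotal J K y) : Relation.ReflTransGen (Step J K n) x y := by
  induction hN : (∑ j ∈ Finset.Icc (1 : ℤ) J, ∑ k ∈ Finset.range (K + 1),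
    |cum (column x j) k - cum (column y j) k|).toNat using Nat.strong_induction_on
    generalizing x with
  | _ N ih =>
  subst hN
  set F : ℤ → ℕ → ℤ := fun j k => cum (column x j) k - cum (column y j) k with hF
  -- Equal sums of levels mean that the vertical flows of all columns together are balanced. Hence,
  -- unless `x = y`, a hop up and a hop down are both needed somewhere, possibly in the same column.
  have hsum : ∑ j ∈ Finset.Icc (1 : ℤ) J, ∑ k ∈ Finset.range (K + 1), F j k = 0 := by
    have h1 : ∀ j ∈ Finset.Icc (1 : ℤ) J, ∑ k ∈ Finset.range (K + 1), F j k =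
        levelSum K (column y j) - levelSum K (column x j) := by
      intro j _
      rw [levelSum_eq_sum_cum, levelSum_eq_sum_cum, ← Finset.sum_sub_distrib]
      refine Finset.sum_congr rfl fun k _ => ?_
      have := hc j
      simp only [colSum] at this
      simp only [hF]
      omega
    rw [Finset.sum_congr rfl h1, Finset.sum_sub_distrib]
    simp only [levelTotal] at hT
    omega
  by_cases hall : ∀ j ∈ Finset.Icc (1 : ℤ) J, ∀ k ∈ Finset.range (K + 1), F j k = 0
  · have : x = y := by
      funext ⟨j, k⟩
      by_cases hbox : InBox J K (j, k)
      · obtain ⟨h1, h2, h3, h4⟩ := hbox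
        simp only at h1 h2 h3 h4
        obtain ⟨m, rfl⟩ : ∃ m : ℕ, k = m + 1 := ⟨(k - 1).toNat, by omega⟩
        have h5 := hall j (Finset.mem_Icc.2 ⟨h1, h2⟩) (m + 1) (Finset.mem_range.2 (by omega))
        have h6 := hall j (Finset.mem_Icc.2 ⟨h1, h2⟩) m (Finset.mem_range.2 (by omega))
        simp only [hF, cum_succ, column] at h5 h6
        omega
      · have h1 : x (j, k) = 0 := by
          by_contra hcon
          exact hbox ((hx _).2.2 hcon)
        have h2 : y (j, k) = 0 := by
          by_contra hcon
          exact hbox ((hy _).2.2 hcon)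
        rw [h1, h2]
    rw [this]
  push Not at hall
  obtain ⟨j₀, hj₀, k₀, hk₀, hne⟩ := hall
  have hpos : ∃ j ∈ Finset.Icc (1 : ℤ) J, ∃ k ∈ Finset.range (K + 1), 0 < F j k := by
    by_contra! hcon
    have h1 : ∀ j ∈ Finset.Icc (1 : ℤ) J, ∑ k ∈ Finset.range (K + 1), F j k ≤ 0 :=
      fun j hj => Finset.sum_nonpos fun k hk => hcon j hj k hk
    have h2 := (Finset.sum_eq_zero_iff_of_nonpos h1).1 hsum j₀ hj₀
    exact hne ((Finset.sum_eq_zero_iff_of_nonpos (hcon j₀ hj₀)).1 h2 k₀ hk₀)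
  have hneg : ∃ j ∈ Finset.Icc (1 : ℤ) J, ∃ k ∈ Finset.range (K + 1), F j k < 0 := by
    by_contra! hcon
    have h1 : ∀ j ∈ Finset.Icc (1 : ℤ) J, 0 ≤ ∑ k ∈ Finset.range (K + 1), F j k :=
      fun j hj => Finset.sum_nonneg fun k hk => hcon j hj k hk
    have h2 := (Finset.sum_eq_zero_iff_of_nonneg h1).1 hsum j₀ hj₀
    exact hne ((Finset.sum_eq_zero_iff_of_nonneg (hcon j₀ hj₀)).1 h2 k₀ hk₀)
  obtain ⟨j, hj, k', -, hk'⟩ := hpos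
  obtain ⟨i, hi, l', -, hl'⟩ := hneg
  have hjc := hc j
  have hic := hc i
  simp only [colSum] at hjc hic
  obtain ⟨k, hk1, hkK, hkF, hk2, hk3⟩ := exists_up_hop_of_cum (y := column x j)
    (y' := column y j) (n := column n j) (K := K) (m := k') (fun k => (hy _).1)
    (fun k => (hy _).2.1) (fun k => hn _)
    (fun k hk => by rw [hx.column_lo j hk, hy.column_lo j hk])
    (fun k hk => by rw [hx.column_hi j hk, hy.column_hi j hk]) hjc (by simp only [hF] at hk'; omega)
  obtain ⟨l, hl1, hlK, hlF, hl2, hl3⟩ := exists_down_hop_of_cum (y := column x i)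
    (y' := column y i) (n := column n i) (K := K) (m := l') (fun k => (hy _).1)
    (fun k => (hy _).2.1) (fun k => hn _)
    (fun k hk => by rw [hx.column_lo i hk, hy.column_lo i hk])
    (fun k hk => by rw [hx.column_hi i hk, hy.column_hi i hk]) hic (by simp only [hF] at hl'; omega)
  rw [Finset.mem_Icc] at hi hj
  have b1 : InBox J K (j, (k : ℤ)) := ⟨hj.1, hj.2, by dsimp only; omega, by dsimp only; omega⟩
  have b2 : InBox J K (j, (k : ℤ) + 1) := ⟨hj.1, hj.2, by dsimp only; omega, by dsimp only; omega⟩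
  have b3 : InBox J K (i, (l : ℤ)) := ⟨hi.1, hi.2, by dsimp only; omega, by dsimp only; omega⟩
  have b4 : InBox J K (i, (l : ℤ) + 1) := ⟨hi.1, hi.2, by dsimp only; omega, by dsimp only; omega⟩
  simp only [column] at hk2 hk3 hl2 hl3
  have hnkl : ¬ (i = j ∧ l = k) := by
    rintro ⟨rfl, rfl⟩
    omega
  -- the two hops together
  set x' := x - unit (j, (k : ℤ)) - unit (i, (l : ℤ) + 1) + unit (j, (k : ℤ) + 1) +
    unit (i, (l : ℤ)) with hx'
  have t1 : IsTable J K n (x - unit (j, (k : ℤ))) := hx.sub_unit hk2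
  have t2 : IsTable J K n (x - unit (j, (k : ℤ)) - unit (i, (l : ℤ) + 1)) := by
    refine t1.sub_unit ?_
    rw [Pi.sub_apply]
    -- Both hops may start from the same cell. Then `F` is negative just below it and positive at
    -- it, so that `x` exceeds `y` there by at least two.
    by_cases h : ((i, (l : ℤ) + 1) : ℤ × ℤ) = (j, (k : ℤ))
    · rw [h, unit_self]
      obtain ⟨rfl, h2⟩ := Prod.ext_iff.1 h
      simp only at h2
      obtain rfl : k = l + 1 := by omega
      have h3 := cum_succ (column x i) l
      have h4 := cum_succ (column y i) l
      have h5 := (hy (i, (l : ℤ) + 1)).1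
      simp only [column] at h3 h4 hkF hlF
      push_cast
      omega
    · rw [unit_of_ne h]
      omega
  have t3 : IsTable J K n (x - unit (j, (k : ℤ)) - unit (i, (l : ℤ) + 1) +
      unit (j, (k : ℤ) + 1)) := by
    refine t2.add_unit b2 ?_
    rw [Pi.sub_apply, Pi.sub_apply]
    have h1 := unit_nonneg (j, (k : ℤ)) (j, (k : ℤ) + 1)
    have h2 := unit_nonneg (i, (l : ℤ) + 1) (j, (k : ℤ) + 1)
    omega
  have t4 : IsTable J K n x' := by
    refine t3.add_unit b3 ?_
    rw [Pi.add_apply, Pi.sub_apply, Pi.sub_apply]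
    have h1 := unit_nonneg (j, (k : ℤ)) (i, (l : ℤ))
    have h2 := unit_nonneg (i, (l : ℤ) + 1) (i, (l : ℤ))
    -- Both hops may end in the same cell. Dually, `x` is then smaller than `y` there by at least
    -- two, which leaves room for both units.
    by_cases h : ((i, (l : ℤ)) : ℤ × ℤ) = (j, (k : ℤ) + 1)
    · rw [h, unit_self, ← h]
      obtain ⟨rfl, h2⟩ := Prod.ext_iff.1 h
      simp only at h2
      obtain rfl : l = k + 1 := by omega
      have h3 := cum_succ (column x i) k
      have h4 := cum_succ (column y i) k
      have h5 := (hy (i, (k : ℤ) + 1)).2.1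
      simp only [column] at h3 h4 hkF hlF
      push_cast at *
      omega
    · rw [unit_of_ne h]
      omega
  have hstep : Step J K n x x' := by
    refine ⟨hx, t4, (j, (k : ℤ)), (i, (l : ℤ) + 1), (j, (k : ℤ) + 1), (i, (l : ℤ)), b1, b4, b2, b3,
      ?_, rfl⟩
    rw [Prod.ext_iff]
    simp only [Prod.mk_add_mk, true_and]
    ring
  have hc' : ∀ a, colSum K x' a = colSum K x a := fun a => by
    simp only [hx', colSum_add, colSum_sub, colSum_unit b1, colSum_unit b2, colSum_unit b3,
      colSum_unit b4]
    ring
  have hT' : levelTotal J K x' = levelTotal J K x := by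
    simp only [hx', levelTotal_add, levelTotal_sub, levelTotal_unit b1, levelTotal_unit b2,
      levelTotal_unit b3, levelTotal_unit b4]
    ring
  have hcum : ∀ (a : ℤ) (m : ℕ), cum (column x' a) m - cum (column y a) m =
      F a m - (if a = j ∧ m = k then 1 else 0) + (if a = i ∧ m = l then 1 else 0) := by
    intro a m
    simp only [hx', column_add, column_sub, cum_add, cum_sub]
    rw [cum_column_unit b1.2.2.1, cum_column_unit b2.2.2.1, cum_column_unit b3.2.2.1,
      cum_column_unit b4.2.2.1]
    simp only [hF]
    have e : (if a = j ∧ (k : ℤ) ≤ m then (1 : ℤ) else 0) -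
        (if a = j ∧ (k : ℤ) + 1 ≤ m then 1 else 0) = if a = j ∧ m = k then 1 else 0 := by
      split_ifs <;> omega
    have e' : (if a = i ∧ (l : ℤ) ≤ m then (1 : ℤ) else 0) -
        (if a = i ∧ (l : ℤ) + 1 ≤ m then 1 else 0) = if a = i ∧ m = l then 1 else 0 := by
      split_ifs <;> omega
    linarith
  refine Relation.ReflTransGen.head hstep (ih _ ?_ t4 (fun a => (hc' a).trans (hc a))
    (hT'.trans hT) rfl)
  have hle : ∀ a m, |cum (column x' a) m - cum (column y a) m| ≤ |F a m| := by
    intro a m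
    rw [hcum]
    by_cases h1 : a = j ∧ m = k
    · have h2 : ¬ (a = i ∧ m = l) := fun h2 => hnkl ⟨by omega, by omega⟩
      have h3 : 0 < F a m := by rw [h1.1, h1.2]; simp only [hF]; omega
      rw [if_pos h1, if_neg h2, abs_of_pos h3, abs_of_nonneg] <;> omega
    · by_cases h2 : a = i ∧ m = l
      · have h3 : F a m < 0 := by rw [h2.1, h2.2]; simp only [hF]; omega
        rw [if_neg h1, if_pos h2, abs_of_neg h3, abs_of_nonpos] <;> omega
      · rw [if_neg h1, if_neg h2, sub_zero, add_zero]
  have hlt : |cum (column x' j) k - cum (column y j) k| < |F j k| := by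
    have h2 : ¬ (j = i ∧ k = l) := fun h2 => hnkl ⟨h2.1.symm, h2.2.symm⟩
    have h3 : 0 < F j k := by simp only [hF]; omega
    rw [hcum, if_pos ⟨rfl, rfl⟩, if_neg h2, abs_of_pos h3, abs_of_nonneg] <;> omega
  have htot : ∑ a ∈ Finset.Icc (1 : ℤ) J, ∑ m ∈ Finset.range (K + 1),
      |cum (column x' a) m - cum (column y a) m| <
      ∑ a ∈ Finset.Icc (1 : ℤ) J, ∑ m ∈ Finset.range (K + 1), |F a m| :=
    Finset.sum_lt_sum (fun a _ => Finset.sum_le_sum fun m _ => hle a m)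
      ⟨j, Finset.mem_Icc.2 hj, Finset.sum_lt_sum (fun m _ => hle j m)
        ⟨k, Finset.mem_range.2 (by omega), hlt⟩⟩
  have h0 : 0 ≤ ∑ a ∈ Finset.Icc (1 : ℤ) J, ∑ m ∈ Finset.range (K + 1),
      |cum (column x' a) m - cum (column y a) m| :=
    Finset.sum_nonneg fun _ _ => Finset.sum_nonneg fun _ _ => abs_nonneg _
  simp only [hF] at htot
  omega

/-! ### Moving two units between columns -/

/-- The table `b + u₁ + u₂` and the table `b + v₁ + v₂` differ in the positions of two units, which
are in the columns `i`, `i'` and `j`, `j'`, respectively. -/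
structure IsExchange (J K : ℕ) (n : ℤ × ℤ → ℤ) (i i' j j' : ℤ) (b : ℤ × ℤ → ℤ)
    (u₁ u₂ v₁ v₂ : ℤ × ℤ) : Prop where
  base : IsTable J K n b
  left : IsTable J K n (b + unit u₁ + unit u₂)
  right : IsTable J K n (b + unit v₁ + unit v₂)
  box_u₁ : InBox J K u₁
  box_u₂ : InBox J K u₂
  box_v₁ : InBox J K v₁
  box_v₂ : InBox J K v₂
  u₁_fst : u₁.1 = i
  u₂_fst : u₂.1 = i'
  v₁_fst : v₁.1 = j
  v₂_fst : v₂.1 = j'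

theorem IsExchange.swap_left {J K : ℕ} {n : ℤ × ℤ → ℤ} {i i' j j' : ℤ} {b : ℤ × ℤ → ℤ}
    {u₁ u₂ v₁ v₂ : ℤ × ℤ} (h : IsExchange J K n i i' j j' b u₁ u₂ v₁ v₂) :
    IsExchange J K n i' i j j' b u₂ u₁ v₁ v₂ :=
  ⟨h.base, by rw [add_right_comm]; exact h.left, h.right, h.box_u₂, h.box_u₁, h.box_v₁, h.box_v₂,
    h.u₂_fst, h.u₁_fst, h.v₁_fst, h.v₂_fst⟩

theorem IsExchange.swap_right {J K : ℕ} {n : ℤ × ℤ → ℤ} {i i' j j' : ℤ} {b : ℤ × ℤ → ℤ}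
    {u₁ u₂ v₁ v₂ : ℤ × ℤ} (h : IsExchange J K n i i' j j' b u₁ u₂ v₁ v₂) :
    IsExchange J K n i i' j' j b u₁ u₂ v₂ v₁ :=
  ⟨h.base, h.left, by rw [add_right_comm]; exact h.right, h.box_u₁, h.box_u₂, h.box_v₂, h.box_v₁,
    h.u₁_fst, h.u₂_fst, h.v₂_fst, h.v₁_fst⟩

/-- The difference of the sums of levels of an exchange can be changed by `δ`, while the
sum of levels of the left table and all the column sums are preserved. -/
def CanShift (J K : ℕ) (n : ℤ × ℤ → ℤ) (i i' j j' : ℤ) (b : ℤ × ℤ → ℤ)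
    (u₁ u₂ v₁ v₂ : ℤ × ℤ) (δ : ℤ) : Prop :=
  ∃ b' u₁' u₂' v₁' v₂', IsExchange J K n i i' j j' b' u₁' u₂' v₁' v₂' ∧
    (∀ a, colSum K b' a = colSum K b a) ∧
    levelTotal J K b' + u₁'.2 + u₂'.2 = levelTotal J K b + u₁.2 + u₂.2 ∧
    v₁'.2 + v₂'.2 - u₁'.2 - u₂'.2 = v₁.2 + v₂.2 - u₁.2 - u₂.2 + δ

theorem CanShift.swap_left {J K : ℕ} {n : ℤ × ℤ → ℤ} {i i' j j' : ℤ} {b : ℤ × ℤ → ℤ}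
    {u₁ u₂ v₁ v₂ : ℤ × ℤ} {δ : ℤ} (h : CanShift J K n i' i j j' b u₂ u₁ v₁ v₂ δ) :
    CanShift J K n i i' j j' b u₁ u₂ v₁ v₂ δ := by
  obtain ⟨b', u₁', u₂', v₁', v₂', h1, h2, h3, h4⟩ := h
  exact ⟨b', u₂', u₁', v₁', v₂', h1.swap_left, h2, by omega, by omega⟩

theorem CanShift.swap_right {J K : ℕ} {n : ℤ × ℤ → ℤ} {i i' j j' : ℤ} {b : ℤ × ℤ → ℤ}
    {u₁ u₂ v₁ v₂ : ℤ × ℤ} {δ : ℤ} (h : CanShift J K n i i' j' j b u₁ u₂ v₂ v₁ δ) :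
    CanShift J K n i i' j j' b u₁ u₂ v₁ v₂ δ := by
  obtain ⟨b', u₁', u₂', v₁', v₂', h1, h2, h3, h4⟩ := h
  exact ⟨b', u₁', u₂', v₂', v₁', h1.swap_right, h2, by omega, by omega⟩

/-! ### Correcting the level difference by one -/

/-- The cell below `p`. -/
def below (p : ℤ × ℤ) : ℤ × ℤ := (p.1, p.2 - 1)

/-- The cell above `p`. -/
def above (p : ℤ × ℤ) : ℤ × ℤ := (p.1, p.2 + 1)

theorem ne_of_fst_ne {p q : ℤ × ℤ} (h : p.1 ≠ q.1) : p ≠ q := fun h' => h (by rw [h'])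

theorem below_ne (p : ℤ × ℤ) : below p ≠ p := fun h => by
  have := congrArg Prod.snd h
  simp only [below] at this
  omega

theorem above_ne (p : ℤ × ℤ) : above p ≠ p := fun h => by
  have := congrArg Prod.snd h
  simp only [above] at this
  omega

theorem above_below (p : ℤ × ℤ) : above (below p) = p := by
  simp [below, above]

theorem InBox.below {J K : ℕ} {p : ℤ × ℤ} (h : InBox J K p) (h2 : 2 ≤ p.2) :
    InBox J K (below p) := ⟨h.1, h.2.1, by simp only [BivariateLogistic.below]; omega,
      by simp only [BivariateLogistic.below]; have := h.2.2.2; omega⟩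

theorem InBox.above {J K : ℕ} {p : ℤ × ℤ} (h : InBox J K p) (h2 : p.2 < K) :
    InBox J K (above p) := ⟨h.1, h.2.1, by
      simp only [BivariateLogistic.above]; have := h.2.2.1; omega,
      by simp only [BivariateLogistic.above]; omega⟩

/-- A unit of a table goes from `p` to `q`. -/
theorem IsTable.hop {J K : ℕ} {n x : ℤ × ℤ → ℤ} (h : IsTable J K n x) {p q : ℤ × ℤ}
    (hp : 0 < x p) (hq : InBox J K q) (hxq : x q < n q) : IsTable J K n (x - unit p + unit q) := by
  refine (h.sub_unit hp).add_unit hq ?_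
  rw [Pi.sub_apply]
  have := unit_nonneg p q
  omega

theorem IsTable.inBox {J K : ℕ} {n x : ℤ × ℤ → ℤ} (h : IsTable J K n x) {p : ℤ × ℤ}
    (hp : 0 < x p) : InBox J K p := (h p).2.2 (by omega)

/-- Lower the first unit on the right. -/
theorem IsExchange.lower_right {J K : ℕ} {n : ℤ × ℤ → ℤ} {i i' j j' : ℤ} {b : ℤ × ℤ → ℤ}
    {u₁ u₂ v₁ v₂ : ℤ × ℤ} (h : IsExchange J K n i i' j j' b u₁ u₂ v₁ v₂) (h2 : 2 ≤ v₁.2)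
    (hlt : (b + unit v₁ + unit v₂) (below v₁) < n (below v₁)) :
    CanShift J K n i i' j j' b u₁ u₂ v₁ v₂ (-1) := by
  refine ⟨b, u₁, u₂, below v₁, v₂, ⟨h.base, h.left, ?_, h.box_u₁, h.box_u₂, h.box_v₁.below h2,
    h.box_v₂, h.u₁_fst, h.u₂_fst, h.v₁_fst, h.v₂_fst⟩, fun _ => rfl, rfl, ?_⟩
  · have := h.right.hop (p := v₁) (q := below v₁) (by
      have h3 := (h.base v₁).1
      have h4 := unit_nonneg v₂ v₁
      simp only [Pi.add_apply, unit_self]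
      omega) (h.box_v₁.below h2) hlt
    convert this using 1
    abel
  · simp only [below]
    ring

/-- Raise the first unit on the left. -/
theorem IsExchange.raise_left {J K : ℕ} {n : ℤ × ℤ → ℤ} {i i' j j' : ℤ} {b : ℤ × ℤ → ℤ}
    {u₁ u₂ v₁ v₂ : ℤ × ℤ} (h : IsExchange J K n i i' j j' b u₁ u₂ v₁ v₂)
    (hpos : 0 < b (above u₁)) (hlt : (b + unit v₁ + unit v₂) u₁ < n u₁) :
    CanShift J K n i i' j j' b u₁ u₂ v₁ v₂ (-1) := by
  have hbox := h.base.inBox hpos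
  -- The left table does not change: `u₁` and the base unit just above it swap roles. In the right
  -- table that base unit goes down by one.
  refine ⟨b - unit (above u₁) + unit u₁, above u₁, u₂, v₁, v₂, ⟨?_, ?_, ?_, hbox, h.box_u₂,
    h.box_v₁, h.box_v₂, h.u₁_fst, h.u₂_fst, h.v₁_fst, h.v₂_fst⟩, fun a => ?_, ?_, ?_⟩
  · refine h.base.hop hpos h.box_u₁ ?_
    have h3 := unit_nonneg v₁ u₁
    have h4 := unit_nonneg v₂ u₁
    simp only [Pi.add_apply] at hlt
    omega
  · convert h.left using 1
    abel
  · have := h.right.hop (p := above u₁) (q := u₁) (by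
      have h3 := unit_nonneg v₁ (above u₁)
      have h4 := unit_nonneg v₂ (above u₁)
      simp only [Pi.add_apply]
      omega) h.box_u₁ hlt
    convert this using 1
    abel
  · rw [colSum_add, colSum_sub, colSum_unit hbox, colSum_unit h.box_u₁]
    exact sub_add_cancel _ _
  · rw [levelTotal_add, levelTotal_sub, levelTotal_unit hbox, levelTotal_unit h.box_u₁]
    ring
  · simp only [above]
    ring

/-- Raise the first unit on the left, while a unit of another column goes down. -/
theorem IsExchange.raise_left_of_hop {J K : ℕ} {n : ℤ × ℤ → ℤ} {i i' j j' : ℤ} {b : ℤ × ℤ → ℤ}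
    {u₁ u₂ v₁ v₂ : ℤ × ℤ} (h : IsExchange J K n i i' j j' b u₁ u₂ v₁ v₂) (hn : ∀ p, 1 ≤ n p)
    {a : ℤ × ℤ} (ha : 0 < b a) (ha2 : 2 ≤ a.2)
    (hleft : (b + unit u₁ + unit u₂) (below a) < n (below a))
    (hright : (b + unit v₁ + unit v₂) (below a) < n (below a))
    (hK : u₁.2 < K) (hcol : a.1 ≠ u₁.1) (hu : u₂ ≠ above u₁) (hv₁ : v₁.1 ≠ u₁.1)
    (hv₂ : v₂.1 ≠ u₁.1) :
    CanShift J K n i i' j j' b u₁ u₂ v₁ v₂ (-1) := by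
  by_cases hpos : 0 < b (above u₁)
  · refine h.raise_left hpos ?_
    have h3 := (h.left u₁).2.1
    have h4 := unit_nonneg u₂ u₁
    simp only [Pi.add_apply, unit_self] at h3 ⊢
    rw [unit_of_ne (ne_of_fst_ne hv₁.symm), unit_of_ne (ne_of_fst_ne hv₂.symm)]
    omega
  have hbox := h.box_u₁.above hK
  have habox := h.base.inBox ha
  have hbbox := habox.below ha2
  have n1 : a ≠ u₁ := ne_of_fst_ne hcol
  have n2 : a ≠ above u₁ := ne_of_fst_ne hcol
  have n3 : below a ≠ u₁ := ne_of_fst_ne hcol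
  have n4 : below a ≠ above u₁ := ne_of_fst_ne hcol
  have e1 : b - unit a + unit (below a) + unit (above u₁) + unit u₂ =
      b + unit u₁ + unit u₂ - unit a + unit (below a) - unit u₁ + unit (above u₁) := by abel
  refine ⟨b - unit a + unit (below a), above u₁, u₂, v₁, v₂, ⟨?_, ?_, ?_, hbox, h.box_u₂,
    h.box_v₁, h.box_v₂, h.u₁_fst, h.u₂_fst, h.v₁_fst, h.v₂_fst⟩, fun a => ?_, ?_, ?_⟩
  · refine h.base.hop ha hbbox ?_
    have h3 := unit_nonneg v₁ (below a)
    have h4 := unit_nonneg v₂ (below a)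
    simp only [Pi.add_apply] at hright
    omega
  · rw [e1]
    have t1 := h.left.hop (p := a) (q := below a) (by
      have h3 := unit_nonneg u₁ a
      have h4 := unit_nonneg u₂ a
      simp only [Pi.add_apply]
      omega) hbbox hleft
    refine t1.hop ?_ hbox ?_
    · have h3 := (h.base u₁).1
      have h4 := unit_nonneg u₂ u₁
      simp only [Pi.add_apply, Pi.sub_apply, unit_self, unit_of_ne n1.symm, unit_of_ne n3.symm]
      omega
    · have h3 := (h.base (above u₁)).1
      have h4 := hn (above u₁)
      simp only [Pi.add_apply, Pi.sub_apply, unit_of_ne n2.symm, unit_of_ne n4.symm,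
        unit_of_ne hu.symm, unit_of_ne (above_ne u₁)]
      omega
  · have := h.right.hop (p := a) (q := below a) (by
      have h3 := unit_nonneg v₁ a
      have h4 := unit_nonneg v₂ a
      simp only [Pi.add_apply]
      omega) hbbox hright
    convert this using 1
    abel
  · rw [colSum_add, colSum_sub, colSum_unit habox, colSum_unit hbbox]
    exact sub_add_cancel _ _
  · rw [levelTotal_add, levelTotal_sub, levelTotal_unit habox, levelTotal_unit hbbox]
    simp only [below, above]
    ring
  · simp only [above]
    ring

/-- Lower the first unit on the right, while a unit of another column goes down. -/
theorem IsExchange.lower_right_of_hop {J K : ℕ} {n : ℤ × ℤ → ℤ} {i i' j j' : ℤ} {b : ℤ × ℤ → ℤ}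
    {u₁ u₂ v₁ v₂ : ℤ × ℤ} (h : IsExchange J K n i i' j j' b u₁ u₂ v₁ v₂) (hn : ∀ p, 1 ≤ n p)
    {a : ℤ × ℤ} (ha : 0 < b a) (ha2 : 2 ≤ a.2)
    (hleft : (b + unit u₁ + unit u₂) (below a) < n (below a))
    (hright : (b + unit v₁ + unit v₂) (below a) < n (below a))
    (h2 : 2 ≤ v₁.2) (hcol : a.1 ≠ v₁.1) (hv : v₂ ≠ below v₁) (hu₁ : u₁.1 ≠ v₁.1)
    (hu₂ : u₂.1 ≠ v₁.1) :
    CanShift J K n i i' j j' b u₁ u₂ v₁ v₂ (-1) := by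
  -- If there is room below `v₁`, the hop of `a` is not needed. Otherwise a base unit sits there and
  -- swaps roles with `v₁`: on the right only `a` goes down, on the left that base unit rises as a
  -- compensation.
  by_cases hlt : (b + unit v₁ + unit v₂) (below v₁) < n (below v₁)
  · exact h.lower_right h2 hlt
  have hbox := h.box_v₁.below h2
  have habox := h.base.inBox ha
  have hbbox := habox.below ha2
  have n1 : a ≠ v₁ := ne_of_fst_ne hcol
  have n2 : a ≠ below v₁ := ne_of_fst_ne hcol
  have n3 : below a ≠ v₁ := ne_of_fst_ne hcol
  have n4 : below a ≠ below v₁ := ne_of_fst_ne hcol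
  have hfull : 0 < b (below v₁) := by
    have := hn (below v₁)
    simp only [Pi.add_apply, unit_of_ne (below_ne v₁), unit_of_ne hv.symm] at hlt
    omega
  have hv1 : b v₁ < n v₁ := by
    have h3 := (h.right v₁).2.1
    have h4 := unit_nonneg v₂ v₁
    simp only [Pi.add_apply, unit_self] at h3
    omega
  have e1 : b - unit a + unit (below a) - unit (below v₁) + unit v₁ + unit u₁ + unit u₂ =
      b + unit u₁ + unit u₂ - unit a + unit (below a) - unit (below v₁) + unit v₁ := by abel
  refine ⟨b - unit a + unit (below a) - unit (below v₁) + unit v₁, u₁, u₂, below v₁, v₂,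
    ⟨?_, ?_, ?_, h.box_u₁, h.box_u₂, hbox, h.box_v₂, h.u₁_fst, h.u₂_fst, h.v₁_fst, h.v₂_fst⟩,
    fun a => ?_, ?_, ?_⟩
  · have t1 := h.base.hop ha hbbox (by
      have h3 := unit_nonneg v₁ (below a)
      have h4 := unit_nonneg v₂ (below a)
      simp only [Pi.add_apply] at hright
      omega)
    refine t1.hop ?_ h.box_v₁ ?_ <;>
      simp only [Pi.add_apply, Pi.sub_apply, unit_of_ne n1.symm, unit_of_ne n2.symm,
        unit_of_ne n3.symm, unit_of_ne n4.symm] <;> omega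
  · rw [e1]
    have t1 := h.left.hop (p := a) (q := below a) (by
      have h3 := unit_nonneg u₁ a
      have h4 := unit_nonneg u₂ a
      simp only [Pi.add_apply]
      omega) hbbox hleft
    have m1 : u₁ ≠ below v₁ := ne_of_fst_ne hu₁
    have m2 : u₂ ≠ below v₁ := ne_of_fst_ne hu₂
    refine t1.hop ?_ h.box_v₁ ?_ <;>
      simp only [Pi.add_apply, Pi.sub_apply, unit_of_ne n1.symm, unit_of_ne n2.symm,
        unit_of_ne n3.symm, unit_of_ne n4.symm, unit_of_ne m1.symm, unit_of_ne m2.symm,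
        unit_of_ne (ne_of_fst_ne hu₁.symm), unit_of_ne (ne_of_fst_ne hu₂.symm)] <;> omega
  · have := h.right.hop (p := a) (q := below a) (by
      have h3 := unit_nonneg v₁ a
      have h4 := unit_nonneg v₂ a
      simp only [Pi.add_apply]
      omega) hbbox hright
    convert this using 1
    abel
  · rw [colSum_add, colSum_sub, colSum_add, colSum_sub, colSum_unit habox, colSum_unit hbbox,
      colSum_unit hbox, colSum_unit h.box_v₁]
    simp only [below]
    split_ifs <;> omega
  · rw [levelTotal_add, levelTotal_sub, levelTotal_add, levelTotal_sub, levelTotal_unit habox,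
      levelTotal_unit hbbox, levelTotal_unit hbox, levelTotal_unit h.box_v₁]
    simp only [below]
    ring
  · simp only [below]
    ring

/-- `A` is the column of the hop, `x₁, x₂` and `y₁, y₂` are the levels of the exchanged units; `k1`
to `k4` say that each correction is blocked only by the border, by the column `A` or by the partner
unit. If `A` avoids `i` and `i'`, then `hw` forces `i = i'`, `{x₁, x₂} = {K - 1, K}` and `y₁ = y₂ =
K`, so a unit `y` outside `A` can be lowered. Otherwise `A` avoids `j` and `j'`, and the argument is
dual. -/
theorem exchange_levels_absurd {K : ℕ} {i i' j j' A x₁ x₂ y₁ y₂ : ℤ}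
    (h2 : i ≠ j') (h3 : i' ≠ j) (h4 : i' ≠ j') (h5 : ¬ (i = i' ∧ j = j'))
    (g1 : 1 ≤ x₁ ∧ x₁ ≤ K) (g2 : 1 ≤ x₂ ∧ x₂ ≤ K) (g3 : 1 ≤ y₁ ∧ y₁ ≤ K) (g4 : 1 ≤ y₂ ∧ y₂ ≤ K)
    (hw : 0 < y₁ + y₂ - x₁ - x₂)
    (k1 : x₁ < K → A ≠ i → i' = i ∧ x₂ = x₁ + 1) (k2 : x₂ < K → A ≠ i' → i = i' ∧ x₁ = x₂ + 1)
    (k3 : 2 ≤ y₁ → A ≠ j → j' = j ∧ y₂ = y₁ - 1) (k4 : 2 ≤ y₂ → A ≠ j' → j = j' ∧ y₁ = y₂ - 1) :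
    False := by
  by_cases q1 : A ≠ i ∧ A ≠ i'
  · by_cases q2 : x₁ < K
    · have := k1 q2 q1.1
      by_cases q3 : x₂ < K
      · have := k2 q3 q1.2
        omega
      · by_cases q4 : A = j
        · have := k4 (by omega) (by omega)
          omega
        · have := k3 (by omega) q4
          omega
    · by_cases q3 : x₂ < K
      · have := k2 q3 q1.2
        by_cases q4 : A = j
        · have := k4 (by omega) (by omega)
          omega
        · have := k3 (by omega) q4
          omega
      · omega
  · have q5 : A ≠ j ∧ A ≠ j' := by
      constructor <;> intro hc <;> rw [hc] at q1 <;> omega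
    by_cases q2 : 2 ≤ y₁
    · have := k3 q2 q5.1
      by_cases q3 : 2 ≤ y₂
      · have := k4 q3 q5.2
        omega
      · by_cases q4 : A = i
        · have := k2 (by omega) (by omega)
          omega
        · have := k1 (by omega) q4
          omega
    · by_cases q3 : 2 ≤ y₂
      · have := k4 q3 q5.2
        by_cases q4 : A = i
        · have := k2 (by omega) (by omega)
          omega
        · have := k1 (by omega) q4
          omega
      · omega

/-- If the hopping unit is `v₁` or `v₂`, it is simply lowered. If the hop is impossible on the left,
its target is `u₁` or `u₂`, which can be raised. Otherwise the hop lowers both tables, and one of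
four corrections restores the level sum on the left only. -/
theorem IsExchange.canShift_of_hop {J K : ℕ} {n : ℤ × ℤ → ℤ} {i i' j j' : ℤ} {b : ℤ × ℤ → ℤ}
    {u₁ u₂ v₁ v₂ : ℤ × ℤ} (h : IsExchange J K n i i' j j' b u₁ u₂ v₁ v₂) (hn : ∀ p, 1 ≤ n p)
    (h1 : i ≠ j) (h2 : i ≠ j') (h3 : i' ≠ j) (h4 : i' ≠ j') (h5 : ¬ (i = i' ∧ j = j'))
    (hw : 0 < v₁.2 + v₂.2 - u₁.2 - u₂.2) {a : ℤ × ℤ} (ha2 : 2 ≤ a.2)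
    (ha : 0 < (b + unit v₁ + unit v₂) a)
    (hright : (b + unit v₁ + unit v₂) (below a) < n (below a)) :
    CanShift J K n i i' j j' b u₁ u₂ v₁ v₂ (-1) := by
  by_cases hba : b a = 0
  · simp only [Pi.add_apply, hba, zero_add] at ha
    by_cases hav : a = v₁
    · subst hav
      exact h.lower_right ha2 hright
    · have hav' : a = v₂ := by
        by_contra hc
        rw [unit_of_ne hav, unit_of_ne hc] at ha
        omega
      subst hav'
      exact (h.swap_right.lower_right ha2 (by rwa [add_right_comm])).swap_right
  have hba' : 0 < b a := lt_of_le_of_ne (h.base a).1 (Ne.symm hba)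
  by_cases hleft : (b + unit u₁ + unit u₂) (below a) < n (below a)
  swap
  · have hb : b (below a) < n (below a) := by
      have h6 := unit_nonneg v₁ (below a)
      have h7 := unit_nonneg v₂ (below a)
      simp only [Pi.add_apply] at hright
      omega
    by_cases hau : below a = u₁
    · have e : a = above u₁ := by rw [← hau, above_below]
      exact h.raise_left (e ▸ hba') (hau ▸ hright)
    · have hau' : below a = u₂ := by
        by_contra hc
        simp only [Pi.add_apply] at hleft
        rw [unit_of_ne hau, unit_of_ne hc] at hleft
        omega
      have e : a = above u₂ := by rw [← hau', above_below]
      exact (h.swap_left.raise_left (e ▸ hba') (hau' ▸ hright)).swap_left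
  have hleft' : (b + unit u₂ + unit u₁) (below a) < n (below a) := by rwa [add_right_comm]
  have hright' : (b + unit v₂ + unit v₁) (below a) < n (below a) := by rwa [add_right_comm]
  have f1 := h.u₁_fst
  have f2 := h.u₂_fst
  have f3 := h.v₁_fst
  have f4 := h.v₂_fst
  have g1 := h.box_u₁.2.2
  have g2 := h.box_u₂.2.2
  have g3 := h.box_v₁.2.2
  have g4 := h.box_v₂.2.2
  have optU₁ : u₁.2 < K → a.1 ≠ i → u₂ ≠ above u₁ →
      CanShift J K n i i' j j' b u₁ u₂ v₁ v₂ (-1) := fun o1 o2 o3 =>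
    h.raise_left_of_hop hn hba' ha2 hleft hright o1 (by omega) o3 (by omega) (by omega)
  have optU₂ : u₂.2 < K → a.1 ≠ i' → u₁ ≠ above u₂ →
      CanShift J K n i i' j j' b u₁ u₂ v₁ v₂ (-1) := fun o1 o2 o3 =>
    (h.swap_left.raise_left_of_hop hn hba' ha2 hleft' hright o1 (by omega) o3 (by omega)
      (by omega)).swap_left
  have optV₁ : 2 ≤ v₁.2 → a.1 ≠ j → v₂ ≠ below v₁ →
      CanShift J K n i i' j j' b u₁ u₂ v₁ v₂ (-1) := fun o1 o2 o3 =>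
    h.lower_right_of_hop hn hba' ha2 hleft hright o1 (by omega) o3 (by omega) (by omega)
  have optV₂ : 2 ≤ v₂.2 → a.1 ≠ j' → v₁ ≠ below v₂ →
      CanShift J K n i i' j j' b u₁ u₂ v₁ v₂ (-1) := fun o1 o2 o3 =>
    (h.swap_right.lower_right_of_hop hn hba' ha2 hleft hright' o1 (by omega) o3 (by omega)
      (by omega)).swap_right
  have above_eq : ∀ p q : ℤ × ℤ, p = above q → p.1 = q.1 ∧ p.2 = q.2 + 1 := by
    rintro p q rfl
    exact ⟨rfl, rfl⟩
  have below_eq : ∀ p q : ℤ × ℤ, p = below q → p.1 = q.1 ∧ p.2 = q.2 - 1 := by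
    rintro p q rfl
    exact ⟨rfl, rfl⟩
  by_contra hcon
  have k1 : u₁.2 < K → a.1 ≠ i → u₂.1 = u₁.1 ∧ u₂.2 = u₁.2 + 1 := fun o1 o2 =>
    above_eq _ _ (by_contra fun o3 => hcon (optU₁ o1 o2 o3))
  have k2 : u₂.2 < K → a.1 ≠ i' → u₁.1 = u₂.1 ∧ u₁.2 = u₂.2 + 1 := fun o1 o2 =>
    above_eq _ _ (by_contra fun o3 => hcon (optU₂ o1 o2 o3))
  have k3 : 2 ≤ v₁.2 → a.1 ≠ j → v₂.1 = v₁.1 ∧ v₂.2 = v₁.2 - 1 := fun o1 o2 =>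
    below_eq _ _ (by_contra fun o3 => hcon (optV₁ o1 o2 o3))
  have k4 : 2 ≤ v₂.2 → a.1 ≠ j' → v₁.1 = v₂.1 ∧ v₁.2 = v₂.2 - 1 := fun o1 o2 =>
    below_eq _ _ (by_contra fun o3 => hcon (optV₂ o1 o2 o3))
  rw [f1, f2] at k1 k2
  rw [f3, f4] at k3 k4
  exact exchange_levels_absurd h2 h3 h4 h5 g1 g2 g3 g4 hw k1 k2 k3 k4

/-- If the right table does not have the least possible sum of levels, then the difference of the
sums of levels can be lowered. -/
theorem IsExchange.canShift_down {J K : ℕ} {n : ℤ × ℤ → ℤ} {i i' j j' : ℤ} {b : ℤ × ℤ → ℤ}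
    {u₁ u₂ v₁ v₂ : ℤ × ℤ} (h : IsExchange J K n i i' j j' b u₁ u₂ v₁ v₂) (hn : ∀ p, 1 ≤ n p)
    (h1 : i ≠ j) (h2 : i ≠ j') (h3 : i' ≠ j) (h4 : i' ≠ j') (h5 : ¬ (i = i' ∧ j = j'))
    (hw : 0 < v₁.2 + v₂.2 - u₁.2 - u₂.2)
    (hT : ∑ a ∈ Finset.Icc (1 : ℤ) J,
      levelCost (cum (column n a)) K (colSum K (b + unit v₁ + unit v₂) a) <
        levelTotal J K (b + unit v₁ + unit v₂)) :
    CanShift J K n i i' j j' b u₁ u₂ v₁ v₂ (-1) := by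
  obtain ⟨a, ha, hlt⟩ := Finset.exists_lt_of_sum_lt hT
  obtain ⟨k, k1, k2, k3, k4⟩ := exists_down_hop (n := column n a)
    (fun k => (h.right (a, k)).1) (fun k => (h.right (a, k)).2.1) (fun k => hn _) hlt
  have e : below (a, k + 1) = (a, k) := by simp [below]
  exact h.canShift_of_hop hn h1 h2 h3 h4 h5 hw (a := (a, k + 1)) (by dsimp only; omega) k3
    (by rw [e]; exact k4)

/-! ### Reflection of the levels -/

/-- The cell obtained from `p` by reflecting the levels `1, …, K`. -/
def flipCell (K : ℕ) (p : ℤ × ℤ) : ℤ × ℤ := (p.1, K + 1 - p.2)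

/-- The table obtained from `x` by reflecting the levels `1, …, K`. -/
def flipTable (K : ℕ) (x : ℤ × ℤ → ℤ) (p : ℤ × ℤ) : ℤ := x (flipCell K p)

theorem flipCell_flipCell (K : ℕ) (p : ℤ × ℤ) : flipCell K (flipCell K p) = p := by
  simp [flipCell]

theorem flipTable_flipTable (K : ℕ) (x : ℤ × ℤ → ℤ) : flipTable K (flipTable K x) = x := by
  funext p
  simp only [flipTable, flipCell_flipCell]

theorem flipTable_add (K : ℕ) (x y : ℤ × ℤ → ℤ) :
    flipTable K (x + y) = flipTable K x + flipTable K y := rfl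

theorem flipTable_unit (K : ℕ) (p : ℤ × ℤ) : flipTable K (unit p) = unit (flipCell K p) := by
  funext q
  have : flipCell K q = p ↔ q = flipCell K p := by
    constructor
    · rintro rfl
      exact (flipCell_flipCell K q).symm
    · rintro rfl
      exact flipCell_flipCell K p
  simp only [flipTable, unit, this]

theorem InBox.flip {J K : ℕ} {p : ℤ × ℤ} (h : InBox J K p) : InBox J K (flipCell K p) := by
  obtain ⟨h1, h2, h3, h4⟩ := h
  exact ⟨h1, h2, by simp only [flipCell]; omega, by simp only [flipCell]; omega⟩

theorem IsTable.flip {J K : ℕ} {n x : ℤ × ℤ → ℤ} (h : IsTable J K n x) :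
    IsTable J K (flipTable K n) (flipTable K x) := fun p =>
  ⟨(h _).1, (h _).2.1, fun hp => by
    have := ((h _).2.2 hp).flip
    rwa [flipCell_flipCell] at this⟩

theorem cum_column_flip (n : ℤ × ℤ → ℤ) (j : ℤ) {k K : ℕ} (hk : k ≤ K) :
    cum (column (flipTable K n) j) k = flipCum (cum (column n j)) K k := by
  rw [flipCum_of_le _ hk]
  induction k with
  | zero => simp [cum_zero]
  | succ k ih =>
    rw [cum_succ, ih (by omega)]
    have h1 : K - k = K - (k + 1) + 1 := by omega
    rw [h1, cum_succ]
    have h2 : column (flipTable K n) j ((k : ℤ) + 1) = column n j (((K - (k + 1) : ℕ) : ℤ) + 1) := by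
      simp only [column, flipTable, flipCell]
      congr 2
      omega
    rw [h2]
    ring

theorem colSum_flip (K : ℕ) (x : ℤ × ℤ → ℤ) (j : ℤ) : colSum K (flipTable K x) j = colSum K x j := by
  rw [colSum, cum_column_flip x j le_rfl, flipCum_of_le _ le_rfl, Nat.sub_self, cum_zero, sub_zero,
    colSum]

theorem levelSum_column_flip (K : ℕ) (x : ℤ × ℤ → ℤ) (j : ℤ) :
    levelSum K (column (flipTable K x) j) = (K + 1) * colSum K x j - levelSum K (column x j) := by
  rw [levelSum, ← Finset.sum_range_reflect, colSum, cum, levelSum, Finset.mul_sum,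
    ← Finset.sum_sub_distrib]
  refine Finset.sum_congr rfl fun i hi => ?_
  rw [Finset.mem_range] at hi
  have h1 : (((K - 1 - i : ℕ) : ℤ)) = K - 1 - i := by omega
  have h2 : column (flipTable K x) j ((K : ℤ) - 1 - i + 1) = column x j (i + 1) := by
    simp only [column, flipTable, flipCell]
    congr 2
    omega
  rw [h1, h2]
  ring

theorem levelTotal_flip (J K : ℕ) (x : ℤ × ℤ → ℤ) :
    levelTotal J K (flipTable K x) =
      (K + 1) * ∑ j ∈ Finset.Icc (1 : ℤ) J, colSum K x j - levelTotal J K x := by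
  simp only [levelTotal, levelSum_column_flip, Finset.sum_sub_distrib, Finset.mul_sum]

theorem levelCost_flip (K : ℕ) (n : ℤ × ℤ → ℤ) (j x : ℤ) :
    levelCost (cum (column (flipTable K n) j)) K x =
      levelCost (flipCum (cum (column n j)) K) K x :=
  Finset.sum_congr rfl fun k hk => by
    rw [cum_column_flip n j (by have := Finset.mem_range.1 hk; omega)]

theorem IsExchange.flip {J K : ℕ} {n : ℤ × ℤ → ℤ} {i i' j j' : ℤ} {b : ℤ × ℤ → ℤ}
    {u₁ u₂ v₁ v₂ : ℤ × ℤ} (h : IsExchange J K n i i' j j' b u₁ u₂ v₁ v₂) :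
    IsExchange J K (flipTable K n) i i' j j' (flipTable K b) (flipCell K u₁) (flipCell K u₂)
      (flipCell K v₁) (flipCell K v₂) :=
  ⟨h.base.flip, by simpa only [flipTable_add, flipTable_unit] using h.left.flip,
    by simpa only [flipTable_add, flipTable_unit] using h.right.flip, h.box_u₁.flip, h.box_u₂.flip,
    h.box_v₁.flip, h.box_v₂.flip, h.u₁_fst, h.u₂_fst, h.v₁_fst, h.v₂_fst⟩

theorem CanShift.of_flip {J K : ℕ} {n : ℤ × ℤ → ℤ} {i i' j j' : ℤ} {b : ℤ × ℤ → ℤ}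
    {u₁ u₂ v₁ v₂ : ℤ × ℤ} {δ : ℤ}
    (h : CanShift J K (flipTable K n) i i' j j' (flipTable K b) (flipCell K u₁) (flipCell K u₂)
      (flipCell K v₁) (flipCell K v₂) δ) : CanShift J K n i i' j j' b u₁ u₂ v₁ v₂ (-δ) := by
  obtain ⟨b', u₁', u₂', v₁', v₂', h1, h2, h3, h4⟩ := h
  have h1' := h1.flip
  rw [flipTable_flipTable] at h1'
  refine ⟨_, _, _, _, _, h1', fun a => by rw [colSum_flip, h2, colSum_flip], ?_, ?_⟩
  · rw [levelTotal_flip] at h3 ⊢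
    have h5 : ∀ a, colSum K b' a = colSum K b a := fun a => by rw [h2, colSum_flip]
    simp only [h5]
    simp only [flipCell] at h3 ⊢
    linarith
  · simp only [flipCell] at h4 ⊢
    linarith

/-! ### Realization of an exchange by a step -/

/-- As long as the difference is positive, the right table lies above the level sum of the left one,
hence above its own minimum, and can be lowered. Column sums on the right and the level sum on the
left stay fixed, so `hT` persists. -/
theorem IsExchange.canShift_neg {J K : ℕ} {n : ℤ × ℤ → ℤ} (hn : ∀ p, 1 ≤ n p) {i i' j j' : ℤ}
    (h1 : i ≠ j) (h2 : i ≠ j') (h3 : i' ≠ j) (h4 : i' ≠ j') (h5 : ¬ (i = i' ∧ j = j')) (m : ℕ)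
    {b : ℤ × ℤ → ℤ} {u₁ u₂ v₁ v₂ : ℤ × ℤ} (h : IsExchange J K n i i' j j' b u₁ u₂ v₁ v₂)
    (hw : v₁.2 + v₂.2 - u₁.2 - u₂.2 = m)
    (hT : ∑ a ∈ Finset.Icc (1 : ℤ) J,
      levelCost (cum (column n a)) K (colSum K (b + unit v₁ + unit v₂) a) ≤
        levelTotal J K (b + unit u₁ + unit u₂)) :
    CanShift J K n i i' j j' b u₁ u₂ v₁ v₂ (-m) := by
  induction m generalizing b u₁ u₂ v₁ v₂ with
  | zero => exact ⟨b, u₁, u₂, v₁, v₂, h, fun _ => rfl, rfl, by simp⟩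
  | succ m ih =>
    push_cast at hw
    have hlt : levelTotal J K (b + unit u₁ + unit u₂) < levelTotal J K (b + unit v₁ + unit v₂) := by
      rw [levelTotal_add, levelTotal_add, levelTotal_add, levelTotal_add, levelTotal_unit h.box_u₁,
        levelTotal_unit h.box_u₂, levelTotal_unit h.box_v₁, levelTotal_unit h.box_v₂]
      omega
    obtain ⟨b', u₁', u₂', v₁', v₂', h6, h7, h8, h9⟩ :=
      h.canShift_down hn h1 h2 h3 h4 h5 (by omega) (hT.trans_lt hlt)
    have hc : ∀ a, colSum K (b' + unit v₁' + unit v₂') a = colSum K (b + unit v₁ + unit v₂) a := by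
      intro a
      rw [colSum_add, colSum_add, colSum_add, colSum_add, colSum_unit h.box_v₁,
        colSum_unit h.box_v₂, colSum_unit h6.box_v₁, colSum_unit h6.box_v₂, h7, h.v₁_fst, h.v₂_fst,
        h6.v₁_fst, h6.v₂_fst]
    have hl : levelTotal J K (b' + unit u₁' + unit u₂') =
        levelTotal J K (b + unit u₁ + unit u₂) := by
      rw [levelTotal_add, levelTotal_add, levelTotal_add, levelTotal_add, levelTotal_unit h.box_u₁,
        levelTotal_unit h.box_u₂, levelTotal_unit h6.box_u₁, levelTotal_unit h6.box_u₂]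
      omega
    obtain ⟨b'', u₁'', u₂'', v₁'', v₂'', h10, h11, h12, h13⟩ :=
      ih h6 (by omega) (by simpa only [hc, hl] using hT)
    exact ⟨b'', u₁'', u₂'', v₁'', v₂'', h10, fun a => (h11 a).trans (h7 a), h12.trans h8,
      by push_cast; omega⟩

/-- An exchange between columns can be rearranged such that it preserves the sum of the levels. -/
theorem IsExchange.canShift {J K : ℕ} {n : ℤ × ℤ → ℤ} (hn : ∀ p, 1 ≤ n p) {i i' j j' : ℤ}
    (h1 : i ≠ j) (h2 : i ≠ j') (h3 : i' ≠ j) (h4 : i' ≠ j') (h5 : ¬ (i = i' ∧ j = j'))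
    {b : ℤ × ℤ → ℤ} {u₁ u₂ v₁ v₂ : ℤ × ℤ} (h : IsExchange J K n i i' j j' b u₁ u₂ v₁ v₂)
    (hT : ∑ a ∈ Finset.Icc (1 : ℤ) J,
      levelCost (cum (column n a)) K (colSum K (b + unit v₁ + unit v₂) a) ≤
        levelTotal J K (b + unit u₁ + unit u₂))
    (hG : ∑ a ∈ Finset.Icc (1 : ℤ) J,
      levelCost (flipCum (cum (column n a)) K) K (colSum K (b + unit v₁ + unit v₂) a) ≤
        (K + 1) * ∑ a ∈ Finset.Icc (1 : ℤ) J, colSum K (b + unit u₁ + unit u₂) a -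
          levelTotal J K (b + unit u₁ + unit u₂)) :
    CanShift J K n i i' j j' b u₁ u₂ v₁ v₂ (-(v₁.2 + v₂.2 - u₁.2 - u₂.2)) := by
  rcases le_total 0 (v₁.2 + v₂.2 - u₁.2 - u₂.2) with hw | hw
  · obtain ⟨m, hm⟩ := Int.eq_ofNat_of_zero_le hw
    rw [hm]
    exact h.canShift_neg hn h1 h2 h3 h4 h5 m hm hT
  · obtain ⟨m, hm⟩ := Int.eq_ofNat_of_zero_le (neg_nonneg.2 hw)
    -- Reflecting the levels changes the sign of the difference and turns `hG` into the bound on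
    -- least costs.
    have hf := h.flip
    have hs := hf.canShift_neg (n := flipTable K n) (fun p => hn _) h1 h2 h3 h4 h5 m (by
      simp only [flipCell]
      omega) (by
      simp only [← flipTable_unit, ← flipTable_add, levelTotal_flip, levelCost_flip, colSum_flip]
      exact hG)
    have := hs.of_flip
    rwa [neg_neg, ← hm] at this

/-! ### Taking out and inserting the exchanged units -/

theorem IsTable.exists_pos {J K : ℕ} {n x : ℤ × ℤ → ℤ} (h : IsTable J K n x) {a : ℤ}
    (ha : 0 < colSum K x a) : ∃ p, InBox J K p ∧ p.1 = a ∧ 0 < x p := by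
  obtain ⟨k, -, hk⟩ := Finset.exists_lt_of_sum_lt (s := Finset.range K) (f := fun _ => (0 : ℤ))
    (g := fun i : ℕ => column x a (i + 1)) (by simpa [colSum, cum] using ha)
  exact ⟨_, h.inBox hk, rfl, hk⟩

theorem exists_lt_of_colSum_lt {J K : ℕ} {n x : ℤ × ℤ → ℤ} {a : ℤ} (h1 : 1 ≤ a) (h2 : a ≤ J)
    (ha : colSum K x a < colSum K n a) : ∃ p, InBox J K p ∧ p.1 = a ∧ x p < n p := by
  obtain ⟨k, hk, hlt⟩ := Finset.exists_lt_of_sum_lt (by simpa only [colSum, cum] using ha)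
  rw [Finset.mem_range] at hk
  exact ⟨(a, k + 1), ⟨h1, h2, by dsimp only; omega, by dsimp only; omega⟩, rfl, hlt⟩

theorem exists_isExchange {J K : ℕ} {n x : ℤ × ℤ → ℤ} (hx : IsTable J K n x) {i i' j j' : ℤ}
    (h1 : i ≠ j) (h2 : i ≠ j') (h3 : i' ≠ j) (h4 : i' ≠ j') (hj : 1 ≤ j ∧ j ≤ J)
    (hj' : 1 ≤ j' ∧ j' ≤ J) (hi : 1 ≤ colSum K x i) (hi' : 1 ≤ colSum K x i')
    (hii : i = i' → 2 ≤ colSum K x i) (hcj : colSum K x j < colSum K n j)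
    (hcj' : colSum K x j' < colSum K n j')
    (hjj : j = j' → colSum K x j + 2 ≤ colSum K n j) :
    ∃ b u₁ u₂ v₁ v₂, IsExchange J K n i i' j j' b u₁ u₂ v₁ v₂ ∧ x = b + unit u₁ + unit u₂ := by
  obtain ⟨u₁, hu₁, rfl, hp₁⟩ := hx.exists_pos (a := i) (by omega)
  have t1 := hx.sub_unit hp₁
  obtain ⟨u₂, hu₂, rfl, hp₂⟩ := t1.exists_pos (a := i') (by
    rw [colSum_sub, colSum_unit hu₁]
    split_ifs with h
    · have := hii h.symm
      rw [h]
      omega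
    · omega)
  have t2 := t1.sub_unit hp₂
  obtain ⟨v₁, hv₁, rfl, hq₁⟩ := exists_lt_of_colSum_lt (J := J) (K := K) (n := n)
    (x := x - unit u₁ - unit u₂) hj.1 hj.2 (by
      rw [colSum_sub, colSum_sub, colSum_unit hu₁, colSum_unit hu₂]
      split_ifs <;> omega)
  have t3 := t2.add_unit hv₁ hq₁
  obtain ⟨v₂, hv₂, rfl, hq₂⟩ := exists_lt_of_colSum_lt (J := J) (K := K) (n := n)
    (x := x - unit u₁ - unit u₂ + unit v₁) hj'.1 hj'.2 (by
      rw [colSum_add, colSum_sub, colSum_sub, colSum_unit hu₁, colSum_unit hu₂, colSum_unit hv₁]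
      by_cases h : v₁.1 = j'
      · have := hjj h
        rw [h] at this
        split_ifs <;> omega
      · split_ifs <;> omega)
  have e : x = x - unit u₁ - unit u₂ + unit u₁ + unit u₂ := by abel
  exact ⟨x - unit u₁ - unit u₂, u₁, u₂, v₁, v₂, ⟨t2, e ▸ hx, t3.add_unit hv₂ hq₂, hu₁, hu₂, hv₁,
    hv₂, rfl, rfl, rfl, rfl⟩, e⟩

/-- An exchange of units between columns that is compatible with the sum of the levels is
realized by steps. -/
theorem exists_reach_exchange {J K : ℕ} {n x : ℤ × ℤ → ℤ} (hn : ∀ p, 1 ≤ n p)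
    (hx : IsTable J K n x) {i k t : ℤ} (ht : 1 ≤ t) (hik : i ≠ k) (hi : 1 ≤ i + t ∧ i + t ≤ J)
    (hk : 1 ≤ k ∧ k ≤ J) (hci : 1 ≤ colSum K x i) (hck : 1 ≤ colSum K x (k + t))
    (hii : i = k + t → 2 ≤ colSum K x i) (hcj : colSum K x (i + t) < colSum K n (i + t))
    (hcj' : colSum K x k < colSum K n k) (hjj : k = i + t → colSum K x k + 2 ≤ colSum K n k)
    (hT : ∑ j ∈ Finset.Icc (1 : ℤ) J, levelCost (cum (column n j)) K
        (flowState (colSum K x) (fun e => edgeFlow i t e - edgeFlow k t e) j) ≤ levelTotal J K x)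
    (hG : ∑ j ∈ Finset.Icc (1 : ℤ) J, levelCost (flipCum (cum (column n j)) K) K
        (flowState (colSum K x) (fun e => edgeFlow i t e - edgeFlow k t e) j) ≤
      (K + 1) * ∑ j ∈ Finset.Icc (1 : ℤ) J, colSum K x j - levelTotal J K x) :
    ∃ y, IsTable J K n y ∧ Relation.ReflTransGen (Step J K n) x y ∧
      levelTotal J K y = levelTotal J K x ∧
      ∀ j, colSum K y j =
        flowState (colSum K x) (fun e => edgeFlow i t e - edgeFlow k t e) j := by
  have h1 : i ≠ i + t := by omega
  have h3 : k + t ≠ i + t := by omega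
  have h4 : k + t ≠ k := by omega
  obtain ⟨b, u₁, u₂, v₁, v₂, h, rfl⟩ := exists_isExchange hx h1 hik h3 h4 hi hk hci hck hii hcj hcj'
    (fun h => by rw [h]; exact hjj h.symm)
  have hcol : ∀ {b' u₁' u₂' v₁' v₂'}, IsExchange J K n i (k + t) (i + t) k b' u₁' u₂' v₁' v₂' →
      (∀ a, colSum K b' a = colSum K b a) → ∀ j, colSum K (b' + unit v₁' + unit v₂') j =
      flowState (colSum K (b + unit u₁ + unit u₂))
        (fun e => edgeFlow i t e - edgeFlow k t e) j := by
    intro b' u₁' u₂' v₁' v₂' h' hb j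
    rw [flowState_exchange _ ht, colSum_add, colSum_add, colSum_add, colSum_add,
      colSum_unit h.box_u₁, colSum_unit h.box_u₂, colSum_unit h'.box_v₁, colSum_unit h'.box_v₂,
      h.u₁_fst, h.u₂_fst, h'.v₁_fst, h'.v₂_fst, hb]
    ring
  simp only [← hcol h fun _ => rfl] at hT hG
  obtain ⟨b', u₁', u₂', v₁', v₂', h', hb, hl, hw⟩ :=
    h.canShift hn h1 hik h3 h4 (fun h => by omega) hT hG
  have hl1 : levelTotal J K (b' + unit u₁' + unit u₂') =
      levelTotal J K (b + unit u₁ + unit u₂) := by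
    rw [levelTotal_add, levelTotal_add, levelTotal_add, levelTotal_add, levelTotal_unit h.box_u₁,
      levelTotal_unit h.box_u₂, levelTotal_unit h'.box_u₁, levelTotal_unit h'.box_u₂]
    omega
  refine ⟨b' + unit v₁' + unit v₂', h'.right, ?_, ?_, hcol h' hb⟩
  -- First the given table is rearranged at fixed column sums into the corrected left table; then
  -- the exchange is a single step.
  · refine (reach_of_colSum_eq hn hx h'.left (fun j => ?_) hl1.symm).tail ⟨h'.left, h'.right, u₁',
      u₂', v₁', v₂', h'.box_u₁, h'.box_u₂, h'.box_v₁, h'.box_v₂, ?_, by abel⟩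
    · rw [colSum_add, colSum_add, colSum_add, colSum_add, colSum_unit h.box_u₁,
        colSum_unit h.box_u₂, colSum_unit h'.box_u₁, colSum_unit h'.box_u₂, h.u₁_fst, h.u₂_fst,
        h'.u₁_fst, h'.u₂_fst, hb]
    · have e1 := h'.u₁_fst
      have e2 := h'.u₂_fst
      have e3 := h'.v₁_fst
      have e4 := h'.v₂_fst
      rw [Prod.ext_iff]
      simp only [Prod.fst_add, Prod.snd_add]
      omega
  · rw [← hl1, levelTotal_add, levelTotal_add, levelTotal_add, levelTotal_add,
      levelTotal_unit h'.box_u₁, levelTotal_unit h'.box_u₂, levelTotal_unit h'.box_v₁,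
      levelTotal_unit h'.box_v₂]
    omega

/-! ### Tables with the same sums of positions are connected -/

theorem sum_Icc_eq_sum_range (f : ℤ → ℤ) (J : ℕ) :
    ∑ j ∈ Finset.Icc (1 : ℤ) J, f j = ∑ i ∈ Finset.range J, f (i + 1) := by
  symm
  refine Finset.sum_bij (fun (i : ℕ) _ => (i : ℤ) + 1) (fun i hi => ?_) (fun i _ i' _ h => ?_)
    (fun j hj => ?_) fun _ _ => rfl
  · rw [Finset.mem_range] at hi
    rw [Finset.mem_Icc]
    omega
  · simpa using h
  · rw [Finset.mem_Icc] at hj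
    exact ⟨(j - 1).toNat, by rw [Finset.mem_range]; omega, by omega⟩

theorem sum_levelCost_le {J K : ℕ} {n x : ℤ × ℤ → ℤ} (hx : IsTable J K n x) :
    ∑ j ∈ Finset.Icc (1 : ℤ) J, levelCost (cum (column n j)) K (colSum K x j) ≤
      levelTotal J K x :=
  Finset.sum_le_sum fun _ _ => levelCost_le_levelSum (fun _ => (hx _).1) (fun _ => (hx _).2.1) K

theorem sum_levelCost_flip_le {J K : ℕ} {n x : ℤ × ℤ → ℤ} (hx : IsTable J K n x) :
    ∑ j ∈ Finset.Icc (1 : ℤ) J, levelCost (flipCum (cum (column n j)) K) K (colSum K x j) ≤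
      (K + 1) * ∑ j ∈ Finset.Icc (1 : ℤ) J, colSum K x j - levelTotal J K x := by
  have := sum_levelCost_le hx.flip
  simpa only [levelCost_flip, colSum_flip, levelTotal_flip] using this

theorem IsTable.colSum_mem {J K : ℕ} {n x : ℤ × ℤ → ℤ} (hx : IsTable J K n x) (j : ℤ) :
    0 ≤ colSum K x j ∧ colSum K x j ≤ cum (column n j) K :=
  ⟨by rw [colSum, cum]; exact Finset.sum_nonneg fun _ _ => (hx _).1, cum_le_cum (fun _ => (hx _).2.1) K⟩

/-- Induction on `∑ |F|`: each realized exchange removes a piece of the flow, and once `F = 0` the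
column sums agree. -/
theorem reach_of_flow {J K : ℕ} (hK : 1 ≤ K) {n y : ℤ × ℤ → ℤ} (hn : ∀ p, 1 ≤ n p)
    (hy : IsTable J K n y) {x : ℤ × ℤ → ℤ} (hx : IsTable J K n x) (F : ℤ → ℤ)
    (hF : ∀ i, F i ≠ 0 → 1 ≤ i ∧ i < J) (hsum : ∑ i ∈ Finset.Icc (1 : ℤ) J, F i = 0)
    (hflow : ∀ j, flowState (colSum K x) F j = colSum K y j)
    (hc : ∑ j ∈ Finset.Icc (1 : ℤ) J, colSum K x j = ∑ j ∈ Finset.Icc (1 : ℤ) J, colSum K y j)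
    (hT : levelTotal J K x = levelTotal J K y) : Relation.ReflTransGen (Step J K n) x y := by
  induction hN : (∑ i ∈ Finset.Icc (1 : ℤ) J, |F i|).toNat using Nat.strong_induction_on
    generalizing F x with
  | _ N ih =>
  subst hN
  by_cases hne : ∃ i, F i ≠ 0
  swap
  · push Not at hne
    exact reach_of_colSum_eq hn hx hy (fun j => by rw [← hflow]; simp [flowState, hne]) hT
  have hN : ∀ j, StrictMono (cum (column n j)) := fun j => cum_strictMono fun _ => hn _
  have hcap : ∀ j, 1 ≤ cum (column n j) K := fun j => by
    have := hN j (show 0 < K by omega)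
    rw [cum_zero] at this
    omega
  have hFI : ∀ i, F i ≠ 0 → i ∈ Finset.Icc (1 : ℤ) J := fun i hi => by
    have := hF i hi
    rw [Finset.mem_Icc]
    omega
  have b0 := fun j => (hx.colSum_mem j).1
  have b1 := fun j => (hx.colSum_mem j).2
  have b0' : ∀ j, 0 ≤ flowState (colSum K x) F j := fun j => hflow j ▸ (hy.colSum_mem j).1
  have b1' : ∀ j, flowState (colSum K x) F j ≤ cum (column n j) K :=
    fun j => hflow j ▸ (hy.colSum_mem j).2
  have hreg := flowRegion_of_flow (cap := fun j => cum (column n j) K) hF hcap b0 b1 b0' b1'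
  obtain ⟨i, k, t, ht, hA, hB, a1, a2, a3, a4, a5, a6⟩ := exists_exchange (T := levelTotal J K x)
    hN (fun j => cum_zero _) hcap hF hsum hne b0 b1 b0' b1' (sum_levelCost_le hx)
    (by simp only [hflow, hT]; exact sum_levelCost_le hy) (sum_levelCost_flip_le hx)
    (by simp only [hflow, hT, hc]; exact sum_levelCost_flip_le hy)
  have h1 := hF (i + t - 1) (hA _ (by omega) (by omega)).ne'
  have h2 := hF i (hA i le_rfl (by omega)).ne'
  have h3 := hF k (hB k le_rfl (by omega)).ne
  obtain ⟨z, hz, hxz, hzT, hzc⟩ := exists_reach_exchange hn hx ht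
    (fun h => by
      have h4 := hA i le_rfl (by omega)
      have h5 := hB k le_rfl (by omega)
      rw [h] at h4
      omega) (by omega) (by omega) a1 a3
    (fun h => hreg.two_out i (hA i le_rfl (by omega)) (hB _ (by omega) (by omega))) a2 a4
    (fun h => hreg.two_in k (hA _ (by omega) (by omega)) (hB k le_rfl (by omega))) a5 a6
  refine hxz.trans (ih _ (sum_abs_sub_exchange_lt ht hA hB hFI) hz
    (fun e => F e - (edgeFlow i t e - edgeFlow k t e))
    (fun e he => hF e fun h => he (sub_exchange_eq_zero hA hB h))
    ((sum_sub_exchange (by omega) hA hB hFI).trans hsum) (fun j => ?_) ?_ (hzT.trans hT) rfl)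
  · rw [← hflow, flowState, hzc]
    simp only [flowState]
    ring
  · simp only [hzc, sum_flowState_exchange _ hF ht hA hB, hc]

/-- Tables with the same number of units, the same sum of columns and the same sum of levels are
connected. -/
theorem reach_of_sums_eq {J K : ℕ} {n x y : ℤ × ℤ → ℤ} (hn : ∀ p, 1 ≤ n p)
    (hx : IsTable J K n x) (hy : IsTable J K n y)
    (h0 : cum (colSum K x) J = cum (colSum K y) J)
    (h1 : levelSum J (colSum K x) = levelSum J (colSum K y))
    (hT : levelTotal J K x = levelTotal J K y) : Relation.ReflTransGen (Step J K n) x y := by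
  have hout : ∀ {p x}, IsTable J K n x → ¬ InBox J K p → x p = 0 := fun h hp => by
    by_contra hc
    exact hp ((h _).2.2 hc)
  rcases Nat.eq_zero_or_pos K with rfl | hK
  · have : x = y := by
      funext p
      have hp : ¬ InBox J 0 p := fun h => by
        have := h.2.2
        push_cast at this
        omega
      rw [hout hx hp, hout hy hp]
    rw [this]
  set z := colSum K x - colSum K y with hz
  have hcol : ∀ {x}, IsTable J K n x → ∀ j : ℤ, j < 1 ∨ J < j → colSum K x j = 0 := by
    intro x h j hj
    rw [colSum, cum]
    refine Finset.sum_eq_zero fun i _ => hout h fun hp => ?_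
    have h1 := hp.1
    have h2 := hp.2.1
    dsimp only at h1 h2
    omega
  have hzlo : ∀ j, j < 1 → z j = 0 := fun j hj => by
    rw [hz, Pi.sub_apply, hcol hx j (Or.inl hj), hcol hy j (Or.inl hj), sub_zero]
  have hzhi : ∀ j : ℤ, J < j → z j = 0 := fun j hj => by
    rw [hz, Pi.sub_apply, hcol hx j (Or.inr hj), hcol hy j (Or.inr hj), sub_zero]
  have hzJ : cum z J = 0 := by rw [hz, cum_sub, h0, sub_self]
  -- The surplus of the columns `1, …, j` has to cross the edge from `j` to `j + 1`. The total of
  -- this flow vanishes because the sums of columns agree.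
  refine reach_of_flow hK hn hy hx (fun j => cum z j.toNat) (fun j hj => ?_) ?_ (fun j => ?_) ?_ hT
  · refine ⟨?_, ?_⟩ <;> by_contra hc
    · exact hj (by rw [show j.toNat = 0 by omega, cum_zero])
    · exact hj (by rw [cum_eq_of_le hzhi (show J ≤ j.toNat by omega), hzJ])
  · rw [sum_Icc_eq_sum_range]
    have h2 := levelSum_eq_sum_cum J z
    rw [hz, levelSum_sub, h1, sub_self, ← hz, Finset.sum_range_succ'] at h2
    simp only [hzJ, cum_zero, zero_sub, neg_zero, add_zero, Finset.sum_neg_distrib] at h2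
    have h3 : ∀ i : ℕ, ((i : ℤ) + 1).toNat = i + 1 := fun i => by omega
    simp only [h3]
    omega
  · have := cum_toNat_sub_one (k := j) hzlo
    simp only [flowState]
    rw [show z j = colSum K x j - colSum K y j from rfl] at this
    omega
  · rw [sum_Icc_eq_sum_range, sum_Icc_eq_sum_range]
    exact h0

/-! ### The sufficient statistic -/

theorem statistic_eq_sufficientStatistic {J K : ℕ} (x : Cell J K → ℕ) :
    statistic x = sufficientStatistic x := by
  funext r
  rcases r with (r | r) | ⟨j, k⟩
  · fin_cases r
    · simp [statistic, config, lawrenceLifting, segreProduct, poissonConfig, sufficientStatistic,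
        Matrix.mulVec, dotProduct, Fintype.sum_prod_type]
    · simp [statistic, config, lawrenceLifting, segreProduct, poissonConfig, sufficientStatistic,
        Matrix.mulVec, dotProduct, Fintype.sum_prod_type, Finset.mul_sum]
  · fin_cases r
    · simp [statistic, config, lawrenceLifting, segreProduct, poissonConfig, sufficientStatistic,
        Matrix.mulVec, dotProduct, Fintype.sum_prod_type]
    · simp [statistic, config, lawrenceLifting, segreProduct, poissonConfig, sufficientStatistic,
        Matrix.mulVec, dotProduct, Fintype.sum_prod_type, Finset.mul_sum]
      exact Finset.sum_comm
  · simp [statistic, config, lawrenceLifting, sufficientStatistic, Matrix.mulVec, dotProduct,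
      Fintype.sum_prod_type, responseMarginal, Matrix.one_apply, Prod.ext_iff, ite_and]

/-- The statistic consists of the number of successes, the sums of their first and of their second
levels, and the response marginals. -/
theorem statistic_eq_iff {J K : ℕ} {x y : Cell J K → ℕ} :
    statistic x = statistic y ↔
      ∑ j : Fin J, ∑ k : Fin K, (x (0, (j, k)) : ℤ) = ∑ j : Fin J, ∑ k : Fin K, (y (0, (j, k)) : ℤ) ∧
      ∑ j : Fin J, (((j : ℕ) : ℤ) + 1) * ∑ k : Fin K, (x (0, (j, k)) : ℤ) =
        ∑ j : Fin J, (((j : ℕ) : ℤ) + 1) * ∑ k : Fin K, (y (0, (j, k)) : ℤ) ∧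
      ∑ k : Fin K, (((k : ℕ) : ℤ) + 1) * ∑ j : Fin J, (x (0, (j, k)) : ℤ) =
        ∑ k : Fin K, (((k : ℕ) : ℤ) + 1) * ∑ j : Fin J, (y (0, (j, k)) : ℤ) ∧
      ∀ j k, responseMarginal x j k = responseMarginal y j k := by
  rw [statistic_eq_sufficientStatistic, statistic_eq_sufficientStatistic]
  constructor
  · intro h
    exact ⟨congrFun h (Sum.inl (Sum.inl 0)), congrFun h (Sum.inl (Sum.inl 1)),
      congrFun h (Sum.inl (Sum.inr 1)), fun j k => by
        have := congrFun h (Sum.inr (j, k))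
        simpa [sufficientStatistic] using this⟩
  · rintro ⟨h1, h2, h3, h4⟩
    simp only [sufficientStatistic, h1, h2, h3, h4]

/-! ### The likelihood -/

/-- Exponential family form, from `p ^ a * (1 - p) ^ b = (1 - p) ^ (a + b) * (p / (1 - p)) ^ a`:
apart from the binomial coefficients and a factor depending on the response marginals, only the
exponent sees the table. -/
theorem likelihood_eq {J K : ℕ} {p : Fin J → Fin K → ℝ} (hp : ∀ j k, 0 < p j k ∧ p j k < 1)
    {μ α β : ℝ} (h : ∀ j k,
      Real.log (p j k / (1 - p j k)) = μ + α * ((j : ℕ) + 1 : ℝ) + β * ((k : ℕ) + 1 : ℝ))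
    (x : Cell J K → ℕ) :
    likelihood p x = (∏ j, ∏ k, ((responseMarginal x j k).choose (x (0, (j, k))) : ℝ)) *
      (∏ j, ∏ k, (1 - p j k) ^ responseMarginal x j k) *
      Real.exp (μ * ((∑ j : Fin J, ∑ k : Fin K, (x (0, (j, k)) : ℤ) : ℤ) : ℝ) +
        α * ((∑ j : Fin J, (((j : ℕ) : ℤ) + 1) * ∑ k : Fin K, (x (0, (j, k)) : ℤ) : ℤ) : ℝ) +
        β * ((∑ k : Fin K, (((k : ℕ) : ℤ) + 1) * ∑ j : Fin J, (x (0, (j, k)) : ℤ) : ℤ) : ℝ)) := by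
  have e : μ * ((∑ j : Fin J, ∑ k : Fin K, (x (0, (j, k)) : ℤ) : ℤ) : ℝ) +
        α * ((∑ j : Fin J, (((j : ℕ) : ℤ) + 1) * ∑ k : Fin K, (x (0, (j, k)) : ℤ) : ℤ) : ℝ) +
        β * ((∑ k : Fin K, (((k : ℕ) : ℤ) + 1) * ∑ j : Fin J, (x (0, (j, k)) : ℤ) : ℤ) : ℝ) =
      ∑ j : Fin J, ∑ k : Fin K, (x (0, (j, k)) : ℝ) * Real.log (p j k / (1 - p j k)) := by
    push_cast
    simp only [h, Finset.mul_sum]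
    rw [Finset.sum_comm (s := (Finset.univ : Finset (Fin K)))]
    simp only [← Finset.sum_add_distrib]
    exact Finset.sum_congr rfl fun j _ => Finset.sum_congr rfl fun k _ => by ring
  rw [e, Real.exp_sum, likelihood]
  simp only [Real.exp_sum, ← Finset.prod_mul_distrib]
  refine Finset.prod_congr rfl fun j _ => Finset.prod_congr rfl fun k _ => ?_
  have h1 : 0 < 1 - p j k := sub_pos.2 (hp j k).2
  rw [Real.exp_nat_mul, Real.exp_log (div_pos (hp j k).1 h1), responseMarginal, Fin.sum_univ_two,
    pow_add, div_pow]
  field_simp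

theorem exists_mem_model (J K : ℕ) (μ α β : ℝ) :
    ∃ p ∈ model J K, ∀ j k,
      Real.log (p j k / (1 - p j k)) = μ + α * ((j : ℕ) + 1 : ℝ) + β * ((k : ℕ) + 1 : ℝ) := by
  set η : Fin J → Fin K → ℝ := fun j k => μ + α * ((j : ℕ) + 1 : ℝ) + β * ((k : ℕ) + 1 : ℝ)
  have hpos : ∀ j k, 0 < Real.exp (η j k) := fun j k => Real.exp_pos _
  have hlog : ∀ j k, Real.log (Real.exp (η j k) / (1 + Real.exp (η j k)) /
      (1 - Real.exp (η j k) / (1 + Real.exp (η j k)))) = η j k := fun j k => by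
    have h1 := hpos j k
    have h2 : Real.exp (η j k) / (1 + Real.exp (η j k)) /
      (1 - Real.exp (η j k) / (1 + Real.exp (η j k))) = Real.exp (η j k) := by
      have h3 : 1 - Real.exp (η j k) / (1 + Real.exp (η j k)) = 1 / (1 + Real.exp (η j k)) := by
        field_simp
        ring
      rw [h3]
      field_simp
    rw [h2, Real.log_exp]
  refine ⟨fun j k => Real.exp (η j k) / (1 + Real.exp (η j k)),
    ⟨fun j k => ⟨div_pos (hpos j k) (by linarith [hpos j k]), ?_⟩, μ, α, β, hlog⟩, hlog⟩
  rw [div_lt_one (by linarith [hpos j k])]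
  linarith

theorem prod_choose_pos {J K : ℕ} (x : Cell J K → ℕ) :
    0 < ∏ j, ∏ k, ((responseMarginal x j k).choose (x (0, (j, k))) : ℝ) :=
  Finset.prod_pos fun j _ => Finset.prod_pos fun k _ => Nat.cast_pos.2 <| Nat.choose_pos <| by
    rw [responseMarginal, Fin.sum_univ_two]
    exact Nat.le_add_right _ _

theorem statistic_eq_iff_likelihood {J K : ℕ} {x y : Cell J K → ℕ}
    (hm : ∀ j k, responseMarginal x j k = responseMarginal y j k) :
    statistic x = statistic y ↔
      ∃ r : ℝ, ∀ p ∈ model J K, likelihood p x = r * likelihood p y := by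
  have hx := prod_choose_pos x
  have hy := prod_choose_pos y
  rw [statistic_eq_iff]
  constructor
  · rintro ⟨h1, h2, h3, -⟩
    refine ⟨(∏ j, ∏ k, ((responseMarginal x j k).choose (x (0, (j, k))) : ℝ)) /
      ∏ j, ∏ k, ((responseMarginal y j k).choose (y (0, (j, k))) : ℝ), ?_⟩
    rintro p ⟨hp, μ, α, β, h⟩
    rw [likelihood_eq hp h, likelihood_eq hp h, h1, h2, h3]
    simp only [hm] at hx ⊢
    field_simp
  · rintro ⟨r, hr⟩
    have key : ∀ μ α β : ℝ,
        (∏ j, ∏ k, ((responseMarginal x j k).choose (x (0, (j, k))) : ℝ)) *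
        Real.exp (μ * ((∑ j : Fin J, ∑ k : Fin K, (x (0, (j, k)) : ℤ) : ℤ) : ℝ) +
          α * ((∑ j : Fin J, (((j : ℕ) : ℤ) + 1) * ∑ k : Fin K, (x (0, (j, k)) : ℤ) : ℤ) : ℝ) +
          β * ((∑ k : Fin K, (((k : ℕ) : ℤ) + 1) * ∑ j : Fin J, (x (0, (j, k)) : ℤ) : ℤ) : ℝ)) =
        r * (∏ j, ∏ k, ((responseMarginal y j k).choose (y (0, (j, k))) : ℝ)) *
        Real.exp (μ * ((∑ j : Fin J, ∑ k : Fin K, (y (0, (j, k)) : ℤ) : ℤ) : ℝ) +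
          α * ((∑ j : Fin J, (((j : ℕ) : ℤ) + 1) * ∑ k : Fin K, (y (0, (j, k)) : ℤ) : ℤ) : ℝ) +
          β * ((∑ k : Fin K, (((k : ℕ) : ℤ) + 1) * ∑ j : Fin J, (y (0, (j, k)) : ℤ) : ℤ) : ℝ)) := by
      intro μ α β
      obtain ⟨p, hp, h⟩ := exists_mem_model J K μ α β
      have h1 := hr p hp
      rw [likelihood_eq hp.1 h, likelihood_eq hp.1 h] at h1
      have h2 : 0 < ∏ j, ∏ k, (1 - p j k) ^ responseMarginal y j k :=
        Finset.prod_pos fun j _ => Finset.prod_pos fun k _ => pow_pos (sub_pos.2 (hp.1 j k).2) _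
      have h3 : ∏ j, ∏ k, (1 - p j k) ^ responseMarginal x j k =
          ∏ j, ∏ k, (1 - p j k) ^ responseMarginal y j k := by simp only [hm]
      rw [h3] at h1
      refine mul_right_cancel₀ h2.ne' ?_
      linear_combination h1
    -- At `μ = α = β = 0` the exponentials are `1`, which determines the constant. The unit
    -- parameter vectors then isolate the three remaining coordinates.
    have h0 := key 0 0 0
    simp only [zero_mul, add_zero, Real.exp_zero, mul_one] at h0
    simp only [← h0] at key
    have key' := fun μ α β => Real.exp_injective (mul_left_cancel₀ hx.ne' (key μ α β))
    refine ⟨?_, ?_, ?_, hm⟩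
    · exact_mod_cast (by simpa using key' 1 0 0 :)
    · exact_mod_cast (by simpa using key' 0 1 0 :)
    · exact_mod_cast (by simpa using key' 0 0 1 :)

/-! ### Tables of successes -/

/-- The position of a pair of indices on the grid. -/
def position {J K : ℕ} (c : Fin J × Fin K) : ℤ × ℤ := (((c.1 : ℕ) : ℤ) + 1, ((c.2 : ℕ) : ℤ) + 1)

open Classical in
/-- The extension of `f` to the plane by the constant `d`. -/
noncomputable def extend {J K : ℕ} (d : ℤ) (f : Fin J × Fin K → ℤ) (p : ℤ × ℤ) : ℤ :=
  if h : ∃ c, position c = p then f h.choose else d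

theorem position_injective {J K : ℕ} :
    Function.Injective (position : Fin J × Fin K → ℤ × ℤ) := by
  rintro ⟨j, k⟩ ⟨j', k'⟩ h
  simp only [position, Prod.mk.injEq] at h
  refine Prod.ext (Fin.ext ?_) (Fin.ext ?_) <;> dsimp only <;> omega

theorem exists_position_iff {J K : ℕ} {p : ℤ × ℤ} :
    (∃ c : Fin J × Fin K, position c = p) ↔ InBox J K p := by
  constructor
  · rintro ⟨⟨j, k⟩, rfl⟩
    have := j.2
    have := k.2
    refine ⟨?_, ?_, ?_, ?_⟩ <;> simp only [position] <;> omega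
  · rintro ⟨h1, h2, h3, h4⟩
    refine ⟨(⟨(p.1 - 1).toNat, by omega⟩, ⟨(p.2 - 1).toNat, by omega⟩), ?_⟩
    simp only [position]
    refine Prod.ext ?_ ?_ <;> dsimp only <;> omega

theorem extend_position {J K : ℕ} (d : ℤ) (f : Fin J × Fin K → ℤ) (c : Fin J × Fin K) :
    extend d f (position c) = f c := by
  have h : ∃ c', position c' = position c := ⟨c, rfl⟩
  rw [extend, dif_pos h, position_injective h.choose_spec]

theorem extend_of_not_inBox {J K : ℕ} (d : ℤ) (f : Fin J × Fin K → ℤ) {p : ℤ × ℤ}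
    (hp : ¬ InBox J K p) : extend d f p = d := by
  rw [extend, dif_neg (mt exists_position_iff.1 hp)]

theorem isTable_extend {J K : ℕ} {f g : Fin J × Fin K → ℤ} (h0 : ∀ c, 0 ≤ f c)
    (h1 : ∀ c, f c ≤ g c) : IsTable J K (extend 1 g) (extend 0 f) := fun p => by
  by_cases hp : InBox J K p
  · obtain ⟨c, rfl⟩ := exists_position_iff.2 hp
    rw [extend_position, extend_position]
    exact ⟨h0 c, h1 c, fun _ => hp⟩
  · rw [extend_of_not_inBox _ _ hp, extend_of_not_inBox _ _ hp]
    exact ⟨le_rfl, zero_le_one, fun h => absurd rfl h⟩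

theorem colSum_extend {J K : ℕ} (d : ℤ) (f : Fin J × Fin K → ℤ) (j : Fin J) :
    colSum K (extend d f) (((j : ℕ) : ℤ) + 1) = ∑ k : Fin K, f (j, k) := by
  rw [colSum, cum, Finset.sum_range]
  exact Finset.sum_congr rfl fun k _ => extend_position d f (j, k)

theorem cum_colSum_extend {J K : ℕ} (d : ℤ) (f : Fin J × Fin K → ℤ) :
    cum (colSum K (extend d f)) J = ∑ j : Fin J, ∑ k : Fin K, f (j, k) := by
  rw [cum, Finset.sum_range]
  exact Finset.sum_congr rfl fun j _ => colSum_extend d f j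

theorem levelSum_colSum_extend {J K : ℕ} (d : ℤ) (f : Fin J × Fin K → ℤ) :
    levelSum J (colSum K (extend d f)) =
      ∑ j : Fin J, (((j : ℕ) : ℤ) + 1) * ∑ k : Fin K, f (j, k) := by
  rw [levelSum, Finset.sum_range]
  exact Finset.sum_congr rfl fun j _ => by rw [colSum_extend]

theorem levelTotal_extend {J K : ℕ} (d : ℤ) (f : Fin J × Fin K → ℤ) :
    levelTotal J K (extend d f) =
      ∑ k : Fin K, (((k : ℕ) : ℤ) + 1) * ∑ j : Fin J, f (j, k) := by
  rw [levelTotal, sum_Icc_eq_sum_range, Finset.sum_range]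
  simp only [Finset.mul_sum]
  rw [Finset.sum_comm (s := (Finset.univ : Finset (Fin K)))]
  refine Finset.sum_congr rfl fun j _ => ?_
  rw [levelSum, Finset.sum_range]
  exact Finset.sum_congr rfl fun k _ =>
    congrArg (fun z => (((k : ℕ) : ℤ) + 1) * z) (extend_position d f (j, k))

/-- The table with the successes `t` and the response marginals `m`. -/
def ofSuccesses {J K : ℕ} (m : Fin J → Fin K → ℕ) (t : ℤ × ℤ → ℤ) (c : Cell J K) : ℕ :=
  if c.1 = 0 then (t (position c.2)).toNat else m c.2.1 c.2.2 - (t (position c.2)).toNat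

theorem ofSuccesses_extend {J K : ℕ} {m : Fin J → Fin K → ℕ} {x : Cell J K → ℕ}
    (hx : ∀ j k, responseMarginal x j k = m j k) :
    ofSuccesses m (extend 0 fun c => (x (0, c) : ℤ)) = x := by
  funext ⟨i, c⟩
  have h := hx c.1 c.2
  rw [responseMarginal, Fin.sum_univ_two] at h
  simp only [ofSuccesses, extend_position, Int.toNat_natCast]
  fin_cases i
  · rfl
  · simp only [Fin.mk_one, Fin.isValue, one_ne_zero, if_false]
    exact Nat.sub_eq_of_eq_add' h.symm

theorem arrayE_zero {J K : ℕ} (a c : Fin J × Fin K) :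
    arrayE a.1 a.2 (0, c) = unit (position a) (position c) := by
  simp only [arrayE, Pi.sub_apply, Pi.single_apply, unit, position_injective.eq_iff]
  simp

theorem arrayE_one {J K : ℕ} (a c : Fin J × Fin K) :
    arrayE a.1 a.2 (1, c) = - unit (position a) (position c) := by
  simp only [arrayE, Pi.sub_apply, Pi.single_apply, unit, position_injective.eq_iff]
  simp

theorem config_mulVec_arrayE {J K : ℕ} (a : Fin J × Fin K) :
    (config J K).mulVec (arrayE a.1 a.2) =
      Sum.elim (Sum.elim ![1, (position a).1] ![1, (position a).2]) 0 := by
  rw [arrayE, Matrix.mulVec_sub, Matrix.mulVec_single_one, Matrix.mulVec_single_one]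
  funext r
  rcases r with (r | r) | c
  · fin_cases r <;>
      simp [config, lawrenceLifting, segreProduct, poissonConfig, position, Matrix.col]
  · fin_cases r <;>
      simp [config, lawrenceLifting, segreProduct, poissonConfig, position, Matrix.col]
  · simp [config, lawrenceLifting, Matrix.col]

theorem mem_moves {J K : ℕ} {a₁ a₂ c₁ c₂ : Fin J × Fin K}
    (h : position a₁ + position a₂ = position c₁ + position c₂) :
    arrayE c₁.1 c₁.2 - arrayE a₁.1 a₁.2 - arrayE a₂.1 a₂.2 + arrayE c₂.1 c₂.2 ∈ moves J K := by
  have h1 := congrArg Prod.fst h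
  have h2 := congrArg Prod.snd h
  simp only [Prod.fst_add, Prod.snd_add] at h1 h2
  refine ⟨?_, c₁.1, a₁.1, a₂.1, c₂.1, c₁.2, a₁.2, a₂.2, c₂.2, rfl, ?_, ?_⟩
  · rw [Matrix.mulVec_add, Matrix.mulVec_sub, Matrix.mulVec_sub, config_mulVec_arrayE,
      config_mulVec_arrayE, config_mulVec_arrayE, config_mulVec_arrayE]
    funext r
    rcases r with (r | r) | c
    · fin_cases r <;> simp
      omega
    · fin_cases r <;> simp
      omega
    · simp
  · simp only [position] at h1
    omega
  · simp only [position] at h2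
    omega

/-- The failures are `m` minus the successes, so they change oppositely. As both tables lie between
`0` and `m`, neither `toNat` nor the truncated subtraction loses anything. -/
theorem Step.exists_move {J K : ℕ} {m : Fin J → Fin K → ℕ} {t t' : ℤ × ℤ → ℤ}
    (h : Step J K (extend 1 fun c => (m c.1 c.2 : ℤ)) t t') :
    ∃ z ∈ moves J K, ∀ c, (ofSuccesses m t' c : ℤ) = ofSuccesses m t c + z c := by
  obtain ⟨ht, ht', p₁, p₂, q₁, q₂, b1, b2, b3, b4, hpq, rfl⟩ := h
  obtain ⟨a₁, rfl⟩ := exists_position_iff.2 b1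
  obtain ⟨a₂, rfl⟩ := exists_position_iff.2 b2
  obtain ⟨c₁, rfl⟩ := exists_position_iff.2 b3
  obtain ⟨c₂, rfl⟩ := exists_position_iff.2 b4
  refine ⟨_, mem_moves hpq, ?_⟩
  rintro ⟨i, c⟩
  have h1 := ht (position c)
  have h2 := ht' (position c)
  rw [extend_position] at h1 h2
  simp only [Pi.add_apply, Pi.sub_apply] at h1 h2
  fin_cases i
  · simp only [Fin.zero_eta, Pi.add_apply, Pi.sub_apply, arrayE_zero, ofSuccesses, if_true]
    omega
  · simp only [Fin.mk_one, Pi.add_apply, Pi.sub_apply, arrayE_one, ofSuccesses, one_ne_zero,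
      if_false]
    omega

theorem statistic_eq_of_move {J K : ℕ} {u v : Cell J K → ℕ} {z : Cell J K → ℤ}
    (hz : z ∈ moves J K) (h : ∀ c, (v c : ℤ) = u c + z c) : statistic v = statistic u := by
  have : (fun c => (v c : ℤ)) = (fun c => (u c : ℤ)) + z := funext h
  rw [statistic, this, Matrix.mulVec_add, hz.1, add_zero, statistic]

/-- The moves connect the fibers of the tables with positive response marginals. -/
theorem connects_fiber {J K : ℕ} {b : StatIndex J K → ℤ}
    (hb : ∀ x ∈ fiber b, ∀ j k, 0 < responseMarginal x j k) :
    Connects (moves J K) (fiber b) := by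
  intro x hx y hy
  have hxy : statistic x = statistic y := Eq.trans hx (Eq.symm hy)
  obtain ⟨h1, h2, h3, h4⟩ := statistic_eq_iff.1 hxy
  set m := responseMarginal x with hm
  set n : ℤ × ℤ → ℤ := extend 1 fun c : Fin J × Fin K => (m c.1 c.2 : ℤ) with hn
  -- The default capacity `1` off the grid gives positivity on the whole plane; tables vanish there
  -- anyway.
  have hn1 : ∀ p, 1 ≤ n p := fun p => by
    by_cases hp : InBox J K p
    · obtain ⟨c, rfl⟩ := exists_position_iff.2 hp
      rw [hn, extend_position]
      exact_mod_cast hb x hx c.1 c.2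
    · rw [hn, extend_of_not_inBox _ _ hp]
  have htab : ∀ w : Cell J K → ℕ, (∀ j k, responseMarginal w j k = m j k) →
      IsTable J K n (extend 0 fun c => (w (0, c) : ℤ)) := fun w hw =>
    isTable_extend (fun _ => Int.natCast_nonneg _) fun c => by
      rw [← hw, responseMarginal, Fin.sum_univ_two]
      exact_mod_cast Nat.le_add_right _ _
  have hreach := reach_of_sums_eq hn1 (htab x fun _ _ => rfl) (htab y fun j k => (h4 j k).symm)
    (by rw [cum_colSum_extend, cum_colSum_extend]; exact h1)
    (by rw [levelSum_colSum_extend, levelSum_colSum_extend]; exact h2)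
    (by rw [levelTotal_extend, levelTotal_extend]; exact h3)
  have hgoal : ∀ t, Relation.ReflTransGen (Step J K n) (extend 0 fun c => (x (0, c) : ℤ)) t →
      ofSuccesses m t ∈ fiber b ∧ Relation.ReflTransGen (fun u v : Cell J K → ℕ =>
        u ∈ fiber b ∧ v ∈ fiber b ∧ ∃ z ∈ moves J K, ∀ c, (v c : ℤ) = (u c : ℤ) + z c) x
        (ofSuccesses m t) := by
    intro t ht
    induction ht with
    | refl =>
      rw [ofSuccesses_extend fun _ _ => rfl]
      exact ⟨hx, .refl⟩
    | tail _ hstep ih =>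
      obtain ⟨z, hz, hadd⟩ := hstep.exists_move
      have hmem := (statistic_eq_of_move hz hadd).trans ih.1
      exact ⟨hmem, ih.2.tail ⟨ih.1, hmem, z, hz, hadd⟩⟩
  have := (hgoal _ hreach).2
  rwa [ofSuccesses_extend fun j k => (h4 j k).symm] at this

end BivariateLogistic

theorem mainTheorem1 (J K : ℕ) :
    (∀ x : BivariateLogistic.Cell J K → ℕ,
      BivariateLogistic.statistic x = BivariateLogistic.sufficientStatistic x) ∧
    (∀ x y : BivariateLogistic.Cell J K → ℕ,
      (∀ j k, BivariateLogistic.responseMarginal x j k =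
        BivariateLogistic.responseMarginal y j k) →
      (BivariateLogistic.statistic x = BivariateLogistic.statistic y ↔
        ∃ r : ℝ, ∀ p ∈ BivariateLogistic.model J K,
          BivariateLogistic.likelihood p x = r * BivariateLogistic.likelihood p y)) ∧
    (∀ b : BivariateLogistic.StatIndex J K → ℤ,
      (∀ x ∈ BivariateLogistic.fiber b, ∀ j k,
        0 < BivariateLogistic.responseMarginal x j k) →
      BivariateLogistic.Connects (BivariateLogistic.moves J K) (BivariateLogistic.fiber b)) :=
  ⟨fun x => BivariateLogistic.statistic_eq_sufficientStatistic x,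
    fun _ _ hm => BivariateLogistic.statistic_eq_iff_likelihood hm,
    fun _ hb => BivariateLogistic.connects_fiber hb⟩
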